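/- Let $K$ be a field of characteristic $0$, $\Gamma$ a finite abelian group, $H=K[\Gamma]$, and let $W=\bigoplus_{i=1}^{\theta}Kx_i$ be a quantum linear space: $x_i$ has degree $g_i\in\Gamma$ and character $\chi_i:\Gamma\to K^{\times}$, with $\chi_i(g_j)\chi_j(g_i)=1$ for $i\ne j$, and $\chi_i(g_i)$ is a primitive $r_i$-th root of unity, $r_i\ge 2$. A *lifting datum* consists of scalars $a_i\in K$ ($1\le i\le\theta$) and $a_{ij}\in K$ ($i\neq j$) such that $a_i\ne0$ implies $g_i^{r_i}\ne1$ and $\chi_i^{r_i}=1$; $a_{ij}\neq 0$ implies $g_ig_j\neq1$ and $\chi_i\chi_j=1$; and $a_{ji}=-\chi_i(g_j)a_{ij}$. The lifting $B=A(a_i,a_{ij})$ is the algebra generated by $\Gamma$ and $x_1,\dots,x_\theta$ with the relations of $\Gamma$ and $$hx_i=\chi_i(h)x_ih,\qquad x_i^{r_i}=a_i(1-g_i^{r_i}),\qquad x_ix_j=\chi_j(g_i)x_jx_i+a_{ij}(1-g_ig_j)\ (i\ne j),$$ with the bialgebra structure in which each $h\in\Gamma$ is grouplike and $\Delta(x_i)=x_i\otimes1+g_i\otimes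 x_i$, $\varepsilon(x_i)=0$. Let $A=\mathcal B(W)\# K[\Gamma]$, i.e. the lifting with all scalars $0$; it has the basis $Xh$ with $h\in\Gamma$ and $X=x_1^{n_1}\cdots x_\theta^{n_\theta}$, $0\le n_i<r_i$. $Z^2_H(A,K)$ is the set of convolution invertible linear maps $\gamma:A\otimes A\to K$ with $\gamma(y_{(1)}\otimes z_{(1)})\gamma(x\otimes y_{(2)}z_{(2)})=\gamma(x_{(1)}\otimes y_{(1)})\gamma(x_{(2)}y_{(2)}\otimes z)$, $\gamma(x\otimes1)=\gamma(1\otimes x)=\varepsilon(x)$ and $\gamma(hx\otimes yh')=\varepsilon(h)\varepsilon(h')\gamma(x\otimes y)$ for $x,y,z\in A$ and $h,h'\in H$. For such $\gamma$, $A^\gamma$ is the coalgebra $A$ with the same unit and the multiplication $\gamma * m_A * \gamma^{-1}$, where $*$ is the convolution product. Define $H$-bilinear maps $\gamma_i$ and $\gamma_{ij}$ ($i<j$) from $A\otimes A$ to $K$ by their values on pairs $X\otimes Y$ of monomials as above: they agree with $\varepsilon\otimes\varepsilon$, except that $$\gamma_i(x_i^m\otimes x_i^{r_i-m})=a_i\quad(0<m<r_i),\qquad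 \gamma_{ij}(x_j^m\otimes x_i^m)=(m)!_{q_i}\,a_{ji}^m\quad(0\le m<r_i,\ q_i=\chi_i(g_i)).$$ Let $C_\tau$ ($\tau\in T$) be the connected components of the graph with vertices $1,\dots,\theta$ and an edge between $i\ne j$ if $a_{ij}\ne0$. Put $$\alpha_\tau=\Big(\prod_{i<j,\ i,j\in C_\tau}\gamma_{ij}\Big) * \Big(\prod_{i\in C_\tau}\gamma_i\Big),\qquad \alpha=\prod_{\tau\in T}\alpha_\tau ,$$ all products being convolution products (so $\alpha_\tau=\gamma_i$ if $C_\tau=\{i\}$, and $\alpha_\tau=\gamma_{ij}*\gamma_i*\gamma_j$ if $C_\tau=\{i,j\}$ with $i<j$). Then, for every lifting datum and for every choice of the order of the factors inside each of these products $\prod$, $\alpha\in Z^2_H(A,K)$ and $A^\alpha\cong B$ as bialgebras. -/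

import Mathlib

open scoped TensorProduct
open TensorProduct WithConv

noncomputable section

namespace QLS

/-! ### `q`-numbers -/

/-- The `q`-integer `(n)_q = 1 + q + ⋯ + q^(n-1)`. -/
def qInt {K : Type*} [CommSemiring K] (q : K) (n : ℕ) : K := ∑ k ∈ Finset.range n, q ^ k

/-- The `q`-factorial `(n)!_q = (1)_q (2)_q ⋯ (n)_q`. -/
def qFact {K : Type*} [CommSemiring K] (q : K) (n : ℕ) : K := ∏ k ∈ Finset.range n, qInt q (k + 1)

/-- The `q`-binomial coefficients, by the `q`-Pascal recursion. -/
def qBinom {K : Type*} [CommRing K] (q : K) : ℕ → ℕ → K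
  | _, 0 => 1
  | 0, _ + 1 => 0
  | n + 1, k + 1 => qBinom q n k + q ^ (k + 1) * qBinom q n (k + 1)

theorem qBinom_zero_right {K : Type*} [CommRing K] (q : K) (n : ℕ) : qBinom q n 0 = 1 := by
  cases n <;> simp [qBinom]

theorem qBinom_succ {K : Type*} [CommRing K] (q : K) (n k : ℕ) :
    qBinom q (n + 1) (k + 1) = qBinom q n k + q ^ (k + 1) * qBinom q n (k + 1) := by
  simp [qBinom]

theorem qBinom_eq_zero {K : Type*} [CommRing K] (q : K) :
    ∀ n k : ℕ, n < k → qBinom q n k = 0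
  | 0, k + 1, _ => by simp [qBinom]
  | n + 1, k + 1, h => by
      rw [qBinom_succ, qBinom_eq_zero q n k (by omega), qBinom_eq_zero q n (k + 1) (by omega)]
      simp

theorem qBinom_self {K : Type*} [CommRing K] (q : K) (n : ℕ) : qBinom q n n = 1 := by
  induction n with
  | zero => simp [qBinom]
  | succ n ih => rw [qBinom_succ, ih, qBinom_eq_zero q n (n + 1) (by omega)]; simp

theorem qBinom_mul {K : Type*} [CommRing K] (q : K) (n k : ℕ) :
    (q ^ (k + 1) - 1) * qBinom q (n + 1) (k + 1) = (q ^ (n + 1) - 1) * qBinom q n k := by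
  induction n generalizing k with
  | zero =>
    cases k with
    | zero => simp [qBinom]
    | succ k => simp [qBinom]
  | succ n ih =>
    cases k with
    | zero =>
      have h := ih 0
      rw [qBinom_zero_right] at h
      rw [qBinom_succ, qBinom_zero_right]
      linear_combination q * h
    | succ k =>
      have h1 := ih (k + 1)
      have h2 := ih k
      have h3 := qBinom_succ q n k
      rw [qBinom_succ q (n + 1) (k + 1)]
      linear_combination q ^ (k + 1 + 1) * h1 + q * h2 - (q ^ (n + 2) - q) * h3

theorem qBinom_root {K : Type*} [Field K] {q : K} {r : ℕ} (hq : IsPrimitiveRoot q r) {k : ℕ}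
    (h0 : 0 < k) (hk : k < r) : qBinom q r k = 0 := by
  obtain ⟨k, rfl⟩ : ∃ j, k = j + 1 := ⟨k - 1, by omega⟩
  obtain ⟨r, rfl⟩ : ∃ j, r = j + 1 := ⟨r - 1, by omega⟩
  have h := qBinom_mul q r k
  rw [hq.pow_eq_one, sub_self, zero_mul] at h
  refine (mul_eq_zero.mp h).resolve_left (sub_ne_zero.mpr ?_)
  exact hq.pow_ne_one_of_pos_of_lt (by omega) hk

/-- The `q`-binomial theorem for `q`-commuting elements. -/
theorem add_pow_qComm {K S : Type*} [Field K] [Ring S] [Algebra K S] {q : K} {u v : S}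
    (h : v * u = q • (u * v)) (n : ℕ) :
    (u + v) ^ n = ∑ k ∈ Finset.range (n + 1), qBinom q n k • (u ^ k * v ^ (n - k)) := by
  have hv : ∀ k : ℕ, v * u ^ k = q ^ k • (u ^ k * v) := by
    intro k
    induction k with
    | zero => simp
    | succ k ih =>
      rw [pow_succ, ← mul_assoc, ih, smul_mul_assoc, mul_assoc, h, mul_smul_comm, smul_smul,
        ← mul_assoc, pow_succ]
  induction n with
  | zero => simp [qBinom]
  | succ n ih =>
    rw [pow_succ', ih, Finset.mul_sum, Finset.sum_range_succ' _ (n + 1)]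
    have e : ∀ k ∈ Finset.range (n + 1),
        (u + v) * (qBinom q n k • (u ^ k * v ^ (n - k))) =
          qBinom q n k • (u ^ (k + 1) * v ^ (n + 1 - (k + 1))) +
          (q ^ k * qBinom q n k) • (u ^ k * v ^ (n + 1 - k)) := by
      intro k hk
      have hk' : k ≤ n := by simpa [Nat.lt_succ_iff] using hk
      have e1 : n + 1 - k = n - k + 1 := by omega
      have e2 : n + 1 - (k + 1) = n - k := by omega
      rw [e1, e2, add_mul, mul_smul_comm, mul_smul_comm, ← mul_assoc, ← mul_assoc, hv, ← pow_succ',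
        smul_mul_assoc, smul_smul, mul_assoc (u ^ k) v, ← pow_succ', mul_comm (q ^ k)]
    rw [Finset.sum_congr rfl e, Finset.sum_add_distrib]
    simp only [qBinom_succ, add_smul, Finset.sum_add_distrib, qBinom_zero_right]
    rw [add_assoc]
    congr 1
    rw [Finset.sum_range_succ' (fun k => (q ^ k * qBinom q n k) • (u ^ k * v ^ (n + 1 - k))) n,
      Finset.sum_range_succ _ n]
    simp [qBinom_eq_zero q n (n + 1) (by omega), qBinom_zero_right]

theorem add_pow_primitiveRoot {K S : Type*} [Field K] [Ring S] [Algebra K S] {q : K} {u v : S}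
    (h : v * u = q • (u * v)) {r : ℕ} (hr : 0 < r) (hq : IsPrimitiveRoot q r) :
    (u + v) ^ r = u ^ r + v ^ r := by
  rw [add_pow_qComm h, Finset.sum_range_succ]
  obtain ⟨r, rfl⟩ : ∃ j, r = j + 1 := ⟨r - 1, by omega⟩
  rw [Finset.sum_range_succ', Finset.sum_eq_zero]
  · simp [qBinom_self, qBinom_zero_right, add_comm]
  · intro k hk
    rw [qBinom_root hq (by omega) (by simpa using hk), zero_smul]

/-! ### Quantum linear spaces and their liftings -/

variable {K : Type*} [Field K] {Γ : Type*} [CommGroup Γ] {θ : ℕ}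

/-- The data of a quantum linear space `W = ⊕ K x_i` with `x_i ∈ W_{g_i}^{χ_i}`. -/
structure QuantumLinearSpace (K : Type*) [Field K] (Γ : Type*) [CommGroup Γ] (θ : ℕ) where
  /-- the grouplikes `g_i` -/
  g : Fin θ → Γ
  /-- the characters `χ_i` -/
  χ : Fin θ → Γ →* Kˣ
  /-- the order `r_i` of `χ_i(g_i)` -/
  r : Fin θ → ℕ
  two_le : ∀ i, 2 ≤ r i
  braid : ∀ i j, i ≠ j → χ i (g j) * χ j (g i) = 1
  root : ∀ i, IsPrimitiveRoot (χ i (g i)) (r i)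

namespace QuantumLinearSpace

variable (W : QuantumLinearSpace K Γ θ)

/-- The defining relations, in the free algebra on `Γ` and `x_1, …, x_θ`. -/
inductive Rel (a : Fin θ → K) (b : Fin θ → Fin θ → K) :
    FreeAlgebra K (Γ ⊕ Fin θ) → FreeAlgebra K (Γ ⊕ Fin θ) → Prop
  | one : Rel a b (FreeAlgebra.ι K (Sum.inl 1)) 1
  | mul (h k : Γ) : Rel a b (FreeAlgebra.ι K (Sum.inl h) * FreeAlgebra.ι K (Sum.inl k))
      (FreeAlgebra.ι K (Sum.inl (h * k)))
  | comm (h : Γ) (i : Fin θ) :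
      Rel a b (FreeAlgebra.ι K (Sum.inl h) * FreeAlgebra.ι K (Sum.inr i))
        ((W.χ i h : K) • (FreeAlgebra.ι K (Sum.inr i) * FreeAlgebra.ι K (Sum.inl h)))
  | pow (i : Fin θ) : Rel a b (FreeAlgebra.ι K (Sum.inr i) ^ W.r i)
      (a i • (1 - FreeAlgebra.ι K (Sum.inl (W.g i ^ W.r i))))
  | skew (i j : Fin θ) (hij : i ≠ j) :
      Rel a b (FreeAlgebra.ι K (Sum.inr i) * FreeAlgebra.ι K (Sum.inr j))
        ((W.χ j (W.g i) : K) • (FreeAlgebra.ι K (Sum.inr j) * FreeAlgebra.ι K (Sum.inr i)) +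
          b i j • (1 - FreeAlgebra.ι K (Sum.inl (W.g i * W.g j))))

/-- The algebra `A(a_i, a_ij)`, generated by the grouplikes `h ∈ Γ` and by `x_1, …, x_θ` subject to
`h x_i = χ_i(h) x_i h`, `x_i ^ r_i = a_i (1 - g_i ^ r_i)` and
`x_i x_j = χ_j(g_i) x_j x_i + a_ij (1 - g_i g_j)` for `i ≠ j`. -/
def Lifting (a : Fin θ → K) (b : Fin θ → Fin θ → K) : Type _ := RingQuot (W.Rel a b)

namespace Lifting

variable (a : Fin θ → K) (b : Fin θ → Fin θ → K)

instance : Ring (W.Lifting a b) := inferInstanceAs (Ring (RingQuot (W.Rel a b)))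
instance : Algebra K (W.Lifting a b) := inferInstanceAs (Algebra K (RingQuot (W.Rel a b)))

/-- The quotient map from the free algebra. -/
def mk : FreeAlgebra K (Γ ⊕ Fin θ) →ₐ[K] W.Lifting a b := RingQuot.mkAlgHom K (W.Rel a b)

theorem mk_surjective : Function.Surjective (mk W a b) :=
  RingQuot.mkAlgHom_surjective K (W.Rel a b)

variable {W a b} in
theorem mk_rel {u v : FreeAlgebra K (Γ ⊕ Fin θ)} (h : W.Rel a b u v) :
    mk W a b u = mk W a b v := RingQuot.mkAlgHom_rel K h

/-- The image of `h ∈ Γ`. -/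
def of (h : Γ) : W.Lifting a b := mk W a b (FreeAlgebra.ι K (Sum.inl h))

/-- The generator `x_i`. -/
def x (i : Fin θ) : W.Lifting a b := mk W a b (FreeAlgebra.ι K (Sum.inr i))

theorem of_one : of W a b 1 = 1 := by
  have h := mk_rel (Rel.one (W := W) (a := a) (b := b))
  rwa [map_one] at h

theorem of_mul (h k : Γ) : of W a b h * of W a b k = of W a b (h * k) := by
  have h := mk_rel (Rel.mul (W := W) (a := a) (b := b) h k)
  rwa [map_mul] at h

theorem of_mul_x (h : Γ) (i : Fin θ) :
    of W a b h * x W a b i = (W.χ i h : K) • (x W a b i * of W a b h) := by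
  have h := mk_rel (Rel.comm (W := W) (a := a) (b := b) h i)
  rwa [map_smul, map_mul, map_mul] at h

theorem x_pow (i : Fin θ) : x W a b i ^ W.r i = a i • (1 - of W a b (W.g i ^ W.r i)) := by
  have h := mk_rel (Rel.pow (W := W) (a := a) (b := b) i)
  rwa [map_smul, map_pow, map_sub, map_one] at h

theorem x_mul_x {i j : Fin θ} (hij : i ≠ j) :
    x W a b i * x W a b j = (W.χ j (W.g i) : K) • (x W a b j * x W a b i) +
      b i j • (1 - of W a b (W.g i * W.g j)) := by
  have h := mk_rel (Rel.skew (W := W) (a := a) (b := b) i j hij)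
  rwa [map_add, map_smul, map_smul, map_mul, map_mul, map_sub, map_one] at h

/-- The universal property of the presentation. -/
def lift {S : Type*} [Ring S] [Algebra K S] (G : Γ → S) (X : Fin θ → S)
    (h1 : G 1 = 1) (hm : ∀ h k, G h * G k = G (h * k))
    (hc : ∀ h i, G h * X i = (W.χ i h : K) • (X i * G h))
    (hp : ∀ i, X i ^ W.r i = a i • (1 - G (W.g i ^ W.r i)))
    (hs : ∀ i j, i ≠ j → X i * X j = (W.χ j (W.g i) : K) • (X j * X i) +
      b i j • (1 - G (W.g i * W.g j))) : W.Lifting a b →ₐ[K] S :=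
  RingQuot.liftAlgHom K ⟨FreeAlgebra.lift K (Sum.elim G X), by
    intro u v huv
    cases huv with
    | one => simpa using h1
    | mul h k => simpa using hm h k
    | comm h i => simpa using hc h i
    | pow i => simpa using hp i
    | skew i j hij => simpa using hs i j hij⟩

section
variable {S : Type*} [Ring S] [Algebra K S] (G : Γ → S) (X : Fin θ → S)
    (h1 : G 1 = 1) (hm : ∀ h k, G h * G k = G (h * k))
    (hc : ∀ h i, G h * X i = (W.χ i h : K) • (X i * G h))
    (hp : ∀ i, X i ^ W.r i = a i • (1 - G (W.g i ^ W.r i)))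
    (hs : ∀ i j, i ≠ j → X i * X j = (W.χ j (W.g i) : K) • (X j * X i) +
      b i j • (1 - G (W.g i * W.g j)))

@[simp] theorem lift_of (h : Γ) : lift W a b G X h1 hm hc hp hs (of W a b h) = G h := by
  rw [lift, of, mk]
  erw [RingQuot.liftAlgHom_mkAlgHom_apply]
  simp

@[simp] theorem lift_x (i : Fin θ) : lift W a b G X h1 hm hc hp hs (x W a b i) = X i := by
  rw [lift, x, mk]
  erw [RingQuot.liftAlgHom_mkAlgHom_apply]
  simp

end

variable {W a b} in
theorem algHom_ext {S : Type*} [Semiring S] [Algebra K S] {f f' : W.Lifting a b →ₐ[K] S}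
    (hG : ∀ h, f (of W a b h) = f' (of W a b h)) (hX : ∀ i, f (x W a b i) = f' (x W a b i)) :
    f = f' := by
  apply RingQuot.ringQuot_ext' (S := K)
  apply FreeAlgebra.hom_ext
  funext s
  cases s with
  | inl h => exact hG h
  | inr i => exact hX i

/-- The comultiplication: `h ↦ h ⊗ h` and `x_i ↦ x_i ⊗ 1 + g_i ⊗ x_i`. -/
def comulHom : W.Lifting a b →ₐ[K] W.Lifting a b ⊗[K] W.Lifting a b :=
  lift W a b (fun h => of W a b h ⊗ₜ of W a b h)
    (fun i => x W a b i ⊗ₜ 1 + of W a b (W.g i) ⊗ₜ x W a b i)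
    (by rw [of_one]; rfl)
    (fun h k => by simp [of_mul])
    (fun h i => by
      simp only [mul_add, add_mul, Algebra.TensorProduct.tmul_mul_tmul, of_mul_x, of_mul, mul_one,
        one_mul, smul_add, smul_tmul', tmul_smul, mul_comm])
    (fun i => by
      have hq : IsPrimitiveRoot ((W.χ i (W.g i) : K)) (W.r i) :=
        IsPrimitiveRoot.coe_units_iff.mpr (W.root i)
      have hpow : ∀ n : ℕ, of W a b (W.g i) ^ n = of W a b (W.g i ^ n) := by
        intro n
        induction n with
        | zero => simp [of_one]
        | succ n ih => rw [pow_succ, ih, of_mul, pow_succ]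
      rw [add_pow_primitiveRoot (q := (W.χ i (W.g i) : K)) _ (by have := W.two_le i; omega) hq]
      · simp only [Algebra.TensorProduct.tmul_pow, one_pow, x_pow, hpow, ← smul_tmul', tmul_smul,
          ← smul_add, sub_tmul, tmul_sub, Algebra.TensorProduct.one_def]
        congr 1
        abel
      · simp [of_mul_x, smul_tmul'])
    (fun i j hij => by
      have hb : (W.χ i (W.g j) : K) * (W.χ j (W.g i) : K) = 1 := by
        simpa using congrArg Units.val (W.braid i j hij)
      have hb' : (W.χ j (W.g i) : K) * (W.χ i (W.g j) : K) = 1 := by rw [mul_comm]; exact hb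
      simp only [mul_add, add_mul, Algebra.TensorProduct.tmul_mul_tmul, of_mul_x, of_mul, mul_one,
        one_mul, x_mul_x W a b hij, Algebra.TensorProduct.one_def, tmul_add, add_tmul, tmul_sub,
        sub_tmul, smul_add, smul_sub, smul_tmul', tmul_smul, smul_smul, hb', one_smul,
        mul_comm (W.g j) (W.g i)]
      abel)

@[simp] theorem comulHom_of (h : Γ) :
    comulHom W a b (of W a b h) = of W a b h ⊗ₜ of W a b h := by simp [comulHom]

@[simp] theorem comulHom_x (i : Fin θ) :
    comulHom W a b (x W a b i) = x W a b i ⊗ₜ 1 + of W a b (W.g i) ⊗ₜ x W a b i := by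
  simp [comulHom]

/-- The counit: `h ↦ 1` and `x_i ↦ 0`. -/
def counitHom : W.Lifting a b →ₐ[K] K :=
  lift W a b (fun _ => 1) (fun _ => 0) rfl (by simp) (by simp)
    (fun i => by have := W.two_le i; simp; omega) (by simp)

@[simp] theorem counitHom_of (h : Γ) : counitHom W a b (of W a b h) = 1 := by simp [counitHom]

@[simp] theorem counitHom_x (i : Fin θ) : counitHom W a b (x W a b i) = 0 := by simp [counitHom]

/-- The bialgebra structure in which each `h ∈ Γ` is grouplike and each `x_i` is
`(1, g_i)`-primitive. -/
instance : Bialgebra K (W.Lifting a b) :=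
  Bialgebra.ofAlgHom (comulHom W a b) (counitHom W a b)
    (by
      refine algHom_ext (fun h => by simp) (fun i => ?_)
      simp [add_tmul, tmul_add, Algebra.TensorProduct.one_def, add_assoc])
    (algHom_ext (fun h => by simp) (fun i => by simp))
    (algHom_ext (fun h => by simp) (fun i => by simp))

theorem comul_of (h : Γ) :
    Coalgebra.comul (R := K) (of W a b h) = of W a b h ⊗ₜ[K] of W a b h := comulHom_of W a b h

theorem comul_x (i : Fin θ) : Coalgebra.comul (R := K) (x W a b i) =
    x W a b i ⊗ₜ[K] 1 + of W a b (W.g i) ⊗ₜ[K] x W a b i := comulHom_x W a b i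

theorem counit_of (h : Γ) : Coalgebra.counit (R := K) (of W a b h) = 1 := counitHom_of W a b h

theorem counit_x (i : Fin θ) : Coalgebra.counit (R := K) (x W a b i) = 0 := counitHom_x W a b i

end Lifting

/-! ### The ordered monomials -/

namespace Lifting

variable (a : Fin θ → K) (b : Fin θ → Fin θ → K)

/-- The ordered monomial `x_1 ^ n_1 ⋯ x_θ ^ n_θ`. -/
def mon (n : Fin θ → ℕ) : W.Lifting a b :=
  ((List.finRange θ).map fun i => x W a b i ^ n i).prod

end Lifting

/-- `χ_1^{n_1} ⋯ χ_θ^{n_θ}` evaluated at `h`. -/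
def weight (n : Fin θ → ℕ) (h : Γ) : Kˣ := ∏ i, W.χ i h ^ n i

namespace Lifting

variable (a : Fin θ → K) (b : Fin θ → Fin θ → K)

theorem of_mul_x_pow (h : Γ) (i : Fin θ) (m : ℕ) :
    of W a b h * x W a b i ^ m = ((W.χ i h ^ m : Kˣ) : K) • (x W a b i ^ m * of W a b h) := by
  induction m with
  | zero => simp
  | succ m ih =>
    rw [pow_succ, ← mul_assoc, ih, smul_mul_assoc, mul_assoc, of_mul_x, mul_smul_comm, smul_smul,
      ← mul_assoc, pow_succ (W.χ i h), Units.val_mul]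

theorem of_mul_mon (n : Fin θ → ℕ) (h : Γ) :
    of W a b h * mon W a b n = (W.weight n h : K) • (mon W a b n * of W a b h) := by
  have key : ∀ l : List (Fin θ), of W a b h * (l.map fun i => x W a b i ^ n i).prod =
      (((l.map fun i => W.χ i h ^ n i).prod : Kˣ) : K) •
        ((l.map fun i => x W a b i ^ n i).prod * of W a b h) := by
    intro l
    induction l with
    | nil => simp
    | cons i t ih =>
      simp only [List.map_cons, List.prod_cons]
      rw [← mul_assoc, of_mul_x_pow, smul_mul_assoc, mul_assoc, ih, mul_smul_comm, smul_smul,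
        mul_assoc, Units.val_mul]
  rw [weight, Fin.prod_univ_def]
  exact key (List.finRange θ)

end Lifting

/-- The biproduct `A = B(W) # K[Γ]`, i.e. the trivial lifting, with all scalars equal to `0`: the
Nichols algebra `B(W)` of a quantum linear space is generated by `x_1, …, x_θ` subject to
`x_i ^ r_i = 0` and `x_i x_j = χ_j(g_i) x_j x_i`, and in the smash product with `K[Γ]` one has
`h x_i = χ_i(h) x_i h`. -/
abbrev Biproduct : Type _ := W.Lifting 0 0

namespace Biproduct

open Lifting

/-- The module on which the biproduct acts, with basis indexed by exponents and group elements. -/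
abbrev Rep (_W : QuantumLinearSpace K Γ θ) : Type _ := ((Fin θ → ℕ) × Γ) →₀ K

/-- The scalar arising when `x_i` is moved past `x_1^{n_1} ⋯ x_{i-1}^{n_{i-1}}`. -/
def coef (i : Fin θ) (n : Fin θ → ℕ) : K := ∏ k ∈ Finset.Iio i, (W.χ k (W.g i) : K) ^ n k

/-- The action of `h ∈ Γ`. -/
def opG (h : Γ) : Module.End K (Rep W) :=
  Finsupp.linearCombination K fun p => Finsupp.single (p.1, h * p.2) (W.weight p.1 h : K)

open Classical in
/-- The action of `x_i`. -/
def opX (i : Fin θ) : Module.End K (Rep W) :=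
  Finsupp.linearCombination K fun p =>
    if p.1 i + 1 < W.r i then Finsupp.single (p.1 + Pi.single i 1, p.2) (coef W i p.1) else 0

theorem weight_add_single (n : Fin θ → ℕ) (i : Fin θ) (m : ℕ) (h : Γ) :
    W.weight (n + Pi.single i m) h = W.weight n h * W.χ i h ^ m := by
  simp only [weight, Pi.add_apply, pow_add, Finset.prod_mul_distrib]
  congr 1
  rw [Finset.prod_eq_single i] <;> simp +contextual

theorem coef_add_single (i j : Fin θ) (n : Fin θ → ℕ) (m : ℕ) :
    coef W i (n + Pi.single j m) =
      coef W i n * (if j < i then (W.χ j (W.g i) : K) ^ m else 1) := by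
  simp only [coef, Pi.add_apply, pow_add, Finset.prod_mul_distrib]
  congr 1
  split_ifs with h
  · rw [Finset.prod_eq_single j] <;> simp +contextual [h]
  · refine Finset.prod_eq_one fun k hk => ?_
    have : k ≠ j := by rintro rfl; exact h (by simpa using hk)
    simp [this]

theorem opG_single (h : Γ) (n : Fin θ → ℕ) (k : Γ) (t : K) :
    opG W h (Finsupp.single (n, k) t) = Finsupp.single (n, h * k) (t * W.weight n h) := by
  simp [opG]

theorem opX_single (i : Fin θ) (n : Fin θ → ℕ) (k : Γ) (t : K) :
    opX W i (Finsupp.single (n, k) t) =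
      if n i + 1 < W.r i then Finsupp.single (n + Pi.single i 1, k) (t * coef W i n) else 0 := by
  simp [opX]

theorem opX_pow_single (i : Fin θ) (n : Fin θ → ℕ) (k : Γ) (t : K) (m : ℕ) :
    (opX W i ^ (m + 1)) (Finsupp.single (n, k) t) = if n i + (m + 1) < W.r i then
      Finsupp.single (n + Pi.single i (m + 1), k) (t * coef W i n ^ (m + 1)) else 0 := by
  induction m with
  | zero => simp [opX_single]
  | succ m ih =>
    rw [pow_succ', Module.End.mul_apply, ih]
    split_ifs with h1 h2 h2
    · rw [opX_single, if_pos (by simp; omega), coef_add_single, if_neg (lt_irrefl i), mul_one,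
        add_assoc, ← Pi.single_add, mul_assoc, ← pow_succ]
    · rw [opX_single, if_neg (by simp; omega)]
    · omega
    · simp

/-- The representation of the biproduct. -/
def rep : W.Biproduct →ₐ[K] Module.End K (Rep W) :=
  lift W 0 0 (opG W) (opX W)
    (by
      refine Finsupp.lhom_ext fun p t => ?_
      obtain ⟨n, l⟩ := p
      rw [opG_single]
      simp [weight])
    (fun h k => by
      refine Finsupp.lhom_ext fun p t => ?_
      obtain ⟨n, l⟩ := p
      rw [Module.End.mul_apply, opG_single, opG_single, opG_single, mul_assoc h k l]
      congr 1
      simp only [weight, map_mul, mul_pow, Finset.prod_mul_distrib, Units.val_mul]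
      ring)
    (fun h i => by
      refine Finsupp.lhom_ext fun p t => ?_
      obtain ⟨n, l⟩ := p
      simp only [Module.End.mul_apply, opG_single, opX_single, LinearMap.smul_apply]
      split_ifs
      · rw [opG_single, weight_add_single, Finsupp.smul_single]
        congr 1
        simp
        ring
      · simp)
    (fun i => by
      have h2 := W.two_le i
      refine Finsupp.lhom_ext fun p t => ?_
      obtain ⟨n, l⟩ := p
      obtain ⟨m, hm⟩ : ∃ m, W.r i = m + 1 := ⟨W.r i - 1, by omega⟩
      rw [hm, opX_pow_single, if_neg (by omega)]
      simp)
    (fun i j hij => by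
      refine Finsupp.lhom_ext fun p t => ?_
      obtain ⟨n, l⟩ := p
      have hb : (W.χ j (W.g i) : K) * (W.χ i (W.g j) : K) = 1 := by
        simpa [mul_comm] using congrArg Units.val (W.braid i j hij)
      simp only [Module.End.mul_apply, opX_single, LinearMap.smul_apply, Pi.zero_apply, zero_smul,
        add_zero]
      by_cases hi : n i + 1 < W.r i <;> by_cases hj : n j + 1 < W.r j
      · rw [if_pos hi, if_pos hj, opX_single, opX_single, if_pos (by simpa [hij] using hi),
          if_pos (by simpa [hij.symm] using hj), Finsupp.smul_single, coef_add_single,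
          coef_add_single, add_right_comm, smul_eq_mul]
        congr 1
        rcases lt_or_gt_of_ne hij with h | h
        · rw [if_neg h.not_gt, if_pos h]
          linear_combination (-(t * coef W j n * coef W i n)) * hb
        · rw [if_pos h, if_neg h.not_gt]
          ring
      · rw [if_pos hi, if_neg hj, opX_single, if_neg (by simpa [hij.symm] using hj)]
        simp
      · rw [if_neg hi, if_pos hj, opX_single, if_neg (by simpa [hij] using hi)]
        simp
      · rw [if_neg hi, if_neg hj]
        simp)

theorem rep_list (n : Fin θ → ℕ) (hn : ∀ i, n i < W.r i) (k : Γ) (l : List (Fin θ))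
    (hl : l.Pairwise (· < ·)) :
    rep W (l.map fun i => x W 0 0 i ^ n i).prod (Finsupp.single (0, k) 1) =
      Finsupp.single ((l.map fun i => Pi.single (M := fun _ => ℕ) i (n i)).sum, k) 1 := by
  induction l with
  | nil => simp
  | cons i t ih =>
    rw [List.pairwise_cons] at hl
    simp only [List.map_cons, List.prod_cons, List.sum_cons, map_mul, Module.End.mul_apply]
    rw [ih hl.2]
    have hz : ∀ t : List (Fin θ), (∀ j ∈ t, i < j) → ∀ k ≤ i,
        (t.map fun i => Pi.single (M := fun _ => ℕ) i (n i)).sum k = 0 := by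
      intro t ht k hk
      induction t with
      | nil => simp
      | cons j t iht =>
        have hkj : k ≠ j := (lt_of_le_of_lt hk (ht j (by simp))).ne
        simp only [List.map_cons, List.sum_cons, Pi.add_apply]
        rw [iht fun j hj => ht j (by simp [hj]), Pi.single_eq_of_ne hkj]
    have hz := hz t hl.1
    rw [map_pow]
    have hx : rep W (x W 0 0 i) = opX W i := by simp [rep]
    rw [hx]
    cases hni : n i with
    | zero => simp
    | succ m =>
      have hc : coef W i (t.map fun i => Pi.single (M := fun _ => ℕ) i (n i)).sum = 1 := by
        refine Finset.prod_eq_one fun k hk => ?_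
        rw [hz k (by simpa using (Finset.mem_Iio.mp hk).le), pow_zero]
      have := hn i
      rw [opX_pow_single, hz i le_rfl, if_pos (by omega), hc, add_comm]
      simp

theorem rep_mon (n : Fin θ → ℕ) (hn : ∀ i, n i < W.r i) (k : Γ) :
    rep W (mon W 0 0 n * of W 0 0 k) (Finsupp.single (0, 1) 1) = Finsupp.single (n, k) 1 := by
  rw [map_mul, Module.End.mul_apply]
  have h : rep W (of W 0 0 k) = opG W k := by simp [rep]
  rw [h, opG_single, mul_one]
  have hw : W.weight 0 k = 1 := by simp [weight]
  rw [hw, mon, Units.val_one, mul_one, rep_list W n hn k _ (List.pairwise_lt_finRange θ),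
    ← Fin.sum_univ_def, Finset.univ_sum_single]

/-- Exponents `(n_1, …, n_θ)` with `0 ≤ n_i < r_i`. -/
abbrev Exps : Type := ∀ i, Fin (W.r i)

theorem linearIndependent_mon : LinearIndependent K fun p : Exps W × Γ =>
    mon W 0 0 (fun i => p.1 i) * of W 0 0 p.2 := by
  refine LinearIndependent.of_comp
    ((LinearMap.applyₗ (Finsupp.single (0, 1) 1)).comp (rep W).toLinearMap) ?_
  have h : (((LinearMap.applyₗ (Finsupp.single (0, 1) 1)).comp (rep W).toLinearMap) ∘
      fun p : Exps W × Γ => mon W 0 0 (fun i => p.1 i) * of W 0 0 p.2) =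
      fun p => Finsupp.single ((fun i => (p.1 i : ℕ)), p.2) (1 : K) := by
    funext p
    exact rep_mon W _ (fun i => (p.1 i).2) p.2
  rw [h]
  have hli := (Finsupp.basisSingleOne (R := K) (ι := (Fin θ → ℕ) × Γ)).linearIndependent
  have hinj : Function.Injective
      fun p : Exps W × Γ => ((fun i => (p.1 i : ℕ)), p.2) := by
    rintro ⟨n, k⟩ ⟨m, l⟩ hnm
    simp only [Prod.mk.injEq] at hnm
    obtain ⟨hnm, rfl⟩ := hnm
    congr 1
    funext i
    exact Fin.ext (congrFun hnm i)
  have := hli.comp _ hinj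
  rw [Finsupp.coe_basisSingleOne] at this
  exact this

theorem x_mul_mon (i : Fin θ) (n : Fin θ → ℕ) :
    ∃ c : K, x W 0 0 i * mon W 0 0 n = c • mon W 0 0 (n + Pi.single i 1) := by
  have hxx : ∀ j, j ≠ i → ∀ m : ℕ, ∃ c : K,
      x W 0 0 i * x W 0 0 j ^ m = c • (x W 0 0 j ^ m * x W 0 0 i) := by
    intro j hj m
    induction m with
    | zero => exact ⟨1, by simp⟩
    | succ m ih =>
      obtain ⟨c, hc⟩ := ih
      refine ⟨c * W.χ j (W.g i), ?_⟩
      rw [pow_succ, ← mul_assoc, hc, smul_mul_assoc, mul_assoc, x_mul_x W 0 0 hj.symm]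
      simp [smul_smul, mul_assoc]
  have hsame : ∀ l : List (Fin θ), i ∉ l →
      (l.map fun j => x W 0 0 j ^ (n + Pi.single i 1 : Fin θ → ℕ) j) = l.map fun j => x W 0 0 j ^ n j := by
    intro l hl
    refine List.map_congr_left fun j hj => ?_
    have : j ≠ i := by rintro rfl; exact hl hj
    simp [this]
  have key : ∀ l : List (Fin θ), l.Nodup → i ∈ l → ∃ c : K,
      x W 0 0 i * (l.map fun j => x W 0 0 j ^ n j).prod =
        c • (l.map fun j => x W 0 0 j ^ (n + Pi.single i 1 : Fin θ → ℕ) j).prod := by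
    intro l
    induction l with
    | nil => simp
    | cons j t ih =>
      intro hnd hi
      rw [List.nodup_cons] at hnd
      simp only [List.map_cons, List.prod_cons]
      by_cases hji : j = i
      · subst hji
        refine ⟨1, ?_⟩
        rw [hsame t hnd.1, ← mul_assoc, ← pow_succ']
        simp
      · obtain ⟨c, hc⟩ := hxx j hji (n j)
        obtain ⟨d, hd⟩ := ih hnd.2 (by simpa [Ne.symm hji] using hi)
        refine ⟨c * d, ?_⟩
        rw [← mul_assoc, hc, smul_mul_assoc, mul_assoc, hd]
        simp [hji, smul_smul]
  exact key _ (List.nodup_finRange θ) (List.mem_finRange i)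

theorem mon_eq_zero (n : Fin θ → ℕ) (i : Fin θ) (hi : W.r i ≤ n i) : mon W 0 0 n = 0 := by
  refine List.prod_eq_zero ?_
  rw [List.mem_map]
  refine ⟨i, List.mem_finRange i, ?_⟩
  rw [← Nat.sub_add_cancel hi, pow_add, x_pow]
  simp

theorem span_mon : ⊤ ≤ Submodule.span K (Set.range fun p : Exps W × Γ =>
    mon W 0 0 (fun i => p.1 i) * of W 0 0 p.2) := by
  set S := Submodule.span K (Set.range fun p : Exps W × Γ =>
    mon W 0 0 (fun i => p.1 i) * of W 0 0 p.2) with hS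
  have hmem : ∀ (n : Fin θ → ℕ) (k : Γ), mon W 0 0 n * of W 0 0 k ∈ S := by
    intro n k
    by_cases hn : ∀ i, n i < W.r i
    · exact Submodule.subset_span ⟨(fun i => ⟨n i, hn i⟩, k), rfl⟩
    · push Not at hn
      obtain ⟨i, hi⟩ := hn
      rw [mon_eq_zero W n i hi, zero_mul]
      exact S.zero_mem
  have hleft : ∀ y : W.Biproduct, ∀ s ∈ S, y * s ∈ S := by
    intro y
    obtain ⟨f, rfl⟩ := mk_surjective W 0 0 y
    induction f using FreeAlgebra.induction with
    | grade0 c =>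
      intro s hs
      rw [AlgHom.commutes, ← Algebra.smul_def]
      exact S.smul_mem c hs
    | grade1 t =>
      intro s hs
      induction hs using Submodule.span_induction with
      | zero => rw [mul_zero]; exact S.zero_mem
      | add u v _ _ hu hv => rw [mul_add]; exact S.add_mem hu hv
      | smul c u _ hu => rw [mul_smul_comm]; exact S.smul_mem c hu
      | mem u hu =>
        obtain ⟨⟨n, k⟩, rfl⟩ := hu
        cases t with
        | inl h =>
          change of W 0 0 h * (mon W 0 0 _ * of W 0 0 k) ∈ S
          rw [← mul_assoc, of_mul_mon, smul_mul_assoc, mul_assoc, of_mul]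
          exact S.smul_mem _ (hmem _ _)
        | inr i =>
          change x W 0 0 i * (mon W 0 0 _ * of W 0 0 k) ∈ S
          obtain ⟨c, hc⟩ := x_mul_mon W i (fun i => (n i : ℕ))
          rw [← mul_assoc, hc, smul_mul_assoc]
          exact S.smul_mem _ (hmem _ _)
    | mul f g hf hg =>
      intro s hs
      rw [map_mul, mul_assoc]
      exact hf _ (hg _ hs)
    | add f g hf hg =>
      intro s hs
      rw [map_add, add_mul]
      exact S.add_mem (hf _ hs) (hg _ hs)
  intro y _
  have h1 : (1 : W.Biproduct) ∈ S := by
    have := hmem 0 1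
    simpa [mon, of_one] using this
  simpa using hleft y 1 h1

/-- The basis `x_1^{n_1} ⋯ x_θ^{n_θ} h` (`0 ≤ n_i < r_i`, `h ∈ Γ`) of `A`. -/
def basis : Module.Basis (Exps W × Γ) K W.Biproduct :=
  Module.Basis.mk (linearIndependent_mon W) (span_mon W)

theorem basis_apply (p : Exps W × Γ) :
    basis W p = mon W 0 0 (fun i => p.1 i) * of W 0 0 p.2 := by
  rw [basis, Module.Basis.mk_apply]

/-- The basis `h x_1^{n_1} ⋯ x_θ^{n_θ}` (`0 ≤ n_i < r_i`, `h ∈ Γ`) of `A`. -/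
def leftBasis : Module.Basis (Exps W × Γ) K W.Biproduct :=
  (basis W).unitsSMul fun p => W.weight (fun i => p.1 i) p.2

theorem leftBasis_apply (p : Exps W × Γ) :
    leftBasis W p = of W 0 0 p.2 * mon W 0 0 (fun i => p.1 i) := by
  rw [leftBasis, Module.Basis.unitsSMul_apply, basis_apply, of_mul_mon]
  rfl

end Biproduct

end QuantumLinearSpace

/-! ### Two-cocycles and cocycle twists of a bialgebra -/

section Cocycle

variable (K) (A : Type*) [Ring A] [Bialgebra K A]

/-- Linear forms on `A ⊗ A`, with the convolution product; its unit is `ε ⊗ ε`. -/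
abbrev Cochain : Type _ := WithConv (A ⊗[K] A →ₗ[K] K)

variable {K A}

/-- `γ ∈ Z²_H(A, K)`: `γ` is a convolution invertible, unital, `H`-bilinear 2-cocycle. -/
structure IsCocycle (H : Subalgebra K A) (γ : Cochain K A) : Prop where
  isUnit : IsUnit γ
  /-- `γ(y₁ ⊗ z₁) γ(x ⊗ y₂ z₂) = γ(x₁ ⊗ y₁) γ(x₂ y₂ ⊗ z)` -/
  cocycle : ∀ x y z : A,
    (γ * toConv (γ.ofConv ∘ₗ TensorProduct.mk K A A x ∘ₗ LinearMap.mul' K A)) (y ⊗ₜ z) =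
      (γ * toConv (γ.ofConv ∘ₗ (TensorProduct.mk K A A).flip z ∘ₗ LinearMap.mul' K A)) (x ⊗ₜ y)
  apply_one : ∀ x : A, γ (x ⊗ₜ 1) = Coalgebra.counit (R := K) x
  one_apply : ∀ x : A, γ (1 ⊗ₜ x) = Coalgebra.counit (R := K) x
  bilinear : ∀ h ∈ H, ∀ h' ∈ H, ∀ x y : A, γ ((h * x) ⊗ₜ (y * h')) =
    Coalgebra.counit (R := K) h * Coalgebra.counit (R := K) h' * γ (x ⊗ₜ y)

/-- The twisted multiplication `γ ∗ m_A ∗ γ⁻¹` (convolution product in `Hom(A ⊗ A, A)`). -/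
def twistMul (γ : Cochain K A) : A ⊗[K] A →ₗ[K] A :=
  (toConv (Algebra.linearMap K A ∘ₗ γ.ofConv) * toConv (LinearMap.mul' K A) *
    toConv (Algebra.linearMap K A ∘ₗ (Ring.inverse γ).ofConv)).ofConv

/-- The twist `A^γ`: the coalgebra `A` with its unit and with the multiplication
`γ ∗ m_A ∗ γ⁻¹`. -/
def Twist (_γ : Cochain K A) : Type _ := A

namespace Twist

variable (γ : Cochain K A)

instance : AddCommGroup (Twist γ) := inferInstanceAs (AddCommGroup A)
instance : Module K (Twist γ) := inferInstanceAs (Module K A)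
instance : Coalgebra K (Twist γ) := inferInstanceAs (Coalgebra K A)
instance : One (Twist γ) := inferInstanceAs (One A)
instance : Mul (Twist γ) := ⟨fun x y => twistMul γ (TensorProduct.tmul K (x : A) (y : A))⟩

end Twist

/-- `A^γ ≅ B` as bialgebras: there is an isomorphism of coalgebras compatible with the units and
the multiplications. -/
def TwistIso (γ : Cochain K A) (B : Type*) [Ring B] [Bialgebra K B] : Prop :=
  ∃ e : Twist γ ≃ₗc[K] B, e 1 = 1 ∧ ∀ x y : Twist γ, e (x * y) = e x * e y

end Cocycle

/-! ### The cocycle attached to a lifting -/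

namespace QuantumLinearSpace

variable (W : QuantumLinearSpace K Γ θ)

/-- The parameters `(a_i, a_ij)` of a lifting of `B(W) # K[Γ]`; `off i j` is `a_ij`
(only its values for `i ≠ j` matter). -/
structure LiftingDatum where
  /-- the scalars `a_i` -/
  diag : Fin θ → K
  /-- the scalars `a_ij` -/
  off : Fin θ → Fin θ → K
  diag_ne : ∀ i, diag i ≠ 0 → W.g i ^ W.r i ≠ 1 ∧ W.χ i ^ W.r i = 1
  off_ne : ∀ i j, i ≠ j → off i j ≠ 0 → W.g i * W.g j ≠ 1 ∧ W.χ i * W.χ j = 1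
  off_swap : ∀ i j, i ≠ j → off j i = -(W.χ i (W.g j) : K) * off i j

namespace Biproduct

open Lifting

/-- The sub-Hopf algebra `H = K[Γ]` of `A`. -/
def groupAlgebra : Subalgebra K W.Biproduct := Algebra.adjoin K (Set.range (of W 0 0))

/-- The linear form on `A ⊗ A` with `h X ⊗ Y h' ↦ f(X, Y)` for `h, h' ∈ Γ` and ordered monomials
`X`, `Y` (given by their exponents): the `H`-bilinear extension of `f`. -/
def bilinExt (f : Exps W → Exps W → K) : Cochain K W.Biproduct :=
  toConv (((leftBasis W).tensorProduct (basis W)).constr K fun p => f p.1.1 p.2.1)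

theorem bilinExt_apply (f : Exps W → Exps W → K) (h h' : Γ) (n m : Exps W) :
    bilinExt W f ((of W 0 0 h * mon W 0 0 (fun i => n i)) ⊗ₜ
      (mon W 0 0 (fun i => m i) * of W 0 0 h')) = f n m := by
  have := ((leftBasis W).tensorProduct (basis W)).constr_basis K
    (fun p => f p.1.1 p.2.1) ((n, h), (m, h'))
  rwa [Module.Basis.tensorProduct_apply, leftBasis_apply, basis_apply] at this

open Classical in
/-- `γ_i` with scalar `c`: it takes the value `c` on `x_i^m ⊗ x_i^(r_i - m)` for `0 < m < r_i`, and
agrees with `ε ⊗ ε` on the other `X ⊗ Y`. -/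
def diagCochain (c : K) (i : Fin θ) : Cochain K W.Biproduct :=
  bilinExt W fun n m =>
    if (∃ k, 0 < k ∧ k < W.r i ∧ (fun l => (n l : ℕ)) = Pi.single i k ∧
      (fun l => (m l : ℕ)) = Pi.single i (W.r i - k)) then c
    else if (∀ l, (n l : ℕ) = 0) ∧ ∀ l, (m l : ℕ) = 0 then 1 else 0

open Classical in
/-- `γ_ij` with scalar `c`: it takes the value `(m)!_q c^m`, `q = χ_i(g_i)`, on `x_j^m ⊗ x_i^m` for
`0 ≤ m < r_i`, and agrees with `ε ⊗ ε` on the other `X ⊗ Y`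
(the case `m = 0` is `1 ⊗ 1 ↦ 1`). -/
def offCochain (c : K) (i j : Fin θ) : Cochain K W.Biproduct :=
  bilinExt W fun n m =>
    if (fun l => (n l : ℕ)) = Pi.single j (m i : ℕ) ∧
      (fun l => (m l : ℕ)) = Pi.single i (m i : ℕ) then
      qFact (W.χ i (W.g i) : K) (m i) * c ^ (m i : ℕ) else 0

end Biproduct

variable {W}

namespace LiftingDatum

variable (L : W.LiftingDatum)

/-- The lifting `B = A(a_i, a_ij)`. -/
abbrev Alg : Type _ := W.Lifting L.diag L.off

/-- The graph on `{1, …, θ}` with an edge between `i` and `j` if `a_ij ≠ 0`. -/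
def graph : SimpleGraph (Fin θ) := SimpleGraph.fromRel fun i j => L.off i j ≠ 0

/-- `γ_i`. -/
def γ₁ (i : Fin θ) : Cochain K W.Biproduct := Biproduct.diagCochain W (L.diag i) i

/-- `γ_ij` for `i < j`; its value on `x_j ⊗ x_i` is the scalar of the relation
`x_j x_i = χ_i(g_j) x_i x_j + a_ji (1 - g_j g_i)`. -/
def γ₂ (i j : Fin θ) : Cochain K W.Biproduct := Biproduct.offCochain W (L.off j i) i j

/-- An order for the factors of the products over the connected components, over the vertices of
a component, and over the pairs `i < j` of vertices of a component. -/
structure FactorOrder where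
  /-- the components -/
  comps : List L.graph.ConnectedComponent
  nodup_comps : comps.Nodup
  mem_comps : ∀ τ, τ ∈ comps
  /-- the vertices of a component -/
  verts : L.graph.ConnectedComponent → List (Fin θ)
  nodup_verts : ∀ τ, (verts τ).Nodup
  mem_verts : ∀ τ i, i ∈ verts τ ↔ i ∈ τ.supp
  /-- the pairs `i < j` of vertices of a component -/
  pairs : L.graph.ConnectedComponent → List (Fin θ × Fin θ)
  nodup_pairs : ∀ τ, (pairs τ).Nodup
  mem_pairs : ∀ τ i j, (i, j) ∈ pairs τ ↔ i < j ∧ i ∈ τ.supp ∧ j ∈ τ.supp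

open Classical in
instance : Nonempty L.FactorOrder :=
  have : Fintype L.graph.ConnectedComponent := Fintype.ofFinite _
  ⟨{ comps := Finset.univ.toList
     nodup_comps := Finset.nodup_toList _
     mem_comps := by simp
     verts := fun τ => (Finset.univ.filter fun i => i ∈ τ.supp).toList
     nodup_verts := fun τ => Finset.nodup_toList _
     mem_verts := by simp
     pairs := fun τ =>
      (Finset.univ.filter fun p => p.1 < p.2 ∧ p.1 ∈ τ.supp ∧ p.2 ∈ τ.supp).toList
     nodup_pairs := fun τ => Finset.nodup_toList _
     mem_pairs := by simp }⟩

/-- `α_τ = (∏_{i<j} γ_ij) ∗ ∏_i γ_i`, with `i, j` in the component `τ`; this is `γ_i` if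
`τ = {i}` and `γ_ij ∗ γ_i ∗ γ_j` if `τ = {i, j}`. -/
def componentCocycle (o : L.FactorOrder) (τ : L.graph.ConnectedComponent) :
    Cochain K W.Biproduct :=
  ((o.pairs τ).map fun p => L.γ₂ p.1 p.2).prod * ((o.verts τ).map L.γ₁).prod

/-- `α = ∏_τ α_τ`. -/
def cocycle (o : L.FactorOrder) : Cochain K W.Biproduct :=
  (o.comps.map (L.componentCocycle o)).prod

end LiftingDatum

end QuantumLinearSpace

end QLS

end

/-!
The proof does not verify the cocycle identity for `α` on monomials. It realises `α` as one value of
a cogroupoid on the coalgebra `A`, for which the identities are formal, and evaluates that value.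

A parameter `s` consists of scalars `s_i`, `s_ij` with the character conditions of a lifting datum.
For two parameters `s` and `t` the algebra with `h x_i = χ_i(h) x_i h`,
`x_i ^ r_i = s_i - t_i g_i ^ r_i` and `x_i x_j = χ_j(g_i) x_j x_i + s_ij - t_ij g_i g_j` has the
ordered monomials as a basis. It is transported to the vector space `A` in that basis, which gives a
multiplication `m_st` (`defMul`). Here `m_00` is the multiplication of `A`, and `m_ss` for `s` the
lifting datum is that of `B`. In the ordered monomials, left multiplication by `x_i` is the explicit
operator `X_i y = x_i y + f_i(y₁) y₂ - g_i y₁ f'_i(y₂)` on `A` (`opY`), where `f_i` is the linear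
form with `x_j h ↦ s_ij` for `j < i` and `x_i ^ (r_i - 1) h ↦ s_i`, and `f'_i` is the same for `t`.
These operators satisfy the relations (`opY_mul_opY`, `opY_pow`) and send `1` to the ordered
monomials (`word_opY_of`). Straightening of words (`Straightens.lift_mem_span`) shows that nothing
is lost by applying an operator to `1` (`leftMul_act`), and so `m_st` is associative.

From the form of the operators, `Δ m_su = (m_st ⊗ m_tu) Δ` for all `s`, `t`, `u` (`comul_defMul`).
Hence the forms `γ_st = ε m_st` (`defCochain`) satisfy `γ_st ∗ γ_tu = γ_su` and `γ_ss = ε ⊗ ε`, and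
`γ_st ∗ m_tu = m_su`, `m_st ∗ γ_tu = m_su`. So `γ_s0` is invertible, its cocycle identity is the
associativity of `m_s0` (`isCocycle_defCochain`), and `γ_s0 ∗ m_00 ∗ γ_0s = m_ss`
(`twistMul_defCochain`). For the lifting datum this says `A^γ ≅ B` (`twistIso_defCochain`).

It remains to see that `α = γ_s0` for the lifting datum `s`, whatever the order of the factors.
Since `γ_st ∗ γ_tu = γ_su`, it suffices that each factor is `γ_st` for parameters `s` and `t` that
differ in one scalar: the product switches the scalars off one after the other, the `a_ij` of a component
before its `a_i`. If `s` and `t` differ in `a_ji`, then `ε X_j ^ m = a_ji ^ m ξ_i ^ m` for the form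
`ξ_i` dual to `x_i`, the other words do not contribute, and `γ_st = γ_ij`
(`defCochain_eq_offCochain`). That two scalars `a_ji` and `a_ki` may both be present causes no harm,
for then `r_i = 2` (`r_eq_two`). If `s` and `t` differ in `a_i`, and all `a_ij` at `i` have been
switched off, then `ε X_i ^ m` is `a_i` times the divided power of `ξ_i` of exponent `r_i - m`, and
`γ_st = γ_i` (`defCochain_eq_diagCochain`).
-/

noncomputable section

namespace QLS.QuantumLinearSpace

variable {K : Type*} [Field K] {Γ : Type*} [CommGroup Γ] {θ : ℕ} (W : QuantumLinearSpace K Γ θ)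

/-! ### The braiding matrix -/

/-- The entry `χ_i(g_j)` of the braiding matrix. -/
def q (i j : Fin θ) : K := (W.χ i (W.g j) : K)

variable {W} in
theorem q_mul_q {i j : Fin θ} (h : i ≠ j) : W.q i j * W.q j i = 1 := by
  simpa [q] using congrArg Units.val (W.braid i j h)

theorem q_ne_zero (i j : Fin θ) : W.q i j ≠ 0 := Units.ne_zero _

theorem q_root (i : Fin θ) : IsPrimitiveRoot (W.q i i) (W.r i) :=
  IsPrimitiveRoot.coe_units_iff.mpr (W.root i)

theorem qInt_eq_zero (i : Fin θ) : qInt (W.q i i) (W.r i) = 0 :=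
  (W.q_root i).geom_sum_eq_zero (W.two_le i)

theorem qInt_inv_eq_zero (i : Fin θ) : qInt (W.q i i)⁻¹ (W.r i) = 0 :=
  (W.q_root i).inv.geom_sum_eq_zero (W.two_le i)

theorem qFact_succ (q : K) (n : ℕ) : qFact q (n + 1) = qFact q n * qInt q (n + 1) :=
  Finset.prod_range_succ _ _

theorem qFact_ne_zero (i : Fin θ) {m : ℕ} (hm : m < W.r i) : qFact (W.q i i) m ≠ 0 := by
  refine Finset.prod_ne_zero_iff.mpr fun k hk h => ?_
  have hk : k < m := Finset.mem_range.mp hk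
  have h1 := (mul_neg_geom_sum (W.q i i) (k + 1)).symm
  rw [show ∑ j ∈ Finset.range (k + 1), W.q i i ^ j = 0 from h, mul_zero] at h1
  exact (W.q_root i).pow_ne_one_of_pos_of_lt (by omega) (by omega) (sub_eq_zero.mp h1).symm

/-! ### Ordered words -/

section Word

variable {S : Type*} [Monoid S]

/-- The ordered word `X_1 ^ n_1 ⋯ X_θ ^ n_θ` in the elements of a family `X`. -/
def word (X : Fin θ → S) (n : Fin θ → ℕ) : S := ((List.finRange θ).map fun i => X i ^ n i).prod

theorem word_zero (X : Fin θ → S) : word X 0 = 1 := by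
  simp [word]

theorem mul_word (X : Fin θ → S) {i : Fin θ} {n : Fin θ → ℕ} (hn : ∀ k < i, n k = 0) :
    X i * word X n = word X (n + Pi.single i 1) := by
  have key : ∀ l : List (Fin θ), l.Pairwise (· < ·) → i ∈ l →
      X i * (l.map fun k => X k ^ n k).prod =
        (l.map fun k => X k ^ (n + Pi.single i 1 : Fin θ → ℕ) k).prod := by
    intro l
    induction l with
    | nil => simp
    | cons k t ih =>
      intro hl hi
      rw [List.pairwise_cons] at hl
      simp only [List.map_cons, List.prod_cons]
      rcases eq_or_ne k i with rfl | hki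
      · have : (t.map fun j => X j ^ (n + Pi.single k 1 : Fin θ → ℕ) j) =
            t.map fun j => X j ^ n j := by
          refine List.map_congr_left fun j hj => ?_
          simp [(hl.1 j hj).ne']
        rw [this, ← mul_assoc, ← pow_succ']
        simp
      · have hit : i ∈ t := by simpa [hki.symm] using hi
        simp [hn k (hl.1 i hit), hki, ih hl.2 hit]
  exact key _ (List.pairwise_lt_finRange θ) (List.mem_finRange i)

theorem pow_mul_word (X : Fin θ → S) {i : Fin θ} {n : Fin θ → ℕ} (hn : ∀ k < i, n k = 0) (m : ℕ) :
    X i ^ m * word X n = word X (n + Pi.single i m) := by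
  induction m with
  | zero => simp
  | succ m ih =>
    rw [pow_succ', mul_assoc, ih, mul_word, add_assoc, ← Pi.single_add]
    intro k hk
    simp [hn k hk, hk.ne]

/-- An element that commutes with each letter up to a scalar commutes with words up to a scalar. -/
theorem exists_mul_word {S : Type*} [Ring S] [Algebra K S] (X : Fin θ → S) (T : S)
    (h : ∀ k, ∃ c : K, T * X k = c • (X k * T)) (n : Fin θ → ℕ) :
    ∃ c : K, T * word X n = c • (word X n * T) := by
  have hp : ∀ k m, ∃ c : K, T * X k ^ m = c • (X k ^ m * T) := by
    intro k m
    induction m with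
    | zero => exact ⟨1, by simp⟩
    | succ m ih =>
      obtain ⟨c, hc⟩ := ih
      obtain ⟨d, hd⟩ := h k
      exact ⟨c * d, by
        rw [pow_succ, ← mul_assoc, hc, smul_mul_assoc, mul_assoc, hd, mul_smul_comm, smul_smul,
          ← mul_assoc]⟩
  unfold word
  induction List.finRange θ with
  | nil => exact ⟨1, by simp⟩
  | cons k t ih =>
    obtain ⟨c, hc⟩ := ih
    obtain ⟨d, hd⟩ := hp k (n k)
    refine ⟨d * c, ?_⟩
    simp only [List.map_cons, List.prod_cons]
    rw [← mul_assoc, hd, smul_mul_assoc, mul_assoc, hc, mul_smul_comm, smul_smul, ← mul_assoc]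

end Word

/-! ### Straightening -/

section Straightening

variable {S : Type*} [Ring S] [Algebra K S]

/-- The relations of a lifting up to terms in the span of the group elements: this is all that the
rewriting of words into ordered words uses. -/
structure Straightens (G : Γ → S) (X : Fin θ → S) : Prop where
  one : G 1 = 1
  mul : ∀ h k, G h * G k = G (h * k)
  comm : ∀ h i, G h * X i = (W.χ i h : K) • (X i * G h)
  pow : ∀ i, X i ^ W.r i ∈ Submodule.span K (Set.range G)
  skew : ∀ i j, i ≠ j → ∃ c : K, X i * X j - c • (X j * X i) ∈ Submodule.span K (Set.range G)

/-- The span of the `X_1^{n_1} ⋯ X_θ^{n_θ} h` with `n_i < r_i` of degree at most `N`. -/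
def orderedSpan (G : Γ → S) (X : Fin θ → S) (N : ℕ) : Submodule K S :=
  Submodule.span K {s | ∃ n : Fin θ → ℕ, ∃ h : Γ, (∀ k, n k < W.r k) ∧ ∑ k, n k ≤ N ∧
    s = word X n * G h}

variable {W} {G : Γ → S} {X : Fin θ → S}

theorem orderedSpan_mono {N N' : ℕ} (h : N ≤ N') :
    W.orderedSpan G X N ≤ W.orderedSpan G X N' := by
  refine Submodule.span_mono ?_
  rintro s ⟨n, k, hn, hN, rfl⟩
  exact ⟨n, k, hn, hN.trans h, rfl⟩

namespace Straightens

variable (R : W.Straightens G X)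
include R

theorem exists_group_mul_word (h : Γ) (n : Fin θ → ℕ) :
    ∃ c : K, G h * word X n = c • (word X n * G h) :=
  exists_mul_word X (G h) (fun k => ⟨_, R.comm h k⟩) n

theorem mul_group_mem {N : ℕ} {s : S} (hs : s ∈ W.orderedSpan G X N) (h : Γ) :
    s * G h ∈ W.orderedSpan G X N := by
  have : W.orderedSpan G X N ≤ (W.orderedSpan G X N).comap (LinearMap.mulRight K (G h)) := by
    refine Submodule.span_le.mpr ?_
    rintro _ ⟨n, k, hn, hN, rfl⟩
    refine Submodule.subset_span ⟨n, k * h, hn, hN, ?_⟩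
    simp [mul_assoc, R.mul]
  exact this hs

theorem group_mul_mem {N : ℕ} {s : S} (hs : s ∈ W.orderedSpan G X N) (h : Γ) :
    G h * s ∈ W.orderedSpan G X N := by
  have : W.orderedSpan G X N ≤ (W.orderedSpan G X N).comap (LinearMap.mulLeft K (G h)) := by
    refine Submodule.span_le.mpr ?_
    rintro _ ⟨n, k, hn, hN, rfl⟩
    obtain ⟨c, hc⟩ := R.exists_group_mul_word h n
    change G h * (word X n * G k) ∈ W.orderedSpan G X N
    rw [← mul_assoc, hc, smul_mul_assoc, mul_assoc, R.mul]
    exact Submodule.smul_mem _ _ (Submodule.subset_span ⟨n, h * k, hn, hN, rfl⟩)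
  exact this hs

theorem span_mul_mem {N : ℕ} {u s : S} (hu : u ∈ Submodule.span K (Set.range G))
    (hs : s ∈ W.orderedSpan G X N) : u * s ∈ W.orderedSpan G X N := by
  have : Submodule.span K (Set.range G) ≤
      (W.orderedSpan G X N).comap (LinearMap.mulRight K s) := by
    refine Submodule.span_le.mpr ?_
    rintro _ ⟨h, rfl⟩
    exact R.group_mul_mem hs h
  exact this hu

theorem word_mem {N : ℕ} {n : Fin θ → ℕ} (hn : ∀ k, n k < W.r k) (hN : ∑ k, n k ≤ N) :
    word X n ∈ W.orderedSpan G X N :=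
  Submodule.subset_span ⟨n, 1, hn, hN, by rw [R.one, mul_one]⟩

theorem letter_mul_mem_of_word {N : ℕ} {i : Fin θ}
    (h : ∀ n : Fin θ → ℕ, (∀ k, n k < W.r k) → ∑ k, n k ≤ N →
      X i * word X n ∈ W.orderedSpan G X (N + 1)) {s : S} (hs : s ∈ W.orderedSpan G X N) :
    X i * s ∈ W.orderedSpan G X (N + 1) := by
  have : W.orderedSpan G X N ≤ (W.orderedSpan G X (N + 1)).comap (LinearMap.mulLeft K (X i)) := by
    refine Submodule.span_le.mpr ?_
    rintro _ ⟨n, k, hn, hN, rfl⟩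
    change X i * (word X n * G k) ∈ W.orderedSpan G X (N + 1)
    rw [← mul_assoc]
    exact R.mul_group_mem (h n hn hN) k
  exact this hs

/-- Left multiplication by a letter raises the degree by at most one. The induction is on the degree
and then on the letter: moving `X_i` past a smaller first letter `X_j` leaves `X_i` on a word of
smaller degree, and then `X_j` with `j < i` on a word of the same degree. -/
theorem letter_mul_word_mem (N : ℕ) (i : Fin θ) (n : Fin θ → ℕ) (hn : ∀ k, n k < W.r k)
    (hN : ∑ k, n k ≤ N) : X i * word X n ∈ W.orderedSpan G X (N + 1) := by
  induction N using Nat.strong_induction_on generalizing i n with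
  | _ N ihN =>
  induction i using WellFoundedLT.induction generalizing n with
  | _ i ihi =>
  by_cases h0 : ∀ k < i, n k = 0
  · -- no letter of the word is smaller than `X_i`: the product is ordered, up to the power relation
    rw [mul_word X h0]
    by_cases hi : n i + 1 < W.r i
    · refine R.word_mem (fun k => ?_) ?_
      · rcases eq_or_ne k i with rfl | hk
        · simpa using hi
        · simpa [hk] using hn k
      · simp [Finset.sum_add_distrib, hN]
    · have hr : n i + 1 = W.r i := by have := hn i; omega
      have e : n + Pi.single i 1 = Function.update n i 0 + Pi.single i (W.r i) := by
        funext k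
        rcases eq_or_ne k i with rfl | hk <;> simp [*]
      rw [e, ← pow_mul_word X (fun k hk => by simp [hk.ne, h0 k hk])]
      refine R.span_mul_mem (R.pow i) (R.word_mem (fun k => ?_) ?_)
      · rcases eq_or_ne k i with rfl | hk
        · have := W.two_le k; simp; omega
        · simpa [hk] using hn k
      · refine (Finset.sum_le_sum fun k _ => ?_).trans (hN.trans (Nat.le_succ N))
        rcases eq_or_ne k i with rfl | hk <;> simp [*]
  · -- `X_j` is the first letter of the word
    push Not at h0
    obtain ⟨j, ⟨hji, hj⟩, hmin⟩ := WellFounded.has_min (r := ((· < ·) : Fin θ → Fin θ → Prop))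
      wellFounded_lt {k | k < i ∧ n k ≠ 0} h0
    have hlt : ∀ k < j, n k = 0 := by
      intro k hk
      by_contra hc
      exact hmin k ⟨hk.trans hji, hc⟩ hk
    set n' := Function.update n j (n j - 1) with hn'
    have e : n = n' + Pi.single j 1 := by
      funext k
      rcases eq_or_ne k j with rfl | hk
      · simp [hn']; omega
      · simp [hn', hk]
    have hsum : ∑ k, n k = ∑ k, n' k + 1 := by
      rw [e]; simp [Finset.sum_add_distrib]
    have hn'lt : ∀ k, n' k < W.r k := by
      intro k
      refine lt_of_le_of_lt ?_ (hn k)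
      rcases eq_or_ne k j with rfl | hk
      · simp [hn']
      · simp [hn', hk]
    obtain ⟨M, rfl⟩ : ∃ M, N = M + 1 := ⟨N - 1, by omega⟩
    obtain ⟨c, hc⟩ := R.skew i j hji.ne'
    have e2 : X i * word X n = (X i * X j - c • (X j * X i)) * word X n' +
        c • (X j * (X i * word X n')) := by
      rw [e, ← mul_word X (fun k hk => by simp [hn', hk.ne, hlt k hk]), sub_mul, smul_mul_assoc,
        mul_assoc, mul_assoc, sub_add_cancel]
    rw [e2]
    refine Submodule.add_mem _ (R.span_mul_mem hc (R.word_mem hn'lt (by omega)))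
      (Submodule.smul_mem _ _ ?_)
    exact R.letter_mul_mem_of_word (fun m hm hM => ihi j hji m hm hM)
      (ihN M (by omega) i n' hn'lt (by omega))

/-- The algebra generated by `G` and `X` is spanned by the reduced ordered words times group
elements. -/
theorem lift_mem_span (c : FreeAlgebra K (Γ ⊕ Fin θ)) :
    FreeAlgebra.lift K (Sum.elim G X) c ∈ Submodule.span K
      (Set.range fun p : Biproduct.Exps W × Γ => word X (fun i => p.1 i) * G p.2) := by
  set V := Submodule.span K
      (Set.range fun p : Biproduct.Exps W × Γ => word X (fun i => p.1 i) * G p.2) with hV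
  have hle : ∀ N, W.orderedSpan G X N ≤ V := by
    intro N
    refine Submodule.span_mono ?_
    rintro _ ⟨n, h, hn, -, rfl⟩
    exact ⟨(fun i => ⟨n i, hn i⟩, h), rfl⟩
  have hmem : ∀ s ∈ V, ∃ N, s ∈ W.orderedSpan G X N := by
    intro s hs
    induction hs using Submodule.span_induction with
    | zero => exact ⟨0, Submodule.zero_mem _⟩
    | add u v _ _ hu hv =>
      obtain ⟨N, hN⟩ := hu
      obtain ⟨M, hM⟩ := hv
      exact ⟨max N M, Submodule.add_mem _ (orderedSpan_mono (le_max_left _ _) hN)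
        (orderedSpan_mono (le_max_right _ _) hM)⟩
    | smul c u _ hu =>
      obtain ⟨N, hN⟩ := hu
      exact ⟨N, Submodule.smul_mem _ _ hN⟩
    | mem u hu =>
      obtain ⟨p, rfl⟩ := hu
      exact ⟨_, Submodule.subset_span ⟨_, p.2, fun k => (p.1 k).2, le_rfl, rfl⟩⟩
  have hleft : ∀ s ∈ V, FreeAlgebra.lift K (Sum.elim G X) c * s ∈ V := by
    induction c using FreeAlgebra.induction with
    | grade0 c =>
      intro s hs
      rw [AlgHom.commutes, ← Algebra.smul_def]
      exact V.smul_mem c hs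
    | grade1 t =>
      intro s hs
      obtain ⟨N, hN⟩ := hmem s hs
      cases t with
      | inl h => simpa using hle N (R.group_mul_mem hN h)
      | inr i =>
        simpa using hle (N + 1) (R.letter_mul_mem_of_word (R.letter_mul_word_mem N i) hN)
    | mul f g hf hg =>
      intro s hs
      rw [map_mul, mul_assoc]
      exact hf _ (hg _ hs)
    | add f g hf hg =>
      intro s hs
      rw [map_add, add_mul]
      exact V.add_mem (hf _ hs) (hg _ hs)
  have h1 : (1 : S) ∈ V := by
    rw [← word_zero X]
    exact hle 0 (R.word_mem (fun k => lt_of_lt_of_le two_pos (W.two_le k)) (by simp))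
  simpa using hleft 1 h1

end Straightens

end Straightening

end QLS.QuantumLinearSpace

namespace QLS.QuantumLinearSpace

variable {K : Type*} [Field K] {Γ : Type*} [CommGroup Γ] {θ : ℕ} (W : QuantumLinearSpace K Γ θ)

/-! ### Elements that commute up to scalars -/

section QComm

variable {S : Type*} [Ring S] [Algebra K S] {c : K} {d T : S}

theorem pow_mul_qComm (h : d * T = c • (T * d)) (m : ℕ) : d ^ m * T = c ^ m • (T * d ^ m) := by
  induction m with
  | zero => simp
  | succ m ih =>
    rw [pow_succ, mul_assoc, h, mul_smul_comm, ← mul_assoc, ih, smul_mul_assoc, smul_smul,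
      mul_assoc, pow_succ', mul_comm]

theorem mul_pow_qComm (h : d * T = c • (T * d)) (m : ℕ) : d * T ^ m = c ^ m • (T ^ m * d) := by
  induction m with
  | zero => simp
  | succ m ih =>
    rw [pow_succ, ← mul_assoc, ih, smul_mul_assoc, mul_assoc, h, mul_smul_comm, smul_smul,
      ← mul_assoc, pow_succ]

theorem pow_mul_pow_qComm (h : d * T = c • (T * d)) (m n : ℕ) :
    d ^ m * T ^ n = c ^ (m * n) • (T ^ n * d ^ m) := by
  rw [mul_pow_qComm (pow_mul_qComm h m), pow_mul]

/-- If `X Y = c Y X + u + v`, `u X = e X u` and `v X = f X v`, then `X ^ m Y = c ^ m Y X ^ m` up to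
multiples of `X ^ (m - 1) u` and `X ^ (m - 1) v` by the `q`-integers `(m)_{ce}` and `(m)_{cf}`. -/
theorem pow_mul_of_qComm_add {c e : K} {X Y u v : S} {f : K}
    (h : X * Y = c • (Y * X) + u + v) (hu : u * X = e • (X * u)) (hv : v * X = f • (X * v))
    (m : ℕ) :
    X ^ (m + 1) * Y = c ^ (m + 1) • (Y * X ^ (m + 1)) + qInt (c * e) (m + 1) • (X ^ m * u) +
      qInt (c * f) (m + 1) • (X ^ m * v) := by
  have hu' : ∀ m, u * X ^ m = e ^ m • (X ^ m * u) := mul_pow_qComm hu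
  have hv' : ∀ m, v * X ^ m = f ^ m • (X ^ m * v) := mul_pow_qComm hv
  induction m with
  | zero => simpa [qInt] using h
  | succ m ih =>
    have e1 : X ^ (m + 1 + 1) * Y = X * (X ^ (m + 1) * Y) := by rw [pow_succ', mul_assoc]
    have e2 : X * (Y * X ^ (m + 1)) = c • (Y * X ^ (m + 1 + 1)) + e ^ (m + 1) • (X ^ (m + 1) * u) +
        f ^ (m + 1) • (X ^ (m + 1) * v) := by
      rw [← mul_assoc, h, add_mul, add_mul, hu', hv', smul_mul_assoc, mul_assoc, ← pow_succ']
    have e3 : ∀ x : K, qInt x (m + 1 + 1) = qInt x (m + 1) + x ^ (m + 1) := fun x =>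
      Finset.sum_range_succ _ _
    rw [e1, ih, mul_add, mul_add, mul_smul_comm, mul_smul_comm, mul_smul_comm, e2, ← mul_assoc,
      ← mul_assoc, ← pow_succ', e3, e3, mul_pow, mul_pow, pow_succ c (m + 1)]
    module

/-- The case in which the `q`-integers vanish: then the powers commute up to a scalar. -/
theorem pow_mul_of_qInt_eq_zero {a b f : K} {X Y G : S} {r : ℕ} (hr : 0 < r)
    (h : X * Y = c • (Y * X) + a • 1 - b • G) (hG : G * X = f • (X * G))
    (ha : a ≠ 0 → qInt c r = 0) (hb : b ≠ 0 → qInt (c * f) r = 0) :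
    X ^ r * Y = c ^ r • (Y * X ^ r) := by
  obtain ⟨m, rfl⟩ : ∃ m, r = m + 1 := ⟨r - 1, by omega⟩
  rw [sub_eq_add_neg, ← neg_smul] at h
  have h2 := pow_mul_of_qComm_add (e := (1 : K)) (f := f) h (by simp)
    (by rw [smul_mul_assoc, hG, mul_smul_comm, smul_comm]) m
  have e1 : qInt (c * 1) (m + 1) • (X ^ m * a • 1) = 0 := by
    by_cases h0 : a = 0
    · simp [h0]
    · rw [mul_one, ha h0, zero_smul]
  have e2 : qInt (c * f) (m + 1) • (X ^ m * -b • G) = 0 := by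
    by_cases h0 : b = 0
    · simp [h0]
    · rw [hb h0, zero_smul]
  rw [h2, e1, e2, add_zero, add_zero]

end QComm

/-! ### Parameters and skew sums -/

/-- The scalars `a_i`, `a_ij` of relations `x_i ^ r_i = a_i`, `x_i x_j = χ_j(g_i) x_j x_i + a_ij`,
subject to the conditions that make them compatible with the action of `Γ`. A lifting datum is
such a family; switching off some of its scalars gives another one. -/
structure Param where
  /-- the scalars `a_i` -/
  diag : Fin θ → K
  /-- the scalars `a_ij` (only the values for `i ≠ j` matter) -/
  off : Fin θ → Fin θ → K
  diag_ne : ∀ i, diag i ≠ 0 → W.χ i ^ W.r i = 1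
  off_ne : ∀ i j, i ≠ j → off i j ≠ 0 → W.χ i * W.χ j = 1
  off_swap : ∀ i j, i ≠ j → off j i = -W.q i j * off i j

namespace Param

variable {W} (s : W.Param)

theorem char_pow {i : Fin θ} (h : s.diag i ≠ 0) (g : Γ) : (W.χ i g : K) ^ W.r i = 1 := by
  have := DFunLike.congr_fun (s.diag_ne i h) g
  simpa using congrArg Units.val this

theorem char_mul_char {i k : Fin θ} (hik : i ≠ k) (h : s.off i k ≠ 0) (g : Γ) :
    (W.χ i g : K) * (W.χ k g : K) = 1 := by
  have := DFunLike.congr_fun (s.off_ne i k hik h) g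
  simpa using congrArg Units.val this

theorem q_pow {i : Fin θ} (h : s.diag i ≠ 0) (j : Fin θ) : W.q i j ^ W.r i = 1 := s.char_pow h _

theorem q_pow' {i j : Fin θ} (hij : i ≠ j) (h : s.diag i ≠ 0) : W.q j i ^ W.r i = 1 := by
  have := congrArg (· ^ W.r i) (q_mul_q (W := W) hij)
  simpa [mul_pow, s.q_pow h] using this

theorem q_mul_q_off {i k : Fin θ} (hik : i ≠ k) (h : s.off i k ≠ 0) (j : Fin θ) :
    W.q i j * W.q k j = 1 := s.char_mul_char hik h _

/-- If `c ^ r = 1`, then `c ^ (r - 1)` is the inverse of `c`. -/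
theorem pow_pred {c d : K} {r : ℕ} (hr : 2 ≤ r) (hc : c ^ r = 1) (hcd : c * d = 1) :
    c ^ (r - 1) = d := by
  obtain ⟨r, rfl⟩ : ∃ k, r = k + 1 := ⟨r - 1, by omega⟩
  have hc0 : c ≠ 0 := left_ne_zero_of_mul_eq_one hcd
  refine mul_left_cancel₀ hc0 ?_
  rw [hcd, ← hc, Nat.add_sub_cancel, pow_succ']

/-- A vertex with two different neighbours has `r_k = 2`: the two relations `χ_i χ_k = χ_j χ_k = 1`
and the braiding condition force `q_kk ^ 2 = 1`. -/
theorem r_eq_two {i j k : Fin θ} (hij : i ≠ j) (hik : i ≠ k) (hjk : j ≠ k) (h : s.off i k ≠ 0)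
    (h' : s.off j k ≠ 0) : W.r k = 2 := by
  have h1 : W.q i j * W.q k j = 1 := s.q_mul_q_off hik h j
  have h2 : W.q j i * W.q k i = 1 := s.q_mul_q_off hjk h' i
  have h3 : W.q i k * W.q k k = 1 := s.q_mul_q_off hik h k
  have h4 : W.q j k * W.q k k = 1 := s.q_mul_q_off hjk h' k
  have h5 := q_mul_q (W := W) hik
  have h6 := q_mul_q (W := W) hjk
  have h7 := q_mul_q (W := W) hij
  have h8 : W.q k i = W.q k k := mul_left_cancel₀ (W.q_ne_zero i k) (h5.trans h3.symm)
  have h9 : W.q k j = W.q k k := mul_left_cancel₀ (W.q_ne_zero j k) (h6.trans h4.symm)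
  rw [h9] at h1
  rw [h8] at h2
  have h10 : W.q k k ^ 2 = 1 := by
    linear_combination (-W.q k k ^ 2) * h7 + W.q j i * W.q k k * h1 + h2
  exact le_antisymm (Nat.le_of_dvd two_pos ((W.q_root k).dvd_of_pow_eq_one 2 h10)) (W.two_le k)

variable {S : Type*} [Ring S] [Algebra K S]

/-- The combination `∑_{j < i} a_ij d_j + a_i d_i ^ (r_i - 1) / (r_i - 1)!` of a family `d`, with
the `q`-factorial for `q = χ_i(g_i)`. For `d_j` the skew derivations dual to the `x_j` this is the
correction term of left multiplication by `x_i` on ordered monomials: an `x_j` with `j < i` is hit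
by the relation of `x_i` and `x_j`, and `x_i ^ (r_i - 1)` by the power relation. -/
def comb (d : Fin θ → S) (i : Fin θ) : S :=
  ∑ j ∈ Finset.Iio i, s.off i j • d j +
    (s.diag i / qFact (W.q i i) (W.r i - 1)) • d i ^ (W.r i - 1)

theorem comb_mul_add (d : Fin θ → S) (i : Fin θ) (T : S) (e : K) (u : Fin θ → S)
    (h1 : ∀ k < i, s.off i k ≠ 0 → d k * T = e • (T * d k) + u k)
    (h2 : s.diag i ≠ 0 → d i ^ (W.r i - 1) * T = e • (T * d i ^ (W.r i - 1))) :
    s.comb d i * T = e • (T * s.comb d i) + ∑ k ∈ Finset.Iio i, s.off i k • u k := by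
  have e1 : ∀ k ∈ Finset.Iio i, (s.off i k • d k) * T =
      e • (T * (s.off i k • d k)) + s.off i k • u k := by
    intro k hk
    by_cases h0 : s.off i k = 0
    · simp [h0]
    · rw [smul_mul_assoc, h1 k (Finset.mem_Iio.mp hk) h0, smul_add, mul_smul_comm, smul_comm]
  have e2 : ((s.diag i / qFact (W.q i i) (W.r i - 1)) • d i ^ (W.r i - 1)) * T =
      e • (T * ((s.diag i / qFact (W.q i i) (W.r i - 1)) • d i ^ (W.r i - 1))) := by
    by_cases h0 : s.diag i = 0
    · simp [h0]
    · rw [smul_mul_assoc, h2 h0, mul_smul_comm, smul_comm]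
  rw [comb, add_mul, Finset.sum_mul, Finset.sum_congr rfl e1, Finset.sum_add_distrib, e2, mul_add,
    Finset.mul_sum, smul_add, Finset.smul_sum]
  abel

theorem comb_mul (d : Fin θ → S) (i : Fin θ) (T : S) (e : K)
    (h1 : ∀ k < i, s.off i k ≠ 0 → d k * T = e • (T * d k))
    (h2 : s.diag i ≠ 0 → d i ^ (W.r i - 1) * T = e • (T * d i ^ (W.r i - 1))) :
    s.comb d i * T = e • (T * s.comb d i) := by
  simpa using s.comb_mul_add d i T e 0 (by simpa using h1) h2

theorem qComm_symm {i j : Fin θ} (h : i ≠ j) {u v : S} (huv : u * v = W.q i j • (v * u)) :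
    v * u = W.q j i • (u * v) := by
  rw [huv, smul_smul, mul_comm, q_mul_q h, one_smul]

/-- The family `d` satisfies the relations of the Nichols algebra of a quantum linear space. -/
structure _root_.QLS.QuantumLinearSpace.IsQuantumSpace (W : QuantumLinearSpace K Γ θ)
    (d : Fin θ → S) : Prop where
  comm : ∀ i j, i ≠ j → d i * d j = W.q j i • (d j * d i)
  pow : ∀ i, d i ^ W.r i = 0

variable {d : Fin θ → S} (hd : W.IsQuantumSpace d)
include hd

/-- If `a_ik ≠ 0`, then `d_k` is a summand of the combination at `i`, and it commutes with the
combination at `j` by the scalar `q_ij` that depends only on `i` and `j`. -/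
theorem comb_mul_of_off {i j k : Fin θ} (hij : j < i) (hki : k < i) (h : s.off i k ≠ 0) :
    s.comb d j * d k = W.q i j • (d k * s.comb d j) := by
  refine s.comb_mul d j (d k) _ (fun l hl h' => ?_) (fun h' => ?_)
  · rcases eq_or_ne l k with rfl | hlk
    · -- `l` has the neighbours `i` and `j`, so that `d_l ^ 2 = 0`
      have h2 := s.r_eq_two hij.ne' hki.ne' hl.ne' h h'
      have h3 : d l * d l = 0 := by rw [← pow_two, ← h2, hd.pow]
      rw [h3, smul_zero]
    · rw [hd.comm l k hlk]
      congr 1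
      have h1 := s.q_mul_q_off hki.ne' h l
      have h2 := s.q_mul_q_off hl.ne' h' i
      have h3 := q_mul_q (W := W) (hl.trans hij).ne'
      have h4 := q_mul_q (W := W) hij.ne'
      have hz := W.q_ne_zero i l
      have hz' := W.q_ne_zero j i
      have h5 : W.q k l = W.q l i := mul_left_cancel₀ hz (h1.trans h3.symm)
      have h6 : W.q l i = W.q i j := mul_left_cancel₀ hz' (by rw [h2, mul_comm, h4])
      rw [h5, h6]
  · rcases eq_or_ne k j with rfl | hkj
    · have h3 : d k ^ (W.r k - 1) * d k = 0 := by
        rw [← pow_succ, Nat.sub_add_cancel (by have := W.two_le k; omega), hd.pow]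
      have h4 : d k * d k ^ (W.r k - 1) = 0 := by
        rw [← pow_succ', Nat.sub_add_cancel (by have := W.two_le k; omega), hd.pow]
      rw [h3, h4, smul_zero]
    · rw [pow_mul_qComm (hd.comm j k hkj.symm)]
      congr 1
      have h1 := s.q_mul_q_off hki.ne' h j
      refine pow_pred (W.two_le j) (s.q_pow' hkj.symm h') (by rw [mul_comm, h1])

theorem comb_mul_of_diag {i j : Fin θ} (hij : j < i) (h : s.diag i ≠ 0) :
    s.comb d j * d i ^ (W.r i - 1) = W.q i j • (d i ^ (W.r i - 1) * s.comb d j) := by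
  refine s.comb_mul d j _ _ (fun l hl h' => ?_) (fun h' => ?_)
  · rw [mul_pow_qComm (hd.comm l i (hl.trans hij).ne)]
    congr 1
    have h2 := s.q_mul_q_off hl.ne' h' i
    have h3 := q_mul_q (W := W) (hl.trans hij).ne'
    have h4 := q_mul_q (W := W) hij.ne'
    have h6 : W.q l i = W.q i j :=
      mul_left_cancel₀ (W.q_ne_zero j i) (by rw [h2, mul_comm, h4])
    exact pow_pred (W.two_le i) (s.q_pow h l) (by rw [← h6, h3])
  · rw [pow_mul_pow_qComm (hd.comm j i hij.ne)]
    congr 1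
    have h4 := q_mul_q (W := W) hij.ne'
    rw [pow_mul, pow_pred (W.two_le j) (s.q_pow' hij.ne h') h4]
    exact pow_pred (W.two_le i) (s.q_pow' hij.ne' h) (by rw [mul_comm, h4])

theorem comb_mul_comb {i j : Fin θ} (hij : j < i) :
    s.comb d i * s.comb d j = W.q j i • (s.comb d j * s.comb d i) :=
  s.comb_mul d i _ _ (fun _ hk h => qComm_symm hij.ne' (s.comb_mul_of_off hd hij hk h))
    (fun h => qComm_symm hij.ne' (s.comb_mul_of_diag hd hij h))

end Param

end QLS.QuantumLinearSpace

namespace QLS.QuantumLinearSpace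

variable {K : Type*} [Field K] {Γ : Type*} [CommGroup Γ] {θ : ℕ} (W : QuantumLinearSpace K Γ θ)

/-! ### Skew derivations of the biproduct -/

theorem Lifting.eq_top_of_mul_mem {a : Fin θ → K} {b : Fin θ → Fin θ → K}
    {V : Submodule K (W.Lifting a b)} (h1 : 1 ∈ V)
    (hG : ∀ h, ∀ y ∈ V, Lifting.of W a b h * y ∈ V)
    (hX : ∀ i, ∀ y ∈ V, Lifting.x W a b i * y ∈ V) : V = ⊤ := by
  have hleft : ∀ y : W.Lifting a b, ∀ s ∈ V, y * s ∈ V := by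
    intro y
    obtain ⟨f, rfl⟩ := Lifting.mk_surjective W a b y
    induction f using FreeAlgebra.induction with
    | grade0 c =>
      intro s hs
      rw [AlgHom.commutes, ← Algebra.smul_def]
      exact V.smul_mem c hs
    | grade1 t =>
      cases t with
      | inl h => exact hG h
      | inr i => exact hX i
    | mul f g hf hg =>
      intro s hs
      rw [map_mul, mul_assoc]
      exact hf _ (hg _ hs)
    | add f g hf hg =>
      intro s hs
      rw [map_add, add_mul]
      exact V.add_mem (hf _ hs) (hg _ hs)
  refine eq_top_iff.mpr fun y _ => ?_
  simpa using hleft y 1 h1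

namespace Biproduct

open Lifting

/-- The two-dimensional representation whose off-diagonal entry is `ξ_i`:
`h ↦ diag(χ_i(h), 1)`, `x_i ↦ E_12`, `x_j ↦ 0` for `j ≠ i`. -/
def matrixRep (i : Fin θ) : W.Biproduct →ₐ[K] Matrix (Fin 2) (Fin 2) K :=
  lift W 0 0 (fun h => !![(W.χ i h : K), 0; 0, 1]) (fun j => if j = i then !![0, 1; 0, 0] else 0)
    (by rw [map_one]; exact Matrix.one_fin_two.symm)
    (fun h k => by simp)
    (fun h j => by
      rcases eq_or_ne j i with rfl | hj
      · simp [Matrix.smul_of]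
      · simp [hj])
    (fun j => by
      have h2 := W.two_le j
      obtain ⟨m, hm⟩ : ∃ m, W.r j = m + 2 := ⟨W.r j - 2, by omega⟩
      rcases eq_or_ne j i with rfl | hj
      · simp only [if_true, Pi.zero_apply, zero_smul]
        rw [hm, pow_add, pow_two, Matrix.mul_fin_two]
        have : !![(0 : K) * 0 + 1 * 0, 0 * 1 + 1 * 0; 0 * 0 + 0 * 0, 0 * 1 + 0 * 0] = 0 := by
          ext a b; fin_cases a <;> fin_cases b <;> simp
        rw [this, mul_zero]
      · simp [hj, hm])
    (fun j k hjk => by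
      rcases eq_or_ne j i with rfl | hj
      · simp [hjk.symm]
      · simp [hj])

/-- The linear form `ξ_i` on `A` dual to `x_i`: it sends `x_i h` to `1` and the other monomials
`X h` to `0`. It is an entry of `matrixRep`, which makes it a skew derivation. -/
def ξ (i : Fin θ) : W.Biproduct →ₗ[K] K :=
  Matrix.entryLinearMap K K 0 1 ∘ₗ (matrixRep W i).toLinearMap

theorem ξ_apply (i : Fin θ) (y : W.Biproduct) : ξ W i y = matrixRep W i y 0 1 := rfl

theorem ξ_one (i : Fin θ) : ξ W i 1 = 0 := by simp [ξ_apply]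

theorem ξ_of_mul (i : Fin θ) (h : Γ) (y : W.Biproduct) :
    ξ W i (of W 0 0 h * y) = (W.χ i h : K) * ξ W i y := by
  simp [ξ_apply, matrixRep, Matrix.mul_apply, Fin.sum_univ_two]

theorem counit_of_mul (h : Γ) (y : W.Biproduct) :
    Coalgebra.counit (R := K) (of W 0 0 h * y) = Coalgebra.counit (R := K) y := by
  rw [Bialgebra.counit_mul, counit_of, one_mul]

theorem counit_x_mul (i : Fin θ) (y : W.Biproduct) :
    Coalgebra.counit (R := K) (x W 0 0 i * y) = 0 := by
  rw [Bialgebra.counit_mul, counit_x, zero_mul]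

theorem matrixRep_one_one (i : Fin θ) (y : W.Biproduct) :
    matrixRep W i y 1 1 = Coalgebra.counit (R := K) y := by
  have h : LinearMap.ker (Matrix.entryLinearMap K K 1 1 ∘ₗ (matrixRep W i).toLinearMap -
      Coalgebra.counit) = ⊤ := by
    refine Lifting.eq_top_of_mul_mem W ?_ (fun h y hy => ?_) (fun j y hy => ?_)
    · simp
    · rw [LinearMap.mem_ker, LinearMap.sub_apply, sub_eq_zero] at hy ⊢
      rw [counit_of_mul, ← hy]
      simp [matrixRep, Matrix.vecMul, dotProduct, Fin.sum_univ_two]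
    · rw [LinearMap.mem_ker, LinearMap.sub_apply, counit_x_mul]
      rcases eq_or_ne j i with rfl | hj
      · simp [matrixRep, Matrix.vecMul, dotProduct, Fin.sum_univ_two]
      · simp [matrixRep, hj]
  have h2 : y ∈ LinearMap.ker (Matrix.entryLinearMap K K 1 1 ∘ₗ (matrixRep W i).toLinearMap -
      Coalgebra.counit) := h ▸ Submodule.mem_top
  rw [LinearMap.mem_ker, LinearMap.sub_apply, sub_eq_zero] at h2
  exact h2

theorem ξ_x_mul (i j : Fin θ) (y : W.Biproduct) :
    ξ W i (x W 0 0 j * y) = if i = j then Coalgebra.counit (R := K) y else 0 := by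
  rw [ξ_apply, map_mul, Matrix.mul_apply, Fin.sum_univ_two, matrixRep_one_one]
  rcases eq_or_ne j i with rfl | hj
  · simp [matrixRep]
  · simp [matrixRep, hj, hj.symm]

/-- Left multiplication by `x_i`. -/
def opL (i : Fin θ) : Module.End K W.Biproduct := LinearMap.mulLeft K (x W 0 0 i)

/-- Left multiplication by `h ∈ Γ`. -/
def opGr (h : Γ) : Module.End K W.Biproduct := LinearMap.mulLeft K (of W 0 0 h)

/-- Right multiplication by `h ∈ Γ`. -/
def opR (h : Γ) : Module.End K W.Biproduct := LinearMap.mulRight K (of W 0 0 h)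

/-- The skew derivation `y ↦ ξ_i(y₁) y₂`. -/
def opD (i : Fin θ) : Module.End K W.Biproduct :=
  (TensorProduct.lid K _).toLinearMap ∘ₗ (ξ W i).rTensor _ ∘ₗ Coalgebra.comul

/-- The skew derivation `y ↦ y₁ ξ_i(y₂)`. -/
def opD' (i : Fin θ) : Module.End K W.Biproduct :=
  (TensorProduct.rid K _).toLinearMap ∘ₗ (ξ W i).lTensor _ ∘ₗ Coalgebra.comul

theorem opL_apply (i : Fin θ) (y : W.Biproduct) : opL W i y = x W 0 0 i * y := rfl
theorem opGr_apply (h : Γ) (y : W.Biproduct) : opGr W h y = of W 0 0 h * y := rfl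
theorem opR_apply (h : Γ) (y : W.Biproduct) : opR W h y = y * of W 0 0 h := rfl
theorem opD_apply (i : Fin θ) (y : W.Biproduct) :
    opD W i y = TensorProduct.lid K _ ((ξ W i).rTensor _ (Coalgebra.comul y)) := rfl
theorem opD'_apply (i : Fin θ) (y : W.Biproduct) :
    opD' W i y = TensorProduct.rid K _ ((ξ W i).lTensor _ (Coalgebra.comul y)) := rfl

theorem opD_one (i : Fin θ) : opD W i 1 = 0 := by
  simp [opD_apply, Algebra.TensorProduct.one_def, ξ_one]

theorem opD'_one (i : Fin θ) : opD' W i 1 = 0 := by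
  simp [opD'_apply, Algebra.TensorProduct.one_def, ξ_one]

theorem opD_mul_opL (i j : Fin θ) :
    opD W i * opL W j = W.q i j • (opL W j * opD W i) + if i = j then 1 else 0 := by
  have key : ∀ t : W.Biproduct ⊗[K] W.Biproduct, TensorProduct.lid K _ ((ξ W i).rTensor _
      ((x W 0 0 j ⊗ₜ 1 + of W 0 0 (W.g j) ⊗ₜ x W 0 0 j) * t)) =
      W.q i j • (x W 0 0 j * TensorProduct.lid K _ ((ξ W i).rTensor _ t)) +
        if i = j then TensorProduct.lid K _ ((Coalgebra.counit (R := K)).rTensor _ t) else 0 := by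
    intro t
    induction t with
    | zero => simp
    | add u v hu hv =>
      rw [mul_add, map_add, map_add, hu, hv]
      split_ifs <;> simp only [map_add, mul_add, smul_add] <;> abel
    | tmul u v =>
      simp only [add_mul, Algebra.TensorProduct.tmul_mul_tmul, map_add, LinearMap.rTensor_tmul,
        TensorProduct.lid_tmul, ξ_x_mul, ξ_of_mul, one_mul]
      split_ifs <;> simp [q, mul_smul, add_comm]
  ext y
  rw [Module.End.mul_apply, opL_apply, opD_apply, Bialgebra.comul_mul, comul_x, key,
    Coalgebra.rTensor_counit_comul]
  split_ifs <;> simp [opL_apply, opD_apply]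

theorem opD_mul_opGr (i : Fin θ) (h : Γ) :
    opD W i * opGr W h = (W.χ i h : K) • (opGr W h * opD W i) := by
  have key : ∀ t : W.Biproduct ⊗[K] W.Biproduct, TensorProduct.lid K _ ((ξ W i).rTensor _
      ((of W 0 0 h ⊗ₜ of W 0 0 h) * t)) =
      (W.χ i h : K) • (of W 0 0 h * TensorProduct.lid K _ ((ξ W i).rTensor _ t)) := by
    intro t
    induction t with
    | zero => simp
    | add u v hu hv =>
      rw [mul_add, map_add, map_add, hu, hv]
      simp only [map_add, mul_add, smul_add]
    | tmul u v => simp [ξ_of_mul, mul_smul]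
  ext y
  rw [Module.End.mul_apply, opGr_apply, opD_apply, Bialgebra.comul_mul, comul_of, key]
  rfl

theorem opD'_mul_opL (i j : Fin θ) :
    opD' W i * opL W j = opL W j * opD' W i + if i = j then opGr W (W.g j) else 0 := by
  have key : ∀ t : W.Biproduct ⊗[K] W.Biproduct, TensorProduct.rid K _ ((ξ W i).lTensor _
      ((x W 0 0 j ⊗ₜ 1 + of W 0 0 (W.g j) ⊗ₜ x W 0 0 j) * t)) =
      x W 0 0 j * TensorProduct.rid K _ ((ξ W i).lTensor _ t) +
        if i = j then of W 0 0 (W.g j) *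
          TensorProduct.rid K _ ((Coalgebra.counit (R := K)).lTensor _ t) else 0 := by
    intro t
    induction t with
    | zero => simp
    | add u v hu hv =>
      rw [mul_add, map_add, map_add, hu, hv]
      split_ifs <;> simp only [map_add, mul_add] <;> abel
    | tmul u v =>
      simp only [add_mul, Algebra.TensorProduct.tmul_mul_tmul, map_add, LinearMap.lTensor_tmul,
        TensorProduct.rid_tmul, ξ_x_mul, one_mul]
      split_ifs <;> simp
  ext y
  rw [Module.End.mul_apply, opL_apply, opD'_apply, Bialgebra.comul_mul, comul_x, key,
    Coalgebra.lTensor_counit_comul]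
  split_ifs <;> simp [opL_apply, opD'_apply, opGr_apply]

theorem opD'_mul_opGr (i : Fin θ) (h : Γ) :
    opD' W i * opGr W h = (W.χ i h : K) • (opGr W h * opD' W i) := by
  have key : ∀ t : W.Biproduct ⊗[K] W.Biproduct, TensorProduct.rid K _ ((ξ W i).lTensor _
      ((of W 0 0 h ⊗ₜ of W 0 0 h) * t)) =
      (W.χ i h : K) • (of W 0 0 h * TensorProduct.rid K _ ((ξ W i).lTensor _ t)) := by
    intro t
    induction t with
    | zero => simp
    | add u v hu hv =>
      rw [mul_add, map_add, map_add, hu, hv]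
      simp only [map_add, mul_add, smul_add]
    | tmul u v => simp [ξ_of_mul, mul_smul]
  ext y
  rw [Module.End.mul_apply, opGr_apply, opD'_apply, Bialgebra.comul_mul, comul_of, key]
  rfl

theorem opL_mul_opL {i j : Fin θ} (h : i ≠ j) :
    opL W i * opL W j = W.q j i • (opL W j * opL W i) := by
  ext y
  simp [opL_apply, ← mul_assoc, x_mul_x W 0 0 h, q]

theorem opL_pow (i : Fin θ) : opL W i ^ W.r i = 0 := by
  rw [opL, LinearMap.pow_mulLeft, x_pow]
  simp

theorem opGr_mul_opL (h : Γ) (i : Fin θ) :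
    opGr W h * opL W i = (W.χ i h : K) • (opL W i * opGr W h) := by
  ext y
  simp [opL_apply, opGr_apply, ← mul_assoc, of_mul_x W 0 0]

theorem opGr_mul_opGr (h k : Γ) : opGr W h * opGr W k = opGr W (h * k) := by
  ext y
  simp [opGr_apply, ← mul_assoc, of_mul]

theorem opGr_one : opGr W 1 = 1 := by
  ext y
  simp [opGr_apply, of_one]

theorem opR_mul_opL (h : Γ) (i : Fin θ) : opR W h * opL W i = opL W i * opR W h := by
  ext y
  simp [opL_apply, opR_apply, mul_assoc]

theorem opR_mul_opGr (h k : Γ) : opR W h * opGr W k = opGr W k * opR W h := by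
  ext y
  simp [opR_apply, opGr_apply, mul_assoc]

variable {W} in
/-- An endomorphism is zero if it kills `1` and commutes up to scalars with the left multiplications
by the generators. Identities between operators are proved by applying this to the difference of the
two sides. -/
theorem end_eq_zero {T : Module.End K W.Biproduct} (h1 : T 1 = 0)
    (hL : ∀ i, ∃ c : K, T * opL W i = c • (opL W i * T))
    (hG : ∀ h, ∃ c : K, T * opGr W h = c • (opGr W h * T)) : T = 0 := by
  have : LinearMap.ker T = ⊤ := by
    refine Lifting.eq_top_of_mul_mem W h1 (fun h y hy => ?_) (fun i y hy => ?_)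
    · obtain ⟨c, hc⟩ := hG h
      have := LinearMap.congr_fun hc y
      rw [LinearMap.mem_ker] at hy ⊢
      simpa [opGr_apply, hy] using this
    · obtain ⟨c, hc⟩ := hL i
      have := LinearMap.congr_fun hc y
      rw [LinearMap.mem_ker] at hy ⊢
      simpa [opL_apply, hy] using this
  exact LinearMap.ker_eq_top.mp this

end Biproduct

end QLS.QuantumLinearSpace

namespace QLS.QuantumLinearSpace

variable {K : Type*} [Field K] {Γ : Type*} [CommGroup Γ] {θ : ℕ} (W : QuantumLinearSpace K Γ θ)

namespace Biproduct

open Lifting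

theorem opGr_mul_opD' (h : Γ) (i : Fin θ) :
    opGr W h * opD' W i = (W.χ i h : K)⁻¹ • (opD' W i * opGr W h) := by
  rw [opD'_mul_opGr, smul_smul, inv_mul_cancel₀ (Units.ne_zero _), one_smul]

/-! ### The algebra of skew derivations -/

theorem opD_mul_opD' (i j : Fin θ) : opD W i * opD' W j = opD' W j * opD W i := by
  refine sub_eq_zero.mp (end_eq_zero ?_ (fun k => ⟨W.q i k, ?_⟩)
    (fun h => ⟨(W.χ i h : K) * W.χ j h, ?_⟩))
  · simp [opD_one, opD'_one]
  · have e1 : opD W i * (if j = k then opGr W (W.g k) else 0) =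
        W.q i k • ((if j = k then opGr W (W.g k) else 0) * opD W i) := by
      split_ifs
      · exact opD_mul_opGr W i _
      · simp
    have e2 : opD' W j * (if i = k then (1 : Module.End K W.Biproduct) else 0) =
        (if i = k then (1 : Module.End K W.Biproduct) else 0) * opD' W j := by split_ifs <;> simp
    rw [sub_mul, mul_assoc, mul_assoc, opD'_mul_opL, opD_mul_opL, mul_add, mul_add, e1, e2,
      ← mul_assoc, opD_mul_opL, mul_smul_comm, ← mul_assoc, opD'_mul_opL, mul_sub, add_mul, add_mul,
      smul_mul_assoc, ← mul_assoc, ← mul_assoc]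
    module
  · rw [sub_mul, mul_assoc, mul_assoc, opD'_mul_opGr, opD_mul_opGr, mul_smul_comm, mul_smul_comm,
      ← mul_assoc, ← mul_assoc, opD'_mul_opGr, opD_mul_opGr, mul_sub, smul_mul_assoc,
      smul_mul_assoc, mul_assoc, mul_assoc]
    module

theorem opD_mul_opD {i j : Fin θ} (hij : i ≠ j) :
    opD W i * opD W j = W.q j i • (opD W j * opD W i) := by
  refine sub_eq_zero.mp (end_eq_zero ?_ (fun k => ⟨W.q i k * W.q j k, ?_⟩)
    (fun h => ⟨(W.χ i h : K) * W.χ j h, ?_⟩))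
  · simp [opD_one]
  · have e : ∀ i j : Fin θ, opD W i * (opD W j * opL W k) =
        (W.q i k * W.q j k) • (opL W k * (opD W i * opD W j)) +
          (if i = k then W.q j k • opD W j else 0) + (if j = k then opD W i else 0) := by
      intro i j
      rw [opD_mul_opL, mul_add, mul_smul_comm, ← mul_assoc, opD_mul_opL, add_mul, smul_mul_assoc,
        mul_assoc]
      split_ifs <;> simp [mul_smul, mul_comm (W.q i k)]
    rw [sub_mul, smul_mul_assoc, mul_assoc, mul_assoc, e, e, mul_sub, mul_smul_comm]
    by_cases hi : i = k
    · subst hi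
      simp only [if_true, if_neg hij.symm]
      module
    · by_cases hj : j = k
      · subst hj
        have h1 := q_mul_q (W := W) hij
        simp only [if_true, if_neg hij]
        rw [smul_add, smul_add, smul_smul (W.q j i) (W.q i j), mul_comm (W.q j i), h1]
        simp
        module
      · simp only [if_neg hi, if_neg hj]
        module
  · have e : ∀ i j : Fin θ, opD W i * (opD W j * opGr W h) =
        ((W.χ i h : K) * W.χ j h) • (opGr W h * (opD W i * opD W j)) := by
      intro i j
      rw [opD_mul_opGr, mul_smul_comm, ← mul_assoc, opD_mul_opGr, smul_mul_assoc,
        mul_assoc, smul_smul, mul_comm (W.χ j h : K)]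
    rw [sub_mul, smul_mul_assoc, mul_assoc, mul_assoc, e, e, mul_sub, mul_smul_comm]
    module

theorem opD'_mul_opD' {i j : Fin θ} (hij : i ≠ j) :
    opD' W i * opD' W j = W.q i j • (opD' W j * opD' W i) := by
  refine sub_eq_zero.mp (end_eq_zero ?_ (fun k => ⟨1, ?_⟩)
    (fun h => ⟨(W.χ i h : K) * W.χ j h, ?_⟩))
  · simp [opD'_one]
  · have e : ∀ i j : Fin θ, opD' W i * (opD' W j * opL W k) =
        opL W k * (opD' W i * opD' W j) +
          (if i = k then opGr W (W.g k) * opD' W j else 0) +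
          (if j = k then W.q i k • (opGr W (W.g k) * opD' W i) else 0) := by
      intro i j
      rw [opD'_mul_opL, mul_add, ← mul_assoc, opD'_mul_opL, add_mul, mul_assoc]
      split_ifs <;> simp [opD'_mul_opGr, q]
    rw [sub_mul, smul_mul_assoc, mul_assoc, mul_assoc, e, e, mul_sub, mul_smul_comm]
    by_cases hi : i = k
    · subst hi
      have h1 := q_mul_q (W := W) hij
      simp only [if_true, if_neg hij.symm]
      rw [smul_add, smul_add, smul_smul (W.q i j), h1]
      simp
    · by_cases hj : j = k
      · subst hj
        simp only [if_true, if_neg hij]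
        module
      · simp only [if_neg hi, if_neg hj]
        module
  · have e : ∀ i j : Fin θ, opD' W i * (opD' W j * opGr W h) =
        ((W.χ i h : K) * W.χ j h) • (opGr W h * (opD' W i * opD' W j)) := by
      intro i j
      rw [opD'_mul_opGr, mul_smul_comm, ← mul_assoc, opD'_mul_opGr, smul_mul_assoc,
        mul_assoc, smul_smul, mul_comm (W.χ j h : K)]
    rw [sub_mul, smul_mul_assoc, mul_assoc, mul_assoc, e, e, mul_sub, mul_smul_comm]
    module

theorem opD_pow (i : Fin θ) : opD W i ^ W.r i = 0 := by
  obtain ⟨m, hm⟩ : ∃ m, W.r i = m + 1 := ⟨W.r i - 1, by have := W.two_le i; omega⟩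
  refine end_eq_zero ?_ (fun k => ⟨W.q i k ^ W.r i, ?_⟩)
    (fun h => ⟨(W.χ i h : K) ^ W.r i, pow_mul_qComm (opD_mul_opGr W i h) _⟩)
  · rw [hm, pow_succ, Module.End.mul_apply, opD_one, map_zero]
  · rcases eq_or_ne i k with rfl | hk
    · have := pow_mul_of_qComm_add (X := opD W i) (Y := opL W i) (c := W.q i i) (u := 1) (v := 0)
        (e := 1) (f := 1) (by simp [opD_mul_opL]) (by simp) (by simp) m
      rw [← hm, mul_one, qInt_eq_zero] at this
      simpa using this
    · exact pow_mul_qComm (by simp [opD_mul_opL, hk]) _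

theorem opD'_pow (i : Fin θ) : opD' W i ^ W.r i = 0 := by
  obtain ⟨m, hm⟩ : ∃ m, W.r i = m + 1 := ⟨W.r i - 1, by have := W.two_le i; omega⟩
  refine end_eq_zero ?_ (fun k => ⟨1, ?_⟩)
    (fun h => ⟨(W.χ i h : K) ^ W.r i, pow_mul_qComm (opD'_mul_opGr W i h) _⟩)
  · rw [hm, pow_succ, Module.End.mul_apply, opD'_one, map_zero]
  · rcases eq_or_ne i k with rfl | hk
    · have := pow_mul_of_qComm_add (X := opD' W i) (Y := opL W i) (c := 1)
        (u := opGr W (W.g i)) (v := 0) (e := (W.q i i)⁻¹) (f := 1)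
        (by simp [opD'_mul_opL]) (opGr_mul_opD' W _ i) (by simp) m
      rw [← hm, one_mul, qInt_inv_eq_zero] at this
      simpa using this
    · rw [pow_mul_qComm (c := (1 : K)) (by simp [opD'_mul_opL, hk]), one_pow]

theorem isQuantumSpace_opD : W.IsQuantumSpace (opD W) where
  comm _ _ := opD_mul_opD W
  pow := opD_pow W

theorem isQuantumSpace_opD' : W.IsQuantumSpace fun i => MulOpposite.op (opD' W i) where
  comm i j h := by
    rw [← MulOpposite.op_mul, opD'_mul_opD' W h.symm]
    rfl
  pow i := by rw [← MulOpposite.op_pow, opD'_pow, MulOpposite.op_zero]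

theorem opR_mul_opD (h : Γ) (i : Fin θ) : opR W h * opD W i = opD W i * opR W h := by
  refine sub_eq_zero.mp (end_eq_zero ?_ (fun k => ⟨W.q i k, ?_⟩) (fun k => ⟨(W.χ i k : K), ?_⟩))
  · have := LinearMap.congr_fun (opD_mul_opGr W i h) 1
    simp only [Module.End.mul_apply, opGr_apply, mul_one, LinearMap.smul_apply, opD_one,
      mul_zero, smul_zero] at this
    simp [opD_one, opR_apply, this]
  · rw [sub_mul, mul_assoc, mul_assoc, opR_mul_opL, opD_mul_opL, mul_add, mul_smul_comm,
      ← mul_assoc,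
      opR_mul_opL, ← mul_assoc, opD_mul_opL, mul_sub, add_mul, smul_mul_assoc, mul_assoc, mul_assoc]
    split_ifs
    · rw [mul_one, one_mul]; module
    · rw [mul_zero, zero_mul]; module
  · rw [sub_mul, mul_assoc, mul_assoc, opR_mul_opGr, opD_mul_opGr, mul_smul_comm, ← mul_assoc,
      opR_mul_opGr, ← mul_assoc, opD_mul_opGr, mul_sub, smul_mul_assoc, mul_assoc, mul_assoc]
    module

theorem opR_mul_opD' (h : Γ) (i : Fin θ) : opR W h * opD' W i = opD' W i * opR W h := by
  refine sub_eq_zero.mp (end_eq_zero ?_ (fun k => ⟨1, ?_⟩) (fun k => ⟨(W.χ i k : K), ?_⟩))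
  · have := LinearMap.congr_fun (opD'_mul_opGr W i h) 1
    simp only [Module.End.mul_apply, opGr_apply, mul_one, LinearMap.smul_apply, opD'_one,
      mul_zero, smul_zero] at this
    simp [opD'_one, opR_apply, this]
  · rw [sub_mul, mul_assoc, mul_assoc, opR_mul_opL, opD'_mul_opL, mul_add, ← mul_assoc,
      opR_mul_opL, ← mul_assoc, opD'_mul_opL, mul_sub, add_mul, mul_assoc, mul_assoc]
    split_ifs
    · rw [opR_mul_opGr]; module
    · rw [mul_zero, zero_mul]; module
  · rw [sub_mul, mul_assoc, mul_assoc, opR_mul_opGr, opD'_mul_opGr, mul_smul_comm, ← mul_assoc,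
      opR_mul_opGr, ← mul_assoc, opD'_mul_opGr, mul_sub, smul_mul_assoc, mul_assoc, mul_assoc]
    module

theorem counit_opD (i : Fin θ) (y : W.Biproduct) :
    Coalgebra.counit (R := K) (opD W i y) = ξ W i y := by
  have key : ∀ t : W.Biproduct ⊗[K] W.Biproduct,
      Coalgebra.counit (R := K) (TensorProduct.lid K _ ((ξ W i).rTensor _ t)) =
        ξ W i (TensorProduct.rid K _ ((Coalgebra.counit (R := K)).lTensor _ t)) := by
    intro t
    induction t with
    | zero => simp
    | add u v hu hv => simp only [map_add, hu, hv]
    | tmul u v => simp [mul_comm]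
  rw [opD_apply, key, Coalgebra.lTensor_counit_comul]
  simp

theorem counit_opD' (i : Fin θ) (y : W.Biproduct) :
    Coalgebra.counit (R := K) (opD' W i y) = ξ W i y := by
  have key : ∀ t : W.Biproduct ⊗[K] W.Biproduct,
      Coalgebra.counit (R := K) (TensorProduct.rid K _ ((ξ W i).lTensor _ t)) =
        ξ W i (TensorProduct.lid K _ ((Coalgebra.counit (R := K)).rTensor _ t)) := by
    intro t
    induction t with
    | zero => simp
    | add u v hu hv => simp only [map_add, hu, hv]
    | tmul u v => simp [mul_comm]
  rw [opD'_apply, key, Coalgebra.rTensor_counit_comul]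
  simp

theorem comul_opD (i : Fin θ) (y : W.Biproduct) :
    Coalgebra.comul (R := K) (opD W i y) = (opD W i).rTensor _ (Coalgebra.comul y) := by
  have key : ∀ t : W.Biproduct ⊗[K] W.Biproduct,
      Coalgebra.comul (R := K) (TensorProduct.lid K _ ((ξ W i).rTensor _ t)) =
        TensorProduct.lid K _ ((ξ W i).rTensor _ (Coalgebra.comul.lTensor _ t)) := by
    intro t
    induction t with
    | zero => simp
    | add u v hu hv => simp only [map_add, hu, hv]
    | tmul u v => simp
  have key2 : ∀ t : (W.Biproduct ⊗[K] W.Biproduct) ⊗[K] W.Biproduct,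
      TensorProduct.lid K _ ((ξ W i).rTensor _ (TensorProduct.assoc K _ _ _ t)) =
        ((TensorProduct.lid K _).toLinearMap ∘ₗ (ξ W i).rTensor _).rTensor _ t := by
    intro t
    induction t with
    | zero => simp
    | add u v hu hv => simp only [map_add, hu, hv]
    | tmul w v =>
      induction w with
      | zero => simp
      | add u w hu hw => simp only [add_tmul, map_add, hu, hw]
      | tmul a b => simp [smul_tmul']
  rw [opD_apply, key, ← Coalgebra.coassoc_apply, key2, ← LinearMap.rTensor_comp_apply]
  rfl

theorem comul_opD' (i : Fin θ) (y : W.Biproduct) :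
    Coalgebra.comul (R := K) (opD' W i y) = (opD' W i).lTensor _ (Coalgebra.comul y) := by
  have key : ∀ t : W.Biproduct ⊗[K] W.Biproduct,
      Coalgebra.comul (R := K) (TensorProduct.rid K _ ((ξ W i).lTensor _ t)) =
        TensorProduct.rid K _ ((ξ W i).lTensor _ (Coalgebra.comul.rTensor _ t)) := by
    intro t
    induction t with
    | zero => simp
    | add u v hu hv => simp only [map_add, hu, hv]
    | tmul u v => simp
  have key2 : ∀ t : (W.Biproduct ⊗[K] W.Biproduct) ⊗[K] W.Biproduct,
      TensorProduct.rid K _ ((ξ W i).lTensor _ t) =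
        ((TensorProduct.rid K _).toLinearMap ∘ₗ (ξ W i).lTensor _).lTensor _
          (TensorProduct.assoc K _ _ _ t) := by
    intro t
    induction t with
    | zero => simp
    | add u v hu hv => simp only [map_add, hu, hv]
    | tmul w v =>
      induction w with
      | zero => simp
      | add u w hu hw => simp only [add_tmul, map_add, hu, hw]
      | tmul a b => simp
  rw [opD'_apply, key, key2, Coalgebra.coassoc_apply, ← LinearMap.lTensor_comp_apply]
  rfl

theorem rTensor_opD'_comul (i : Fin θ) (y : W.Biproduct) :
    (opD' W i).rTensor _ (Coalgebra.comul (R := K) y) =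
      (opD W i).lTensor _ (Coalgebra.comul (R := K) y) := by
  have key : ∀ t : (W.Biproduct ⊗[K] W.Biproduct) ⊗[K] W.Biproduct,
      ((TensorProduct.rid K _).toLinearMap ∘ₗ (ξ W i).lTensor _).rTensor _ t =
        ((TensorProduct.lid K _).toLinearMap ∘ₗ (ξ W i).rTensor _).lTensor _
          (TensorProduct.assoc K _ _ _ t) := by
    intro t
    induction t with
    | zero => simp
    | add u v hu hv => simp only [map_add, hu, hv]
    | tmul w v =>
      induction w with
      | zero => simp
      | add u w hu hw => simp only [add_tmul, map_add, hu, hw]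
      | tmul a b => simp [smul_tmul]
  have h := key (Coalgebra.comul.rTensor _ (Coalgebra.comul (R := K) y))
  rw [Coalgebra.coassoc_apply, ← LinearMap.rTensor_comp_apply, ← LinearMap.lTensor_comp_apply] at h
  exact h

end Biproduct

end QLS.QuantumLinearSpace

namespace QLS.QuantumLinearSpace

variable {K : Type*} [Field K] {Γ : Type*} [CommGroup Γ] {θ : ℕ} (W : QuantumLinearSpace K Γ θ)

namespace Biproduct

open Lifting

variable {W} (s t : W.Param)

/-! ### Deformed left multiplications -/

/-- The operator `y ↦ f_i(y₁) y₂`, where `f_i` is the linear form on `A` with `f_i(x_j h) = a_ij`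
for `j < i`, `f_i(x_i ^ (r_i - 1) h) = a_i`, and zero on the other monomials. -/
def opP (i : Fin θ) : Module.End K W.Biproduct := s.comb (opD W) i

/-- The operator `y ↦ y₁ f_i(y₂)`, with `f_i` as in `opP`. -/
def opP' (i : Fin θ) : Module.End K W.Biproduct := s.comb (opD' W) i

/-- The operator `y ↦ g_i y₁ f_i(y₂)`, with `f_i` as in `opP`. -/
def opQ (i : Fin θ) : Module.End K W.Biproduct := opGr W (W.g i) * opP' s i

/-- Left multiplication by `x_i` in the two-sided deformation of `A` with relations
`x_i ^ r_i = s_i - t_i g_i ^ r_i` and `x_i x_j = χ_j(g_i) x_j x_i + s_ij - t_ij g_i g_j`, in the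
coordinates given by the ordered monomials. -/
def opY (i : Fin θ) : Module.End K W.Biproduct := opL W i + opP s i - opQ t i

theorem q_inv {i j : Fin θ} (h : i ≠ j) : (W.q i j)⁻¹ = W.q j i :=
  inv_eq_of_mul_eq_one_right (q_mul_q h)

theorem comb_mul_opGr (d : Fin θ → Module.End K W.Biproduct) (i : Fin θ) (h : Γ)
    (hd : ∀ k, d k * opGr W h = (W.χ k h : K) • (opGr W h * d k)) :
    s.comb d i * opGr W h = (W.χ i h : K)⁻¹ • (opGr W h * s.comb d i) := by
  refine s.comb_mul d i _ _ (fun k hk h0 => ?_) (fun h0 => ?_)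
  · rw [hd, eq_inv_of_mul_eq_one_right (s.char_mul_char hk.ne' h0 h)]
  · rw [pow_mul_qComm (c := (W.χ i h : K)) (hd i), Param.pow_pred (W.two_le i) (s.char_pow h0 h)
      (mul_inv_cancel₀ (Units.ne_zero _))]

theorem opP_mul_opGr (i : Fin θ) (h : Γ) :
    opP s i * opGr W h = (W.χ i h : K)⁻¹ • (opGr W h * opP s i) :=
  comb_mul_opGr s _ i h fun k => opD_mul_opGr W k h

theorem opP'_mul_opGr (i : Fin θ) (h : Γ) :
    opP' s i * opGr W h = (W.χ i h : K)⁻¹ • (opGr W h * opP' s i) :=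
  comb_mul_opGr s _ i h fun k => opD'_mul_opGr W k h

theorem sum_off_ite (i j : Fin θ) (T : Module.End K W.Biproduct) :
    ∑ k ∈ Finset.Iio i, s.off i k • (if k = j then T else 0) =
      (if j < i then s.off i j else 0) • T := by
  simp only [smul_ite, smul_zero, Finset.sum_ite_eq', Finset.mem_Iio, ite_smul, zero_smul]

/-- The operator `f_i` commutes with `x_j`, up to a scalar and up to the constant `a_ij`. The case
`i = j`, which would involve `x_i ^ (r_i - 2)`, is not of this form; there the power relation is
obtained from `opY_pow`. -/
theorem opP_mul_opL {i j : Fin θ} (hij : i ≠ j) : opP s i * opL W j =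
    W.q j i • (opL W j * opP s i) + (if j < i then s.off i j else 0) • 1 := by
  rw [opP, s.comb_mul_add (opD W) i (opL W j) (W.q j i) (fun k => if k = j then 1 else 0)
    (fun k hk h0 => ?_) (fun h0 => ?_), sum_off_ite]
  · rw [opD_mul_opL, ← q_inv hij, eq_inv_of_mul_eq_one_right (s.q_mul_q_off hk.ne' h0 j)]
  · rw [pow_mul_qComm (c := W.q i j) (by simp [opD_mul_opL, hij]),
      Param.pow_pred (W.two_le i) (s.q_pow h0 j) (q_mul_q hij)]

theorem opP'_mul_opL {i j : Fin θ} (hij : i ≠ j) : opP' s i * opL W j =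
    opL W j * opP' s i + (if j < i then s.off i j else 0) • opGr W (W.g j) := by
  rw [opP', s.comb_mul_add (opD' W) i (opL W j) 1 (fun k => if k = j then opGr W (W.g j) else 0)
    (fun k hk h0 => ?_) (fun h0 => ?_), sum_off_ite, one_smul]
  · rw [opD'_mul_opL, one_smul]
  · rw [pow_mul_qComm (c := (1 : K)) (by simp [opD'_mul_opL, hij]), one_pow]

theorem opQ_mul_opL {i j : Fin θ} (hij : i ≠ j) : opQ s i * opL W j =
    W.q j i • (opL W j * opQ s i) +
      (if j < i then s.off i j else 0) • opGr W (W.g i * W.g j) := by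
  rw [opQ, mul_assoc, opP'_mul_opL s hij, mul_add, ← mul_assoc, opGr_mul_opL, mul_smul_comm,
    opGr_mul_opGr, smul_mul_assoc, mul_assoc]
  rfl

theorem opP_mul_opP {i j : Fin θ} (hij : j < i) :
    opP s i * opP s j = W.q j i • (opP s j * opP s i) :=
  s.comb_mul_comb (isQuantumSpace_opD W) hij

theorem op_comb (i : Fin θ) :
    s.comb (fun k => MulOpposite.op (opD' W k)) i = MulOpposite.op (opP' s i) := by
  rw [Param.comb, opP', Param.comb, MulOpposite.op_add, MulOpposite.op_smul, MulOpposite.op_pow]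
  congr 1
  exact (map_sum (MulOpposite.opAddEquiv : Module.End K W.Biproduct ≃+ _) _ _).symm

theorem opP'_mul_opP' {i j : Fin θ} (hij : j < i) :
    opP' s j * opP' s i = W.q j i • (opP' s i * opP' s j) := by
  have h := s.comb_mul_comb (isQuantumSpace_opD' W) hij
  rw [op_comb, op_comb, ← MulOpposite.op_mul, ← MulOpposite.op_mul, ← MulOpposite.op_smul] at h
  exact MulOpposite.op_injective h

theorem opD_mul_opP' (i j : Fin θ) : opD W i * opP' t j = opP' t j * opD W i := by
  have h := t.comb_mul (opD' W) j (opD W i) 1 (fun k _ _ => by rw [one_smul, opD_mul_opD'])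
    (fun _ => by
      rw [pow_mul_qComm (c := (1 : K)) (by rw [one_smul, opD_mul_opD']), one_pow])
  rw [one_smul] at h
  exact h.symm

theorem opP_mul_opP'_comm (i j : Fin θ) : opP s i * opP' t j = opP' t j * opP s i := by
  have h := s.comb_mul (opD W) i (opP' t j) 1 (fun k _ _ => by rw [one_smul, opD_mul_opP'])
    (fun _ => by
      rw [pow_mul_qComm (c := (1 : K)) (by rw [one_smul, opD_mul_opP']), one_pow])
  rwa [one_smul] at h

theorem opP_mul_opQ (i j : Fin θ) :
    opP s i * opQ t j = (W.q i j)⁻¹ • (opQ t j * opP s i) := by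
  rw [opQ, ← mul_assoc, opP_mul_opGr, smul_mul_assoc, mul_assoc, opP_mul_opP'_comm, mul_assoc]
  rfl

theorem opQ_mul_opQ {i j : Fin θ} (hij : j < i) :
    opQ s i * opQ s j = W.q j i • (opQ s j * opQ s i) := by
  have e1 : opQ s i * opQ s j = W.q j i • (opGr W (W.g i * W.g j) * (opP' s i * opP' s j)) := by
    rw [opQ, opQ, mul_assoc, ← mul_assoc (opP' s i), opP'_mul_opGr, smul_mul_assoc,
      mul_smul_comm, mul_assoc, ← mul_assoc, opGr_mul_opGr, ← q_inv hij.ne']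
    rfl
  have e2 : opQ s j * opQ s i = W.q i j • (opGr W (W.g j * W.g i) * (opP' s j * opP' s i)) := by
    rw [opQ, opQ, mul_assoc, ← mul_assoc (opP' s j), opP'_mul_opGr, smul_mul_assoc,
      mul_smul_comm, mul_assoc, ← mul_assoc, opGr_mul_opGr, ← q_inv hij.ne]
    rfl
  rw [e1, e2, opP'_mul_opP' s hij, mul_smul_comm, smul_smul (W.q i j), q_mul_q hij.ne', one_smul,
    mul_comm (W.g i)]

theorem opY_mul_opY_of_lt {i j : Fin θ} (hij : j < i) : opY s t i * opY s t j =
    W.q j i • (opY s t j * opY s t i) + s.off i j • 1 - t.off i j • opGr W (W.g i * W.g j) := by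
  have e1 := opL_mul_opL W hij.ne'
  have e2 := opP_mul_opL s hij.ne'
  have e3 := opQ_mul_opL t hij.ne'
  have e4 := opP_mul_opL s hij.ne
  have e5 := opQ_mul_opL t hij.ne
  rw [if_pos hij] at e2 e3
  rw [if_neg hij.not_gt, zero_smul, add_zero] at e4 e5
  have e4 := Param.qComm_symm hij.ne' e4
  have e5 := Param.qComm_symm hij.ne' e5
  have e6 := opP_mul_opP s hij
  have e7 := opQ_mul_opQ t hij
  have e8 := opP_mul_opQ s t i j
  rw [q_inv hij.ne'] at e8
  have e9 := opP_mul_opQ s t j i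
  rw [q_inv hij.ne] at e9
  have e9 := Param.qComm_symm hij.ne' e9
  simp only [opY, add_mul, sub_mul, mul_add, mul_sub, e1, e2, e3, e4, e5, e6, e7, e8, e9]
  module

theorem opY_mul_opY {i j : Fin θ} (hij : i ≠ j) : opY s t i * opY s t j =
    W.q j i • (opY s t j * opY s t i) + s.off i j • 1 - t.off i j • opGr W (W.g i * W.g j) := by
  rcases lt_or_gt_of_ne hij with h | h
  · have h1 := opY_mul_opY_of_lt s t h
    have h2 := q_mul_q (W := W) hij.symm
    rw [s.off_swap i j hij, t.off_swap i j hij] at h1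
    rw [h1, smul_sub, smul_add, smul_smul, smul_smul, smul_smul, h2, mul_comm (W.g j),
      ← mul_assoc, ← mul_assoc, mul_neg, h2]
    module
  · exact opY_mul_opY_of_lt s t h

theorem opGr_mul_opY (h : Γ) (i : Fin θ) :
    opGr W h * opY s t i = (W.χ i h : K) • (opY s t i * opGr W h) := by
  have e2 : opGr W h * opQ t i = (W.χ i h : K) • (opQ t i * opGr W h) := by
    rw [opQ, mul_assoc, opP'_mul_opGr, mul_smul_comm, smul_smul, mul_inv_cancel₀ (Units.ne_zero _),
      one_smul, ← mul_assoc, ← mul_assoc, opGr_mul_opGr, opGr_mul_opGr, mul_comm h]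
  rw [opY, mul_sub, mul_add, e2, opGr_mul_opL, sub_mul, add_mul, opP_mul_opGr, smul_sub, smul_add,
    smul_smul, mul_inv_cancel₀ (Units.ne_zero _), one_smul]

theorem opR_mul_opY (h : Γ) (i : Fin θ) : opR W h * opY s t i = opY s t i * opR W h := by
  have e : ∀ (u : W.Param) (d : Fin θ → Module.End K W.Biproduct),
      (∀ k, opR W h * d k = d k * opR W h) → opR W h * u.comb d i = u.comb d i * opR W h := by
    intro u d hd
    have := u.comb_mul d i (opR W h) 1 (fun k _ _ => by rw [one_smul, hd]) (fun _ => by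
      rw [pow_mul_qComm (c := (1 : K)) (by rw [one_smul, hd]), one_pow])
    rw [this, one_smul]
  rw [opY, mul_sub, mul_add, opQ, ← mul_assoc, opR_mul_opGr, mul_assoc, opP, opP',
    e s _ fun k => opR_mul_opD W h k, e t _ fun k => opR_mul_opD' W h k, opR_mul_opL, sub_mul,
    add_mul, mul_assoc]

/-! ### The action on ordered monomials -/

theorem opL_pow_apply (i : Fin θ) (m : ℕ) (y : W.Biproduct) :
    (opL W i ^ m) y = x W 0 0 i ^ m * y := by
  rw [opL, LinearMap.pow_mulLeft, LinearMap.mulLeft_apply]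

theorem qInt_succ (q : K) (m : ℕ) : qInt q (m + 1) = qInt q m + q ^ m := Finset.sum_range_succ _ _

theorem qInt_succ' (q : K) (m : ℕ) : qInt q (m + 1) = 1 + q * qInt q m := by
  rw [qInt, Finset.sum_range_succ', qInt, Finset.mul_sum, add_comm]
  simp [pow_succ']

theorem opD_opL_pow (i : Fin θ) {y : W.Biproduct} (hy : opD W i y = 0) (m : ℕ) :
    opD W i ((opL W i ^ (m + 1)) y) = qInt (W.q i i) (m + 1) • (opL W i ^ m) y := by
  have e : ∀ z, opD W i (opL W i z) = W.q i i • opL W i (opD W i z) + z := fun z => by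
    have := LinearMap.congr_fun (opD_mul_opL W i i) z
    simpa using this
  induction m with
  | zero => simp [e, hy, qInt]
  | succ m ih =>
    rw [pow_succ', Module.End.mul_apply, e, ih, map_smul, smul_smul, qInt_succ' _ (m + 1), add_smul,
      one_smul, ← Module.End.mul_apply (opL W i), ← pow_succ', add_comm]

theorem opD'_opL_pow (i : Fin θ) {y : W.Biproduct} (hy : opD' W i y = 0) (m : ℕ) :
    opD' W i ((opL W i ^ (m + 1)) y) =
      qInt (W.q i i) (m + 1) • (opL W i ^ m) (opGr W (W.g i) y) := by
  have e : ∀ z, opD' W i (opL W i z) = opL W i (opD' W i z) + opGr W (W.g i) z := fun z => by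
    have := LinearMap.congr_fun (opD'_mul_opL W i i) z
    simpa using this
  have e2 : ∀ m, opGr W (W.g i) ((opL W i ^ m) y) =
      W.q i i ^ m • (opL W i ^ m) (opGr W (W.g i) y) := fun m =>
    LinearMap.congr_fun (mul_pow_qComm (c := W.q i i) (opGr_mul_opL W (W.g i) i) m) y
  induction m with
  | zero => simp [e, hy, qInt]
  | succ m ih =>
    rw [pow_succ', Module.End.mul_apply, e, ih, e2, map_smul, ← Module.End.mul_apply (opL W i),
      ← pow_succ', qInt_succ _ (m + 1), add_smul]

theorem opD_pow_opL_pow (i : Fin θ) {y : W.Biproduct} (hy : opD W i y = 0) (m : ℕ) :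
    (opD W i ^ m) ((opL W i ^ m) y) = qFact (W.q i i) m • y := by
  induction m with
  | zero => simp [qFact]
  | succ m ih =>
    rw [pow_succ, Module.End.mul_apply, opD_opL_pow i hy, map_smul, ih, smul_smul, qFact_succ,
      mul_comm]

theorem opD'_opGr {i : Fin θ} {y : W.Biproduct} (hy : opD' W i y = 0) (h : Γ) :
    opD' W i (opGr W h y) = 0 := by
  have := LinearMap.congr_fun (opD'_mul_opGr W i h) y
  simpa [hy] using this

theorem opD'_pow_opL_pow (i : Fin θ) {y : W.Biproduct} (hy : opD' W i y = 0) (m : ℕ) :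
    (opD' W i ^ m) ((opL W i ^ m) y) = qFact (W.q i i) m • opGr W (W.g i ^ m) y := by
  induction m generalizing y with
  | zero => simp [qFact, opGr_one]
  | succ m ih =>
    rw [pow_succ, Module.End.mul_apply, opD'_opL_pow i hy, map_smul, ih (opD'_opGr hy _), smul_smul,
      qFact_succ, mul_comm, ← Module.End.mul_apply, opGr_mul_opGr, pow_succ]

theorem opD_opL_pow_of_ne {i j : Fin θ} (hij : i ≠ j) {y : W.Biproduct} (hy : opD W i y = 0)
    (m : ℕ) : opD W i ((opL W j ^ m) y) = 0 := by
  have := LinearMap.congr_fun (mul_pow_qComm (d := opD W i) (T := opL W j) (c := W.q i j)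
    (by simp [opD_mul_opL, hij]) m) y
  simpa [hy] using this

theorem opD'_opL_pow_of_ne {i j : Fin θ} (hij : i ≠ j) {y : W.Biproduct} (hy : opD' W i y = 0)
    (m : ℕ) : opD' W i ((opL W j ^ m) y) = 0 := by
  have := LinearMap.congr_fun (mul_pow_qComm (d := opD' W i) (T := opL W j) (c := (1 : K))
    (by simp [opD'_mul_opL, hij]) m) y
  simpa [hy] using this

theorem opP_opL_pow {i : Fin θ} {y : W.Biproduct} (hy : ∀ j ≤ i, opD W j y = 0) (m : ℕ) :
    opP s i ((opL W i ^ m) y) = (s.diag i / qFact (W.q i i) (W.r i - 1)) •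
      (opD W i ^ (W.r i - 1)) ((opL W i ^ m) y) := by
  rw [opP, Param.comb, LinearMap.add_apply, LinearMap.sum_apply, Finset.sum_eq_zero, zero_add,
    LinearMap.smul_apply]
  intro j hj
  rw [LinearMap.smul_apply, opD_opL_pow_of_ne (Finset.mem_Iio.mp hj).ne
    (hy j (Finset.mem_Iio.mp hj).le), smul_zero]

theorem opP'_opL_pow {i : Fin θ} {y : W.Biproduct} (hy : ∀ j ≤ i, opD' W j y = 0) (m : ℕ) :
    opP' s i ((opL W i ^ m) y) = (s.diag i / qFact (W.q i i) (W.r i - 1)) •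
      (opD' W i ^ (W.r i - 1)) ((opL W i ^ m) y) := by
  rw [opP', Param.comb, LinearMap.add_apply, LinearMap.sum_apply, Finset.sum_eq_zero, zero_add,
    LinearMap.smul_apply]
  intro j hj
  rw [LinearMap.smul_apply, opD'_opL_pow_of_ne (Finset.mem_Iio.mp hj).ne
    (hy j (Finset.mem_Iio.mp hj).le), smul_zero]

/-- Below the exponent `r_i` the corrections do not contribute to the powers of a deformed letter on
elements free of `x_j` for `j ≤ i`: in `opP` and `opQ` the derivative `d_i ^ (r_i - 1)` kills
`x_i ^ m y` for `m < r_i - 1`. -/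
theorem opY_pow_apply {i : Fin θ} {y : W.Biproduct} (hy : ∀ j ≤ i, opD W j y = 0)
    (hy' : ∀ j ≤ i, opD' W j y = 0) {m : ℕ} (hm : m < W.r i) :
    (opY s t i ^ m) y = (opL W i ^ m) y := by
  induction m with
  | zero => rfl
  | succ m ih =>
    have e : ∀ d : Module.End K W.Biproduct, d ((d ^ m) ((opL W i ^ m) y)) = 0 →
        (d ^ (W.r i - 1)) ((opL W i ^ m) y) = 0 := by
      intro d hd
      rw [show W.r i - 1 = (W.r i - 2 - m) + (m + 1) by omega, pow_add, pow_succ',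
        Module.End.mul_apply, Module.End.mul_apply, hd, map_zero]
    rw [pow_succ', Module.End.mul_apply, ih (by omega), opY, LinearMap.sub_apply,
      LinearMap.add_apply, opP_opL_pow s hy, e, smul_zero, opQ, Module.End.mul_apply,
      opP'_opL_pow t hy', e, smul_zero, map_zero, add_zero, sub_zero, pow_succ',
      Module.End.mul_apply]
    · rw [opD'_pow_opL_pow i (hy' i le_rfl), map_smul, opD'_opGr (hy' i le_rfl), smul_zero]
    · rw [opD_pow_opL_pow i (hy i le_rfl), map_smul, hy i le_rfl, smul_zero]

theorem opD_of (i : Fin θ) (h : Γ) : opD W i (of W 0 0 h) = 0 := by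
  have := LinearMap.congr_fun (opD_mul_opGr W i h) 1
  simpa [opGr_apply, opD_one] using this

theorem opD'_of (i : Fin θ) (h : Γ) : opD' W i (of W 0 0 h) = 0 := by
  have := LinearMap.congr_fun (opD'_mul_opGr W i h) 1
  simpa [opGr_apply, opD'_one] using this

/-- The ordered words in the deformed letters, applied to `h ∈ Γ`, give the ordered monomials of
`A`: the deformations live on the same vector space, with the ordered monomials as coordinates. -/
theorem word_opY_of {n : Fin θ → ℕ} (hn : ∀ i, n i < W.r i) (h : Γ) :
    word (opY s t) n (of W 0 0 h) = mon W 0 0 n * of W 0 0 h := by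
  have key : ∀ l : List (Fin θ), l.Pairwise (· < ·) →
      ((l.map fun k => opY s t k ^ n k).prod (of W 0 0 h) =
        (l.map fun k => x W 0 0 k ^ n k).prod * of W 0 0 h) ∧
      (∀ j ∉ l, opD W j ((l.map fun k => x W 0 0 k ^ n k).prod * of W 0 0 h) = 0) ∧
      ∀ j ∉ l, opD' W j ((l.map fun k => x W 0 0 k ^ n k).prod * of W 0 0 h) = 0 := by
    intro l
    induction l with
    | nil => simp [opD_of, opD'_of]
    | cons k l ih =>
      intro hl
      rw [List.pairwise_cons] at hl
      obtain ⟨h1, h2, h3⟩ := ih hl.2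
      have hnot : ∀ j ≤ k, j ∉ l := fun j hj hjl => (hl.1 j hjl).not_ge hj
      simp only [List.map_cons, List.prod_cons, List.mem_cons, not_or]
      rw [Module.End.mul_apply, h1, opY_pow_apply s t (fun j hj => h2 j (hnot j hj))
        (fun j hj => h3 j (hnot j hj)) (hn k), mul_assoc, ← opL_pow_apply]
      refine ⟨rfl, fun j hj => ?_, fun j hj => ?_⟩
      · exact opD_opL_pow_of_ne hj.1 (h2 j hj.2) _
      · exact opD'_opL_pow_of_ne hj.1 (h3 j hj.2) _
  exact (key _ (List.pairwise_lt_finRange θ)).1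

theorem word_opY_basis (p : Exps W × Γ) :
    (word (opY s t) (fun i => p.1 i) * opGr W p.2) 1 = basis W p := by
  rw [Module.End.mul_apply, opGr_apply, mul_one, word_opY_of s t fun i => (p.1 i).2, basis_apply]

theorem end_eq_zero_of_opY {T : Module.End K W.Biproduct} (h1 : T 1 = 0)
    (hX : ∀ i, ∃ c : K, T * opY s t i = c • (opY s t i * T))
    (hG : ∀ h, ∃ c : K, T * opGr W h = c • (opGr W h * T)) : T = 0 := by
  refine (basis W).ext fun p => ?_
  obtain ⟨c, hc⟩ := exists_mul_word (K := K) (opY s t) T hX (fun i => p.1 i)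
  obtain ⟨d, hd⟩ := hG p.2
  rw [← word_opY_basis s t, ← Module.End.mul_apply, ← mul_assoc, hc, smul_mul_assoc, mul_assoc, hd]
  simp [h1]

theorem opGr_pow_mul_opY (i j : Fin θ) (m : ℕ) :
    opGr W (W.g i ^ m) * opY s t j = W.q j i ^ m • (opY s t j * opGr W (W.g i ^ m)) := by
  rw [opGr_mul_opY, map_pow]
  simp [q]

end Biproduct

end QLS.QuantumLinearSpace

namespace QLS.QuantumLinearSpace

variable {K : Type*} [Field K] {Γ : Type*} [CommGroup Γ] {θ : ℕ} (W : QuantumLinearSpace K Γ θ)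

namespace Biproduct

open Lifting

variable {W} (s t : W.Param)

/-! ### The power relations of the deformed letters -/

/-- The commutator terms carry the `q`-integer `(r_i)_q` for a primitive `r_i`-th root of unity, and
so they vanish. -/
theorem opY_pow_opY {i j : Fin θ} (hij : i ≠ j) :
    opY s t i ^ W.r i * opY s t j = W.q j i ^ W.r i • (opY s t j * opY s t i ^ W.r i) := by
  have h2 := W.two_le i
  refine pow_mul_of_qInt_eq_zero (f := W.q i i * W.q i j) (by omega) (opY_mul_opY s t hij)
    ?_ (fun h => ?_) (fun h => ?_)
  · rw [opGr_mul_opY, map_mul, Units.val_mul]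
    rfl
  · rw [eq_inv_of_mul_eq_one_right (s.q_mul_q_off hij h i), qInt_inv_eq_zero]
  · rw [mul_comm (W.q i i), ← mul_assoc, q_mul_q hij.symm, one_mul, qInt_eq_zero]

/-- The operator `X_i ^ r_i - s_i + t_i g_i ^ r_i` commutes with the deformed generators up to
scalars and kills `1`, which generates `A` under them. -/
theorem opY_pow (i : Fin θ) :
    opY s t i ^ W.r i = s.diag i • 1 - t.diag i • opGr W (W.g i ^ W.r i) := by
  have h2 := W.two_le i
  refine sub_eq_zero.mp (end_eq_zero_of_opY s t ?_ (fun k => ?_) (fun h => ?_))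
  · have hd : ∀ j ≤ i, opD W j (1 : W.Biproduct) = 0 := fun j _ => opD_one W j
    have hd' : ∀ j ≤ i, opD' W j (1 : W.Biproduct) = 0 := fun j _ => opD'_one W j
    have hf := W.qFact_ne_zero i (m := W.r i - 1) (by omega)
    have e1 : (opY s t i ^ W.r i) 1 = opY s t i ((opL W i ^ (W.r i - 1)) 1) := by
      rw [← opY_pow_apply s t hd hd' (by omega), ← Module.End.mul_apply, ← pow_succ',
        Nat.sub_add_cancel (by omega)]
    have e2 : opL W i ((opL W i ^ (W.r i - 1)) 1) = 0 := by
      rw [← Module.End.mul_apply, ← pow_succ', Nat.sub_add_cancel (by omega), opL_pow,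
        LinearMap.zero_apply]
    rw [LinearMap.sub_apply, e1, opY, LinearMap.sub_apply, LinearMap.add_apply, e2,
      opP_opL_pow s hd, opD_pow_opL_pow i (hd i le_rfl), opQ, Module.End.mul_apply,
      opP'_opL_pow t hd', opD'_pow_opL_pow i (hd' i le_rfl), smul_smul, smul_smul,
      div_mul_cancel₀ _ hf, div_mul_cancel₀ _ hf, map_smul, ← Module.End.mul_apply, opGr_mul_opGr,
      ← pow_succ', Nat.sub_add_cancel (by omega)]
    simp
  · rcases eq_or_ne i k with rfl | hk
    · refine ⟨1, ?_⟩
      rw [sub_mul, sub_mul, smul_mul_assoc, smul_mul_assoc, opGr_pow_mul_opY,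
        (W.q_root i).pow_eq_one, ← pow_succ, pow_succ']
      simp [mul_sub]
    · refine ⟨W.q k i ^ W.r i, ?_⟩
      have e1 : s.diag i • (1 * opY s t k) = W.q k i ^ W.r i • s.diag i • (opY s t k * 1) := by
        by_cases h0 : s.diag i = 0
        · simp [h0]
        · rw [s.q_pow' hk h0, one_smul, one_mul, mul_one]
      rw [sub_mul, sub_mul, smul_mul_assoc, smul_mul_assoc, opGr_pow_mul_opY, opY_pow_opY s t hk,
        e1, mul_sub, mul_sub, mul_smul_comm, mul_smul_comm]
      module
  · have e : opY s t i * opGr W h = (W.χ i h : K)⁻¹ • (opGr W h * opY s t i) := by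
      rw [opGr_mul_opY, smul_smul, inv_mul_cancel₀ (Units.ne_zero _), one_smul]
    refine ⟨(W.χ i h : K)⁻¹ ^ W.r i, ?_⟩
    have e1 : ∀ u : W.Param, ∀ T : Module.End K W.Biproduct,
        u.diag i • T = (W.χ i h : K)⁻¹ ^ W.r i • u.diag i • T := by
      intro u T
      by_cases h0 : u.diag i = 0
      · simp [h0]
      · rw [inv_pow, u.char_pow h0, inv_one, one_smul]
    rw [sub_mul, sub_mul, smul_mul_assoc, smul_mul_assoc, opGr_mul_opGr,
      pow_mul_qComm (c := (W.χ i h : K)⁻¹) e, e1 s, e1 t, mul_sub, mul_sub,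
      mul_smul_comm, mul_smul_comm, opGr_mul_opGr, mul_comm h,
      one_mul, mul_one]
    module

end Biproduct

end QLS.QuantumLinearSpace

namespace QLS.QuantumLinearSpace

variable {K : Type*} [Field K] {Γ : Type*} [CommGroup Γ] {θ : ℕ} (W : QuantumLinearSpace K Γ θ)

theorem map_word {S S' F : Type*} [Monoid S] [Monoid S'] [FunLike F S S'] [MonoidHomClass F S S']
    (f : F) (X : Fin θ → S) (n : Fin θ → ℕ) : f (word X n) = word (fun i => f (X i)) n := by
  simp [word, map_list_prod, Function.comp_def]

namespace Param

variable {W} (s : W.Param)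

theorem map_comb_eq {S S' V : Type*} [Ring S] [Algebra K S] [Ring S'] [Algebra K S']
    [AddCommGroup V] [Module K V] {d : Fin θ → S} {d' : Fin θ → S'} (F : S →ₗ[K] V)
    (F' : S' →ₗ[K] V) (h : ∀ k n, F (d k ^ n) = F' (d' k ^ n)) (i : Fin θ) :
    F (s.comb d i) = F' (s.comb d' i) := by
  have h1 : ∀ k, F (d k) = F' (d' k) := fun k => by simpa using h k 1
  simp only [comb, map_add, map_sum, map_smul, h, h1]

end Param

namespace Biproduct

open Lifting

variable {W} (s t u : W.Param)

/-! ### The two-sided deformations of the multiplication -/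

theorem straightens_opY : W.Straightens (opGr W) (opY s t) where
  one := opGr_one W
  mul := opGr_mul_opGr W
  comm := opGr_mul_opY s t
  pow i := by
    rw [opY_pow, ← opGr_one W]
    exact Submodule.sub_mem _ (Submodule.smul_mem _ _ (Submodule.subset_span ⟨_, rfl⟩))
      (Submodule.smul_mem _ _ (Submodule.subset_span ⟨_, rfl⟩))
  skew i j h := by
    refine ⟨W.q j i, ?_⟩
    have e : opY s t i * opY s t j - W.q j i • (opY s t j * opY s t i) =
        s.off i j • opGr W 1 - t.off i j • opGr W (W.g i * W.g j) := by
      rw [opY_mul_opY s t h, opGr_one]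
      abel
    rw [e]
    exact Submodule.sub_mem _ (Submodule.smul_mem _ _ (Submodule.subset_span ⟨_, rfl⟩))
      (Submodule.smul_mem _ _ (Submodule.subset_span ⟨_, rfl⟩))

/-- The action on `A` of the free algebra on `Γ` and `x_1, …, x_θ` through deformed left
multiplications. -/
def act : FreeAlgebra K (Γ ⊕ Fin θ) →ₐ[K] Module.End K W.Biproduct :=
  FreeAlgebra.lift K (Sum.elim (opGr W) (opY s t))

theorem act_inl (h : Γ) : act s t (FreeAlgebra.ι K (Sum.inl h)) = opGr W h := by simp [act]

theorem act_inr (i : Fin θ) : act s t (FreeAlgebra.ι K (Sum.inr i)) = opY s t i := by simp [act]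

/-- The deformed left multiplication by an element of `A`: the ordered monomials act through the
corresponding words in the deformed generators. -/
def leftMul : W.Biproduct →ₗ[K] Module.End K W.Biproduct :=
  (basis W).constr K fun p => word (opY s t) (fun i => p.1 i) * opGr W p.2

theorem leftMul_basis (p : Exps W × Γ) :
    leftMul s t (basis W p) = word (opY s t) (fun i => p.1 i) * opGr W p.2 := by
  rw [leftMul, Module.Basis.constr_basis]

theorem leftMul_apply_one (y : W.Biproduct) : leftMul s t y 1 = y := by
  have : (LinearMap.applyₗ (1 : W.Biproduct)) ∘ₗ leftMul s t = LinearMap.id :=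
    (basis W).ext fun p => by
      rw [LinearMap.comp_apply, leftMul_basis]
      exact word_opY_basis s t p
  exact LinearMap.congr_fun this y

/-- Straightening shows that an operator from the free algebra is determined by its value at `1`. -/
theorem leftMul_act (c : FreeAlgebra K (Γ ⊕ Fin θ)) : leftMul s t (act s t c 1) = act s t c := by
  have hle : Submodule.span K (Set.range fun p : Exps W × Γ =>
      word (opY s t) (fun i => p.1 i) * opGr W p.2) ≤ LinearMap.range (leftMul s t) := by
    refine Submodule.span_le.mpr ?_
    rintro _ ⟨p, rfl⟩
    exact ⟨basis W p, leftMul_basis s t p⟩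
  obtain ⟨z, hz⟩ := hle ((straightens_opY s t).lift_mem_span c)
  change leftMul s t z = act s t c at hz
  rw [← hz, leftMul_apply_one]

theorem exists_act (y : W.Biproduct) : ∃ c, act s t c 1 = y := by
  have h : LinearMap.range (LinearMap.applyₗ (1 : W.Biproduct) ∘ₗ (act s t).toLinearMap) = ⊤ := by
    rw [eq_top_iff, ← (basis W).span_eq, Submodule.span_le]
    rintro _ ⟨p, rfl⟩
    refine ⟨word (fun i => FreeAlgebra.ι K (Sum.inr i)) (fun i => p.1 i) *
      FreeAlgebra.ι K (Sum.inl p.2), ?_⟩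
    rw [LinearMap.comp_apply, AlgHom.toLinearMap_apply, map_mul, map_word, act_inl]
    simp only [act_inr]
    exact word_opY_basis s t p
  have hy : y ∈ LinearMap.range (LinearMap.applyₗ (1 : W.Biproduct) ∘ₗ (act s t).toLinearMap) :=
    h ▸ Submodule.mem_top
  exact hy

/-- The deformed multiplication of `A`. For `s = t = 0` it is the multiplication of `A`, for
`s = t` that of the lifting with parameter `s`, and for `t = 0` that of the algebra with the
relations `x_i ^ r_i = s_i` and `x_i x_j = χ_j(g_i) x_j x_i + s_ij`, a bi-Galois object for
the lifting and `A`. -/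
def defMul : W.Biproduct ⊗[K] W.Biproduct →ₗ[K] W.Biproduct := TensorProduct.lift (leftMul s t)

theorem defMul_tmul (x y : W.Biproduct) : defMul s t (x ⊗ₜ y) = leftMul s t x y :=
  TensorProduct.lift.tmul _ _

theorem defMul_act_tmul (c : FreeAlgebra K (Γ ⊕ Fin θ)) (y : W.Biproduct) :
    defMul s t (act s t c 1 ⊗ₜ y) = act s t c y := by
  rw [defMul_tmul, leftMul_act]

theorem defMul_one_tmul (y : W.Biproduct) : defMul s t (1 ⊗ₜ y) = y := by
  simpa using defMul_act_tmul s t 1 y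

theorem defMul_tmul_one (y : W.Biproduct) : defMul s t (y ⊗ₜ 1) = y := by
  rw [defMul_tmul, leftMul_apply_one]

theorem defMul_assoc (x y z : W.Biproduct) :
    defMul s t (defMul s t (x ⊗ₜ y) ⊗ₜ z) = defMul s t (x ⊗ₜ defMul s t (y ⊗ₜ z)) := by
  obtain ⟨c, rfl⟩ := exists_act s t x
  obtain ⟨d, rfl⟩ := exists_act s t y
  have := defMul_act_tmul s t (c * d) z
  rw [map_mul, Module.End.mul_apply, Module.End.mul_apply] at this
  rw [defMul_act_tmul, defMul_act_tmul, defMul_act_tmul, this]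

theorem defMul_of_mul_tmul (h : Γ) (x y : W.Biproduct) :
    defMul s t ((of W 0 0 h * x) ⊗ₜ y) = of W 0 0 h * defMul s t (x ⊗ₜ y) := by
  obtain ⟨c, rfl⟩ := exists_act s t x
  have := defMul_act_tmul s t (FreeAlgebra.ι K (Sum.inl h) * c) y
  rw [map_mul, Module.End.mul_apply, Module.End.mul_apply, act_inl] at this
  rw [defMul_act_tmul]
  exact this

theorem opR_mul_act (h : Γ) (c : FreeAlgebra K (Γ ⊕ Fin θ)) :
    opR W h * act s t c = act s t c * opR W h := by
  induction c using FreeAlgebra.induction with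
  | grade0 c => rw [AlgHom.commutes, Algebra.commutes]
  | grade1 v =>
    cases v with
    | inl k => rw [act_inl, opR_mul_opGr]
    | inr i => rw [act_inr, opR_mul_opY]
  | mul f g hf hg => rw [map_mul, ← mul_assoc, hf, mul_assoc, hg, mul_assoc]
  | add f g hf hg => rw [map_add, mul_add, add_mul, hf, hg]

theorem defMul_tmul_mul_of (h : Γ) (x y : W.Biproduct) :
    defMul s t (x ⊗ₜ (y * of W 0 0 h)) = defMul s t (x ⊗ₜ y) * of W 0 0 h := by
  obtain ⟨c, rfl⟩ := exists_act s t x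
  rw [defMul_act_tmul, defMul_act_tmul]
  exact (LinearMap.congr_fun (opR_mul_act s t h c) y).symm

/-! ### Compatibility with the comultiplication -/

/-- Evaluation of `T ⊗ id` at `v`, as a linear function of `T`. -/
def rTensorEval (v : W.Biproduct ⊗[K] W.Biproduct) :
    Module.End K W.Biproduct →ₗ[K] W.Biproduct ⊗[K] W.Biproduct where
  toFun T := T.rTensor _ v
  map_add' a b := by rw [LinearMap.rTensor_add, LinearMap.add_apply]
  map_smul' c a := by rw [LinearMap.rTensor_smul, LinearMap.smul_apply, RingHom.id_apply]

/-- Evaluation of `id ⊗ T` at `v`, as a linear function of `T`. -/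
def lTensorEval (v : W.Biproduct ⊗[K] W.Biproduct) :
    Module.End K W.Biproduct →ₗ[K] W.Biproduct ⊗[K] W.Biproduct where
  toFun T := T.lTensor _ v
  map_add' a b := by rw [LinearMap.lTensor_add, LinearMap.add_apply]
  map_smul' c a := by rw [LinearMap.lTensor_smul, LinearMap.smul_apply, RingHom.id_apply]

theorem comul_opP (i : Fin θ) (y : W.Biproduct) :
    Coalgebra.comul (R := K) (opP s i y) = (opP s i).rTensor _ (Coalgebra.comul y) := by
  refine s.map_comb_eq (Coalgebra.comul ∘ₗ LinearMap.applyₗ y)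
    (rTensorEval (Coalgebra.comul y)) (fun k n => ?_) i
  change Coalgebra.comul ((opD W k ^ n) y) = (opD W k ^ n).rTensor _ (Coalgebra.comul y)
  induction n generalizing y with
  | zero => simp [Module.End.one_eq_id]
  | succ n ih =>
    rw [pow_succ, Module.End.mul_apply, ih, comul_opD, LinearMap.rTensor_mul,
      Module.End.mul_apply]

theorem comul_opP' (i : Fin θ) (y : W.Biproduct) :
    Coalgebra.comul (R := K) (opP' s i y) = (opP' s i).lTensor _ (Coalgebra.comul y) := by
  refine s.map_comb_eq (Coalgebra.comul ∘ₗ LinearMap.applyₗ y)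
    (lTensorEval (Coalgebra.comul y)) (fun k n => ?_) i
  change Coalgebra.comul ((opD' W k ^ n) y) = (opD' W k ^ n).lTensor _ (Coalgebra.comul y)
  induction n generalizing y with
  | zero => simp [Module.End.one_eq_id]
  | succ n ih =>
    rw [pow_succ, Module.End.mul_apply, ih, comul_opD', LinearMap.lTensor_mul,
      Module.End.mul_apply]

theorem rTensor_opP'_comul (i : Fin θ) (y : W.Biproduct) :
    (opP' s i).rTensor _ (Coalgebra.comul (R := K) y) =
      (opP s i).lTensor _ (Coalgebra.comul (R := K) y) := by
  refine s.map_comb_eq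
    (rTensorEval (Coalgebra.comul y))
    (lTensorEval (Coalgebra.comul y)) (fun k n => ?_) i
  change (opD' W k ^ n).rTensor _ (Coalgebra.comul y) = (opD W k ^ n).lTensor _ (Coalgebra.comul y)
  induction n with
  | zero => simp [Module.End.one_eq_id]
  | succ n ih =>
    have hc := (LinearMap.rTensor_comp_lTensor (f := opD' W k) (g := opD W k ^ n)).trans
      (LinearMap.lTensor_comp_rTensor (f := opD' W k) (g := opD W k ^ n)).symm
    rw [pow_succ', LinearMap.rTensor_mul, Module.End.mul_apply, ih, pow_succ,
      LinearMap.lTensor_mul, Module.End.mul_apply, ← rTensor_opD'_comul]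
    exact LinearMap.congr_fun hc _

theorem comul_opGr (h : Γ) (y : W.Biproduct) : Coalgebra.comul (R := K) (opGr W h y) =
    TensorProduct.map (opGr W h) (opGr W h) (Coalgebra.comul y) := by
  rw [opGr_apply, Bialgebra.comul_mul, comul_of]
  generalize Coalgebra.comul (R := K) y = v
  induction v with
  | zero => simp
  | add a b ha hb => rw [mul_add, map_add, ha, hb]
  | tmul a b => simp [opGr_apply]

theorem comul_opL (i : Fin θ) (y : W.Biproduct) : Coalgebra.comul (R := K) (opL W i y) =
    (opL W i).rTensor _ (Coalgebra.comul y) +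
      TensorProduct.map (opGr W (W.g i)) (opL W i) (Coalgebra.comul y) := by
  rw [opL_apply, Bialgebra.comul_mul, comul_x]
  generalize Coalgebra.comul (R := K) y = v
  induction v with
  | zero => simp
  | add a b ha hb => simp only [mul_add, map_add, ha, hb]; abel
  | tmul a b => simp [opGr_apply, opL_apply, add_mul]

/-- In the comultiplication of a deformed letter the middle parameter cancels. -/
theorem comul_opY (i : Fin θ) (y : W.Biproduct) : Coalgebra.comul (R := K) (opY s u i y) =
    (opY s t i).rTensor _ (Coalgebra.comul y) +
      TensorProduct.map (opGr W (W.g i)) (opY t u i) (Coalgebra.comul y) := by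
  have e1 : ∀ v : W.Biproduct ⊗[K] W.Biproduct,
      (opY s t i).rTensor W.Biproduct v = (opL W i).rTensor _ v + (opP s i).rTensor _ v -
        TensorProduct.map (opGr W (W.g i)) 1 ((opP' t i).rTensor _ v) := by
    intro v
    induction v with
    | zero => simp
    | add a b ha hb => simp only [map_add, ha, hb]; abel
    | tmul a b => simp [opY, opQ]
  have e2 : ∀ v : W.Biproduct ⊗[K] W.Biproduct,
      TensorProduct.map (opGr W (W.g i)) (opY t u i) v =
        TensorProduct.map (opGr W (W.g i)) (opL W i) v +
          TensorProduct.map (opGr W (W.g i)) 1 ((opP t i).lTensor _ v) -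
          TensorProduct.map (opGr W (W.g i)) (opGr W (W.g i)) ((opP' u i).lTensor _ v) := by
    intro v
    induction v with
    | zero => simp
    | add a b ha hb => simp only [map_add, ha, hb]; abel
    | tmul a b => simp [opY, opQ, tmul_add, tmul_sub]
  rw [e1, e2, rTensor_opP'_comul, opY, LinearMap.sub_apply, LinearMap.add_apply, map_sub, map_add,
    comul_opL, comul_opP, opQ, Module.End.mul_apply, comul_opGr, comul_opP']
  abel

/-- The comultiplication of the free algebra with `h` grouplike and `x_i ↦ x_i ⊗ 1 + g_i ⊗ x_i`. -/
def freeComul (W : QuantumLinearSpace K Γ θ) : FreeAlgebra K (Γ ⊕ Fin θ) →ₐ[K]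
    FreeAlgebra K (Γ ⊕ Fin θ) ⊗[K] FreeAlgebra K (Γ ⊕ Fin θ) :=
  FreeAlgebra.lift K (Sum.elim
    (fun h => FreeAlgebra.ι K (Sum.inl h) ⊗ₜ FreeAlgebra.ι K (Sum.inl h))
    fun i => FreeAlgebra.ι K (Sum.inr i) ⊗ₜ 1 +
      FreeAlgebra.ι K (Sum.inl (W.g i)) ⊗ₜ FreeAlgebra.ι K (Sum.inr i))

/-- The action of `c ⊗ d` on `A ⊗ A`, with parameters `(s, t)` on the left and `(t, u)` on the
right. -/
def act₂ : FreeAlgebra K (Γ ⊕ Fin θ) ⊗[K] FreeAlgebra K (Γ ⊕ Fin θ) →ₐ[K]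
    Module.End K (W.Biproduct ⊗[K] W.Biproduct) :=
  Module.endTensorEndAlgHom.comp (Algebra.TensorProduct.map (act s t) (act t u))

theorem act₂_tmul (c d : FreeAlgebra K (Γ ⊕ Fin θ)) :
    act₂ s t u (c ⊗ₜ d) = TensorProduct.map (act s t c) (act t u d) := by
  simp [act₂, Module.endTensorEndAlgHom_apply, AlgebraTensorModule.map_eq]

theorem comul_act (c : FreeAlgebra K (Γ ⊕ Fin θ)) (y : W.Biproduct) :
    Coalgebra.comul (R := K) (act s u c y) = act₂ s t u (freeComul W c) (Coalgebra.comul y) := by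
  induction c using FreeAlgebra.induction generalizing y with
  | grade0 c =>
    rw [AlgHom.commutes, AlgHom.commutes, AlgHom.commutes]
    simp [Module.algebraMap_end_apply]
  | grade1 v =>
    cases v with
    | inl k =>
      simp [act_inl, freeComul, act₂_tmul, comul_opGr]
    | inr i =>
      simp only [act_inr, freeComul, FreeAlgebra.lift_ι_apply, Sum.elim_inr, map_add, act₂_tmul,
        act_inl, map_one, LinearMap.add_apply]
      exact comul_opY s t u i y
  | mul f g hf hg =>
    rw [map_mul, map_mul, map_mul, Module.End.mul_apply, Module.End.mul_apply, hf, hg]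
  | add f g hf hg => simp only [map_add, LinearMap.add_apply, hf, hg]

/-- The action of `w` on `v` is the product of `w (1 ⊗ 1)` and `v` for the tensor product of the two
deformed multiplications. -/
theorem act₂_apply (w : FreeAlgebra K (Γ ⊕ Fin θ) ⊗[K] FreeAlgebra K (Γ ⊕ Fin θ))
    (v : W.Biproduct ⊗[K] W.Biproduct) :
    act₂ s t u w v = TensorProduct.map (defMul s t) (defMul t u)
      (TensorProduct.tensorTensorTensorComm K _ _ _ _ (act₂ s t u w (1 ⊗ₜ 1) ⊗ₜ v)) := by
  induction w with
  | zero => simp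
  | add a b ha hb => simp only [map_add, LinearMap.add_apply, add_tmul, ha, hb]
  | tmul c d =>
    induction v with
    | zero => simp
    | add a b ha hb => simp only [map_add, tmul_add, ha, hb]
    | tmul a b => simp [act₂_tmul, defMul_act_tmul]

/-- The deformed multiplications form a cogroupoid on the coalgebra `A`:
`Δ m_{su} = (m_{st} ⊗ m_{tu}) Δ` for all parameters `s, t, u`. -/
theorem comul_defMul (z : W.Biproduct ⊗[K] W.Biproduct) :
    Coalgebra.comul (R := K) (defMul s u z) =
      TensorProduct.map (defMul s t) (defMul t u) (Coalgebra.comul (R := K) z) := by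
  induction z with
  | zero => simp
  | add a b ha hb => simp only [map_add, ha, hb]
  | tmul x y =>
    obtain ⟨c, rfl⟩ := exists_act s u x
    rw [defMul_act_tmul, comul_act s t u, act₂_apply, TensorProduct.comul_tmul, comul_act s t u]
    simp [Algebra.TensorProduct.one_def, AlgebraTensorModule.tensorTensorTensorComm_eq]

end Biproduct

end QLS.QuantumLinearSpace

namespace QLS

/-- The convolution product of pullbacks along maps `m₁`, `m₂` with `Δ m = (m₁ ⊗ m₂) Δ`. -/
theorem conv_comp_of_comul {K C D S : Type*} [Field K] [AddCommGroup C] [Module K C]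
    [Coalgebra K C] [AddCommGroup D] [Module K D] [Coalgebra K D] [Ring S] [Algebra K S]
    {m m₁ m₂ : C →ₗ[K] D}
    (h : ∀ z, Coalgebra.comul (R := K) (m z) = TensorProduct.map m₁ m₂ (Coalgebra.comul (R := K) z))
    (f g : D →ₗ[K] S) :
    toConv (f ∘ₗ m₁) * toConv (g ∘ₗ m₂) = toConv ((toConv f * toConv g).ofConv ∘ₗ m) := by
  ext z
  rw [LinearMap.convMul_apply, LinearMap.comp_apply, LinearMap.convMul_apply, h, ofConv_toConv,
    ofConv_toConv, TensorProduct.map_comp, LinearMap.comp_apply]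

namespace QuantumLinearSpace

variable {K : Type*} [Field K] {Γ : Type*} [CommGroup Γ] {θ : ℕ} (W : QuantumLinearSpace K Γ θ)

instance : Zero W.Param :=
  ⟨{ diag := 0
     off := 0
     diag_ne := fun _ h => absurd rfl h
     off_ne := fun _ _ _ h => absurd rfl h
     off_swap := by simp }⟩

namespace Biproduct

open Lifting

variable {W} (s t u : W.Param)

/-! ### The cocycles of the cogroupoid -/

/-- The linear form `ε ∘ m_{st}` on `A ⊗ A`. -/
def defCochain : Cochain K W.Biproduct := toConv (Coalgebra.counit ∘ₗ defMul s t)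

theorem defCochain_apply (z : W.Biproduct ⊗[K] W.Biproduct) :
    defCochain s t z = Coalgebra.counit (R := K) (defMul s t z) := rfl

theorem toConv_counit_mul {S : Type*} [Ring S] [Algebra K S] (f : W.Biproduct →ₗ[K] S) :
    toConv (Algebra.linearMap K S ∘ₗ (Coalgebra.counit : W.Biproduct →ₗ[K] K)) * toConv f =
      toConv f := one_mul (toConv f)

theorem mul_toConv_counit {S : Type*} [Ring S] [Algebra K S] (f : W.Biproduct →ₗ[K] S) :
    toConv f * toConv (Algebra.linearMap K S ∘ₗ (Coalgebra.counit : W.Biproduct →ₗ[K] K)) =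
      toConv f := mul_one (toConv f)

/-- The form `ε m_{st}` intertwines the deformations with left parameters `t` and `s`; it is the
counit applied to the first factor of `Δ m_{su} = (m_{st} ⊗ m_{tu}) Δ`. -/
theorem defCochain_mul_comp (f : W.Biproduct →ₗ[K] K) :
    defCochain s t * toConv (f ∘ₗ defMul t u) = toConv (f ∘ₗ defMul s u) := by
  rw [defCochain, conv_comp_of_comul (comul_defMul s t u)]
  congr 2
  exact congrArg ofConv (toConv_counit_mul f)

theorem defCochain_mul : defCochain s t * defCochain t u = defCochain s u :=
  defCochain_mul_comp s t u Coalgebra.counit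

theorem linearMap_defCochain_mul :
    toConv (Algebra.linearMap K W.Biproduct ∘ₗ (defCochain s t).ofConv) * toConv (defMul t u) =
      toConv (defMul s u) := by
  have h := conv_comp_of_comul (comul_defMul s t u)
    (Algebra.linearMap K W.Biproduct ∘ₗ Coalgebra.counit) LinearMap.id
  rw [toConv_counit_mul] at h
  exact h

theorem mul_linearMap_defCochain :
    toConv (defMul s t) * toConv (Algebra.linearMap K W.Biproduct ∘ₗ (defCochain t u).ofConv) =
      toConv (defMul s u) := by
  have h := conv_comp_of_comul (comul_defMul s t u) LinearMap.id
    (Algebra.linearMap K W.Biproduct ∘ₗ Coalgebra.counit)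
  rw [mul_toConv_counit] at h
  exact h

/-- The counit of `T y`, as a linear function of `T`. -/
def counitEval (y : W.Biproduct) : Module.End K W.Biproduct →ₗ[K] K where
  toFun T := Coalgebra.counit (R := K) (T y)
  map_add' a b := by rw [LinearMap.add_apply, map_add]
  map_smul' c a := by rw [LinearMap.smul_apply, map_smul, RingHom.id_apply]

theorem counit_opP' (i : Fin θ) (y : W.Biproduct) :
    Coalgebra.counit (R := K) (opP' s i y) = Coalgebra.counit (R := K) (opP s i y) := by
  refine s.map_comb_eq (counitEval y) (counitEval y) (fun k n => ?_) i
  change Coalgebra.counit ((opD' W k ^ n) y) = Coalgebra.counit ((opD W k ^ n) y)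
  induction n generalizing y with
  | zero => simp
  | succ n ih =>
    have hc : opD W k ^ n * opD' W k = opD' W k * opD W k ^ n :=
      (show Commute (opD W k) (opD' W k) from opD_mul_opD' W k k).pow_left n
    rw [pow_succ, Module.End.mul_apply, ih, ← Module.End.mul_apply, hc, Module.End.mul_apply,
      counit_opD', ← counit_opD, ← Module.End.mul_apply, ← pow_succ']

theorem counit_opGr (h : Γ) (y : W.Biproduct) :
    Coalgebra.counit (R := K) (opGr W h y) = Coalgebra.counit (R := K) y := counit_of_mul W h y

theorem counit_opY (i : Fin θ) (y : W.Biproduct) : Coalgebra.counit (R := K) (opY s t i y) =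
    Coalgebra.counit (R := K) (opP s i y) - Coalgebra.counit (R := K) (opP t i y) := by
  rw [opY, LinearMap.sub_apply, LinearMap.add_apply, map_sub, map_add, opL_apply, counit_x_mul,
    zero_add, opQ, Module.End.mul_apply, counit_opGr, counit_opP']

/-- The counit of the free algebra. -/
def freeCounit : FreeAlgebra K (Γ ⊕ Fin θ) →ₐ[K] K :=
  FreeAlgebra.lift K (Sum.elim (fun _ => 1) fun _ => 0)

/-- For `s = t` the corrections of a deformed letter cancel under the counit. -/
theorem counit_act (c : FreeAlgebra K (Γ ⊕ Fin θ)) (y : W.Biproduct) :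
    Coalgebra.counit (R := K) (act s s c y) = freeCounit c * Coalgebra.counit (R := K) y := by
  induction c using FreeAlgebra.induction generalizing y with
  | grade0 c =>
    rw [AlgHom.commutes, AlgHom.commutes, Module.algebraMap_end_apply, map_smul]
    rfl
  | grade1 v =>
    cases v with
    | inl k => simp [act_inl, counit_opGr, freeCounit]
    | inr i => simp [act_inr, counit_opY, freeCounit]
  | mul f g hf hg => rw [map_mul, map_mul, Module.End.mul_apply, hf, hg, mul_assoc]
  | add f g hf hg => rw [map_add, map_add, LinearMap.add_apply, map_add, hf, hg, add_mul]

theorem defCochain_self : defCochain s s = 1 := by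
  ext x y
  obtain ⟨c, rfl⟩ := exists_act s s x
  have h : (1 : Cochain K W.Biproduct) (act s s c 1 ⊗ₜ y) =
      Coalgebra.counit (R := K) y * Coalgebra.counit (R := K) (act s s c 1) := by simp
  refine Eq.trans ?_ h.symm
  refine (defCochain_apply s s _).trans ?_
  rw [TensorProduct.mk_apply, defMul_act_tmul, counit_act, counit_act, Bialgebra.counit_one,
    mul_one, mul_comm]

theorem isUnit_defCochain : IsUnit (defCochain s t) :=
  ⟨⟨_, _, (defCochain_mul s t s).trans (defCochain_self s),
    (defCochain_mul t s t).trans (defCochain_self t)⟩, rfl⟩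

theorem inverse_defCochain : Ring.inverse (defCochain s t) = defCochain t s :=
  Ring.inverse_unit ⟨defCochain s t, defCochain t s,
    (defCochain_mul s t s).trans (defCochain_self s),
    (defCochain_mul t s t).trans (defCochain_self t)⟩

theorem opY_zero (i : Fin θ) : opY (0 : W.Param) 0 i = opL W i := by
  have h : ∀ d : Fin θ → Module.End K W.Biproduct, (0 : W.Param).comb d i = 0 := fun d => by
    have h1 : ∀ j, (0 : W.Param).off i j = 0 := fun _ => rfl
    have h2 : (0 : W.Param).diag i = 0 := rfl
    simp [Param.comb, h1, h2]
  rw [opY, opQ, opP, opP', h, h, mul_zero, add_zero, sub_zero]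

theorem defMul_zero : defMul (0 : W.Param) 0 = LinearMap.mul' K W.Biproduct := by
  have key : ∀ (c : FreeAlgebra K (Γ ⊕ Fin θ)) (y : W.Biproduct),
      act (0 : W.Param) 0 c y = act (0 : W.Param) 0 c 1 * y := by
    intro c
    induction c using FreeAlgebra.induction with
    | grade0 c => simp [Module.algebraMap_end_apply]
    | grade1 v =>
      cases v with
      | inl k => simp [act_inl, opGr_apply]
      | inr i => simp [act_inr, opY_zero, opL_apply]
    | mul f g hf hg =>
      intro y
      rw [map_mul, Module.End.mul_apply, Module.End.mul_apply, hf, hf (act 0 0 g 1), hg y,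
        mul_assoc]
    | add f g hf hg =>
      intro y
      rw [map_add, LinearMap.add_apply, LinearMap.add_apply, hf, hg, add_mul]
  ext x y
  obtain ⟨c, rfl⟩ := exists_act (0 : W.Param) 0 x
  exact (defMul_act_tmul 0 0 c y).trans (key c y)

theorem defCochain_bilinear {h h' : W.Biproduct} (hh : h ∈ groupAlgebra W)
    (hh' : h' ∈ groupAlgebra W) (x y : W.Biproduct) : defCochain s t ((h * x) ⊗ₜ (y * h')) =
      Coalgebra.counit (R := K) h * Coalgebra.counit (R := K) h' * defCochain s t (x ⊗ₜ y) := by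
  have h1 : ∀ x y : W.Biproduct, defCochain s t ((h * x) ⊗ₜ y) =
      Coalgebra.counit (R := K) h * defCochain s t (x ⊗ₜ y) := by
    induction hh using Algebra.adjoin_induction with
    | mem a ha =>
      obtain ⟨k, rfl⟩ := ha
      intro x y
      rw [defCochain_apply, defCochain_apply, defMul_of_mul_tmul, counit_of_mul, counit_of, one_mul]
    | algebraMap c =>
      intro x y
      rw [← Algebra.smul_def, ← smul_tmul', Bialgebra.counit_algebraMap, defCochain_apply,
        defCochain_apply, map_smul, map_smul, smul_eq_mul]
    | add a b _ _ ha hb =>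
      intro x y
      rw [add_mul, add_tmul, map_add, map_add, ha, hb, add_mul]
    | mul a b _ _ ha hb =>
      intro x y
      rw [mul_assoc, ha, hb, Bialgebra.counit_mul, mul_assoc]
  have h2 : ∀ x y : W.Biproduct, defCochain s t (x ⊗ₜ (y * h')) =
      Coalgebra.counit (R := K) h' * defCochain s t (x ⊗ₜ y) := by
    induction hh' using Algebra.adjoin_induction with
    | mem a ha =>
      obtain ⟨k, rfl⟩ := ha
      intro x y
      rw [defCochain_apply, defCochain_apply, defMul_tmul_mul_of, Bialgebra.counit_mul, counit_of,
        one_mul, mul_one]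
    | algebraMap c =>
      intro x y
      rw [← Algebra.commutes, ← Algebra.smul_def, tmul_smul, Bialgebra.counit_algebraMap,
        defCochain_apply, defCochain_apply, map_smul, map_smul, smul_eq_mul]
    | add a b _ _ ha hb =>
      intro x y
      rw [mul_add, tmul_add, map_add, map_add, ha, hb, add_mul]
    | mul a b _ _ ha hb =>
      intro x y
      rw [← mul_assoc, hb, ha, Bialgebra.counit_mul, ← mul_assoc,
        mul_comm (Coalgebra.counit (R := K) b)]
  rw [h1, h2, mul_assoc]

/-- The deformations with `t = 0` are given by two-cocycles of `A`; the cocycle identity expresses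
the associativity of the deformed multiplication. -/
theorem isCocycle_defCochain : IsCocycle (groupAlgebra W) (defCochain s 0) where
  isUnit := isUnit_defCochain s 0
  cocycle x y z := by
    have e : ∀ f : W.Biproduct →ₗ[K] K,
        defCochain s 0 * toConv (f ∘ₗ LinearMap.mul' K W.Biproduct) =
          toConv (f ∘ₗ defMul s 0) := fun f => by
      rw [← defMul_zero]
      exact defCochain_mul_comp s 0 0 f
    rw [← LinearMap.comp_assoc, ← LinearMap.comp_assoc, e, e]
    change Coalgebra.counit (R := K) (defMul s 0 (x ⊗ₜ defMul s 0 (y ⊗ₜ z))) =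
      Coalgebra.counit (R := K) (defMul s 0 (defMul s 0 (x ⊗ₜ y) ⊗ₜ z))
    rw [defMul_assoc]
  apply_one x := by rw [defCochain_apply, defMul_tmul_one]
  one_apply x := by rw [defCochain_apply, defMul_one_tmul]
  bilinear h hh h' hh' x y := defCochain_bilinear s 0 hh hh' x y

/-- With `γ = ε m_{s0}` and `γ⁻¹ = ε m_{0s}` the twisted multiplication is
`γ ∗ m_{00} ∗ γ⁻¹ = m_{s0} ∗ γ⁻¹ = m_{ss}`. -/
theorem twistMul_defCochain : twistMul (defCochain s 0) = defMul s s := by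
  rw [twistMul, inverse_defCochain, ← defMul_zero, linearMap_defCochain_mul,
    mul_linearMap_defCochain]

end Biproduct

end QuantumLinearSpace

end QLS

namespace QLS.QuantumLinearSpace

variable {K : Type*} [Field K] {Γ : Type*} [CommGroup Γ] {θ : ℕ} {W : QuantumLinearSpace K Γ θ}

namespace LiftingDatum

open Lifting Biproduct

variable (L : W.LiftingDatum)

/-! ### The twist is the lifting -/

/-- The scalars of a lifting datum as a parameter of the deformations of `A`. -/
def param : W.Param where
  diag := L.diag
  off := L.off
  diag_ne i h := (L.diag_ne i h).2
  off_ne i j hij h := (L.off_ne i j hij h).2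
  off_swap i j hij := L.off_swap i j hij

/-- The lifting acts on `A` through the deformed left multiplications with both parameters equal to
the lifting datum. -/
def rep : L.Alg →ₐ[K] Module.End K W.Biproduct :=
  lift W L.diag L.off (opGr W) (opY L.param L.param) (opGr_one W) (opGr_mul_opGr W)
    (opGr_mul_opY _ _)
    (fun i => (opY_pow _ _ i).trans (smul_sub _ _ _).symm)
    (fun i j hij => by
      rw [opY_mul_opY _ _ hij, add_sub_assoc]
      exact congrArg _ (smul_sub _ _ _).symm)

theorem rep_mk (c : FreeAlgebra K (Γ ⊕ Fin θ)) :
    L.rep (Lifting.mk W L.diag L.off c) = act L.param L.param c := by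
  have : L.rep.comp (Lifting.mk W L.diag L.off) = act L.param L.param := by
    refine FreeAlgebra.hom_ext (funext fun v => ?_)
    cases v with
    | inl h =>
      refine Eq.trans ?_ (act_inl L.param L.param h).symm
      exact lift_of W L.diag L.off _ _ _ _ _ _ _ h
    | inr i =>
      refine Eq.trans ?_ (act_inr L.param L.param i).symm
      exact lift_x W L.diag L.off _ _ _ _ _ _ _ i
  exact DFunLike.congr_fun this c

/-- The linear map from the lifting to `A` that sends ordered monomials to ordered monomials,
encoded as the action on `1`. -/
def toBiproduct : L.Alg →ₗ[K] W.Biproduct where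
  toFun b := L.rep b 1
  map_add' a b := by rw [map_add, LinearMap.add_apply]
  map_smul' c a := by rw [map_smul, LinearMap.smul_apply, RingHom.id_apply]

theorem toBiproduct_apply (b : L.Alg) : L.toBiproduct b = L.rep b 1 := rfl

theorem toBiproduct_mk (c : FreeAlgebra K (Γ ⊕ Fin θ)) :
    L.toBiproduct (Lifting.mk W L.diag L.off c) = act L.param L.param c 1 := by
  rw [toBiproduct_apply, rep_mk]

theorem toBiproduct_mul (a b : L.Alg) : L.toBiproduct (a * b) =
    defMul L.param L.param (L.toBiproduct a ⊗ₜ L.toBiproduct b) := by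
  obtain ⟨c, rfl⟩ := Lifting.mk_surjective W L.diag L.off a
  obtain ⟨d, rfl⟩ := Lifting.mk_surjective W L.diag L.off b
  rw [← map_mul, toBiproduct_mk, toBiproduct_mk, toBiproduct_mk, defMul_act_tmul, map_mul,
    Module.End.mul_apply]

/-- The linear map from `A` to the lifting that sends ordered monomials to ordered monomials. -/
def ofBiproduct : W.Biproduct →ₗ[K] L.Alg :=
  (basis W).constr K fun p => word (x W L.diag L.off) (fun i => p.1 i) * of W L.diag L.off p.2

theorem toBiproduct_monomial (p : Exps W × Γ) :
    L.toBiproduct (word (x W L.diag L.off) (fun i => p.1 i) * of W L.diag L.off p.2) =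
      basis W p := by
  have h := L.toBiproduct_mk (word (fun i => FreeAlgebra.ι K (Sum.inr i)) (fun i => p.1 i) *
    FreeAlgebra.ι K (Sum.inl p.2))
  rw [map_mul (Lifting.mk W L.diag L.off), map_mul (act L.param L.param), map_word, map_word,
    act_inl] at h
  simp only [act_inr] at h
  rw [word_opY_basis] at h
  exact h

theorem toBiproduct_ofBiproduct (y : W.Biproduct) : L.toBiproduct (L.ofBiproduct y) = y := by
  have : L.toBiproduct ∘ₗ L.ofBiproduct = LinearMap.id :=
    (basis W).ext fun p => by
      rw [LinearMap.comp_apply, ofBiproduct, Module.Basis.constr_basis, toBiproduct_monomial]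
      rfl
  exact LinearMap.congr_fun this y

theorem straightens : W.Straightens (of W L.diag L.off) (x W L.diag L.off) where
  one := of_one W _ _
  mul := of_mul W _ _
  comm := of_mul_x W _ _
  pow i := by
    rw [x_pow, ← of_one W L.diag L.off]
    exact Submodule.smul_mem _ _ (Submodule.sub_mem _ (Submodule.subset_span ⟨_, rfl⟩)
      (Submodule.subset_span ⟨_, rfl⟩))
  skew i j h := by
    refine ⟨W.χ j (W.g i), ?_⟩
    rw [x_mul_x W L.diag L.off h, add_sub_cancel_left, ← of_one W L.diag L.off]
    exact Submodule.smul_mem _ _ (Submodule.sub_mem _ (Submodule.subset_span ⟨_, rfl⟩)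
      (Submodule.subset_span ⟨_, rfl⟩))

/-- The ordered monomials span the lifting, and their images under `toBiproduct` are linearly
independent; in particular they form a basis of the lifting. -/
theorem ofBiproduct_toBiproduct (b : L.Alg) : L.ofBiproduct (L.toBiproduct b) = b := by
  obtain ⟨c, rfl⟩ := Lifting.mk_surjective W L.diag L.off b
  have hmk : FreeAlgebra.lift K (Sum.elim (of W L.diag L.off) (x W L.diag L.off)) =
      Lifting.mk W L.diag L.off := by
    refine FreeAlgebra.hom_ext (funext fun v => ?_)
    cases v <;> exact FreeAlgebra.lift_ι_apply _ _
  have hle : Submodule.span K (Set.range fun p : Exps W × Γ =>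
      word (x W L.diag L.off) (fun i => p.1 i) * of W L.diag L.off p.2) ≤
      LinearMap.range L.ofBiproduct := by
    refine Submodule.span_le.mpr ?_
    rintro _ ⟨p, rfl⟩
    exact ⟨basis W p, by rw [ofBiproduct, Module.Basis.constr_basis]⟩
  have hspan := L.straightens.lift_mem_span c
  rw [hmk] at hspan
  obtain ⟨z, hz⟩ := hle hspan
  rw [← hz, toBiproduct_ofBiproduct]

theorem counit_mk (c : FreeAlgebra K (Γ ⊕ Fin θ)) :
    Coalgebra.counit (R := K) (Lifting.mk W L.diag L.off c) = freeCounit c := by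
  have : (counitHom W L.diag L.off).comp (Lifting.mk W L.diag L.off) = freeCounit := by
    refine FreeAlgebra.hom_ext (funext fun v => ?_)
    cases v with
    | inl h => exact (counitHom_of W L.diag L.off h).trans (by simp [freeCounit])
    | inr i => exact (counitHom_x W L.diag L.off i).trans (by simp [freeCounit])
  exact DFunLike.congr_fun this c

theorem comul_mk (c : FreeAlgebra K (Γ ⊕ Fin θ)) :
    Coalgebra.comul (R := K) (Lifting.mk W L.diag L.off c) =
      Algebra.TensorProduct.map (Lifting.mk W L.diag L.off) (Lifting.mk W L.diag L.off)
        (freeComul W c) := by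
  have : (comulHom W L.diag L.off).comp (Lifting.mk W L.diag L.off) =
      (Algebra.TensorProduct.map (Lifting.mk W L.diag L.off) (Lifting.mk W L.diag L.off)).comp
        (freeComul W) := by
    refine FreeAlgebra.hom_ext (funext fun v => ?_)
    cases v with
    | inl h => exact (comulHom_of W L.diag L.off h).trans (by simp [freeComul, of])
    | inr i => exact (comulHom_x W L.diag L.off i).trans (by simp [freeComul, x, of])
  exact DFunLike.congr_fun this c

/-- The lifting and `A` are isomorphic as coalgebras. -/
def coalgEquiv : L.Alg ≃ₗc[K] W.Biproduct where
  toFun := L.toBiproduct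
  map_add' := map_add _
  map_smul' := map_smul _
  counit_comp := by
    refine LinearMap.ext fun b => ?_
    obtain ⟨c, rfl⟩ := Lifting.mk_surjective W L.diag L.off b
    rw [counit_mk]
    change Coalgebra.counit (R := K) (L.toBiproduct (Lifting.mk W L.diag L.off c)) = _
    rw [toBiproduct_mk, counit_act, Bialgebra.counit_one, mul_one]
  map_comp_comul := by
    refine LinearMap.ext fun b => ?_
    obtain ⟨c, rfl⟩ := Lifting.mk_surjective W L.diag L.off b
    change TensorProduct.map L.toBiproduct L.toBiproduct
      (Coalgebra.comul (R := K) (Lifting.mk W L.diag L.off c)) =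
      Coalgebra.comul (R := K) (L.toBiproduct (Lifting.mk W L.diag L.off c))
    have key : ∀ w, TensorProduct.map L.toBiproduct L.toBiproduct
        (Algebra.TensorProduct.map (Lifting.mk W L.diag L.off) (Lifting.mk W L.diag L.off) w) =
        act₂ L.param L.param L.param w (1 ⊗ₜ 1) := by
      intro w
      induction w with
      | zero => simp
      | add a b ha hb => simp only [map_add, LinearMap.add_apply, ha, hb]
      | tmul a b =>
        rw [act₂_tmul, Algebra.TensorProduct.map_tmul, TensorProduct.map_tmul,
          TensorProduct.map_tmul, toBiproduct_mk, toBiproduct_mk]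
    rw [comul_mk, toBiproduct_mk, comul_act L.param L.param L.param, key, Bialgebra.comul_one,
      Algebra.TensorProduct.one_def]
  invFun := L.ofBiproduct
  left_inv := L.ofBiproduct_toBiproduct
  right_inv := L.toBiproduct_ofBiproduct

theorem ofBiproduct_defMul (y z : W.Biproduct) :
    L.ofBiproduct (defMul L.param L.param (y ⊗ₜ z)) = L.ofBiproduct y * L.ofBiproduct z := by
  have h := L.toBiproduct_mul (L.ofBiproduct y) (L.ofBiproduct z)
  rw [toBiproduct_ofBiproduct, toBiproduct_ofBiproduct] at h
  rw [← h, ofBiproduct_toBiproduct]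

theorem twistIso_defCochain : TwistIso (defCochain L.param 0) L.Alg := by
  refine ⟨L.coalgEquiv.symm, ?_, fun y z => ?_⟩
  · change L.ofBiproduct 1 = 1
    have : L.toBiproduct 1 = 1 := by
      rw [toBiproduct_apply, map_one L.rep]
      rfl
    rw [← this, ofBiproduct_toBiproduct]
  · change L.ofBiproduct (twistMul (defCochain L.param 0)
      ((y : W.Biproduct) ⊗ₜ[K] (z : W.Biproduct))) = L.ofBiproduct y * L.ofBiproduct z
    rw [twistMul_defCochain]
    exact L.ofBiproduct_defMul y z

end LiftingDatum

end QLS.QuantumLinearSpace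

namespace QLS.QuantumLinearSpace

variable {K : Type*} [Field K] {Γ : Type*} [CommGroup Γ] {θ : ℕ} {W : QuantumLinearSpace K Γ θ}

/-! ### Linear forms along words -/

section Forms

variable {V V' : Type*} [AddCommGroup V] [Module K V] [AddCommGroup V'] [Module K V']
  {X : Fin θ → Module.End K V}

theorem comp_pow_eq_zero {f : V →ₗ[K] V'} {T : Module.End K V} (h : f ∘ₗ T = 0) {m : ℕ}
    (hm : m ≠ 0) : f ∘ₗ (T ^ m) = 0 := by
  obtain ⟨m, rfl⟩ := Nat.exists_eq_succ_of_ne_zero hm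
  rw [pow_succ', Module.End.mul_eq_comp, ← LinearMap.comp_assoc, h, LinearMap.zero_comp]

open Classical in
theorem comp_prod_of_comp_eq_zero (f : V →ₗ[K] V') (n : Fin θ → ℕ) (l : List (Fin θ))
    (h : ∀ k ∈ l, f ∘ₗ X k = 0) :
    f ∘ₗ (l.map fun k => X k ^ n k).prod = if ∀ k ∈ l, n k = 0 then f else 0 := by
  induction l with
  | nil => simp [Module.End.one_eq_id]
  | cons i t ih =>
    rw [List.map_cons, List.prod_cons, Module.End.mul_eq_comp, ← LinearMap.comp_assoc]
    by_cases hi : n i = 0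
    · rw [hi, pow_zero, Module.End.one_eq_id, LinearMap.comp_id,
        ih fun k hk => h k (List.mem_cons_of_mem _ hk)]
      simp [hi]
    · rw [comp_pow_eq_zero (h i List.mem_cons_self) hi, LinearMap.zero_comp, if_neg]
      exact fun H => hi (H i List.mem_cons_self)

open Classical in
/-- If a linear form vanishes on the images of all letters but `X_j`, and `f X_j ^ m` vanishes on
the images of the letters after `X_j`, then `f` sees only the powers of `X_j` among the words. -/
theorem comp_word_eq_ite (f : V →ₗ[K] V') (n : Fin θ → ℕ) (j : Fin θ)
    (h1 : ∀ k, k ≠ j → f ∘ₗ X k = 0) (h2 : ∀ k, j < k → (f ∘ₗ (X j ^ n j)) ∘ₗ X k = 0) :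
    f ∘ₗ word X n = if ∀ k, k ≠ j → n k = 0 then f ∘ₗ (X j ^ n j) else 0 := by
  have key : ∀ l : List (Fin θ), l.Pairwise (· < ·) → j ∈ l →
      f ∘ₗ (l.map fun k => X k ^ n k).prod =
        if ∀ k ∈ l, k ≠ j → n k = 0 then f ∘ₗ (X j ^ n j) else 0 := by
    intro l
    induction l with
    | nil => simp
    | cons i t ih =>
      intro hl hj
      rw [List.pairwise_cons] at hl
      rw [List.map_cons, List.prod_cons, Module.End.mul_eq_comp, ← LinearMap.comp_assoc]
      rcases eq_or_ne i j with rfl | hij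
      · rw [comp_prod_of_comp_eq_zero _ n t fun k hk => h2 k (hl.1 k hk)]
        congr 1
        refine propext ⟨fun H k hk hki => ?_, fun H k hk => ?_⟩
        · exact H k ((List.mem_cons.mp hk).resolve_left hki)
        · exact H k (List.mem_cons_of_mem _ hk) (hl.1 k hk).ne'
      · have hj' : j ∈ t := (List.mem_cons.mp hj).resolve_left hij.symm
        by_cases hi : n i = 0
        · rw [hi, pow_zero, Module.End.one_eq_id, LinearMap.comp_id, ih hl.2 hj']
          simp [hi]
        · rw [comp_pow_eq_zero (h1 i hij) hi, LinearMap.zero_comp, if_neg]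
          exact fun H => hi (H i List.mem_cons_self hij)
  simpa [word] using key _ (List.pairwise_lt_finRange θ) (List.mem_finRange j)

end Forms

namespace Biproduct

open Lifting

/-! ### Powers of the skew derivations -/

variable (W) in
/-- The linear form `y ↦ ε(∂_i^m y)`, the `m`-th convolution power of `ξ_i`. -/
def ξPow (i : Fin θ) (m : ℕ) : W.Biproduct →ₗ[K] K := Coalgebra.counit ∘ₗ (opD W i ^ m)

theorem ξPow_zero (i : Fin θ) : ξPow W i 0 = Coalgebra.counit := by
  rw [ξPow, pow_zero, Module.End.one_eq_id, LinearMap.comp_id]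

theorem ξPow_eq_zero (i : Fin θ) {m : ℕ} (hm : W.r i ≤ m) : ξPow W i m = 0 := by
  rw [ξPow, ← Nat.sub_add_cancel hm, pow_add, opD_pow, mul_zero, LinearMap.comp_zero]

theorem counit_comp_opL (i : Fin θ) :
    (Coalgebra.counit : W.Biproduct →ₗ[K] K) ∘ₗ opL W i = 0 :=
  LinearMap.ext fun y => counit_x_mul W i y

theorem comp_eq_zero_of_qComm {f : W.Biproduct →ₗ[K] K} {S T : Module.End K W.Biproduct} {c : K}
    (h : S * T = c • (T * S)) (hf : f ∘ₗ T = 0) : (f ∘ₗ S) ∘ₗ T = 0 := by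
  rw [LinearMap.comp_assoc, ← Module.End.mul_eq_comp, h, LinearMap.comp_smul,
    Module.End.mul_eq_comp, ← LinearMap.comp_assoc, hf, LinearMap.zero_comp, smul_zero]

theorem ξPow_comp_opL_of_ne {i k : Fin θ} (h : k ≠ i) (m : ℕ) : ξPow W i m ∘ₗ opL W k = 0 :=
  comp_eq_zero_of_qComm (pow_mul_qComm (c := W.q i k) (by simp [opD_mul_opL, h.symm]) m)
    (counit_comp_opL k)

theorem ξPow_comp_opL (i : Fin θ) (m : ℕ) :
    ξPow W i (m + 1) ∘ₗ opL W i = qInt (W.q i i) (m + 1) • ξPow W i m := by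
  have h := pow_mul_of_qComm_add (c := W.q i i) (e := (1 : K)) (f := (1 : K)) (X := opD W i)
    (Y := opL W i) (u := 1) (v := 0) (by simp [opD_mul_opL]) (by simp) (by simp) m
  rw [mul_zero, smul_zero, add_zero, mul_one, mul_one] at h
  rw [ξPow, LinearMap.comp_assoc, ← Module.End.mul_eq_comp, h, LinearMap.comp_add,
    LinearMap.comp_smul, LinearMap.comp_smul, Module.End.mul_eq_comp, ← LinearMap.comp_assoc,
    counit_comp_opL, LinearMap.zero_comp, smul_zero, zero_add]
  rfl

theorem ξPow_opL_pow_one (i : Fin θ) (m p : ℕ) :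
    ξPow W i m ((opL W i ^ p) 1) = if p = m then qFact (W.q i i) m else 0 := by
  induction m generalizing p with
  | zero =>
    rw [ξPow_zero]
    rcases Nat.eq_zero_or_pos p with rfl | hp
    · simp [qFact]
    · rw [if_neg hp.ne']
      exact LinearMap.congr_fun (comp_pow_eq_zero (counit_comp_opL (W := W) i) hp.ne') 1
  | succ m ih =>
    cases p with
    | zero => simp [ξPow, pow_succ, opD_one]
    | succ p =>
      rw [pow_succ', Module.End.mul_apply]
      refine (LinearMap.congr_fun (ξPow_comp_opL i m) ((opL W i ^ p) 1)).trans ?_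
      rw [LinearMap.smul_apply, ih, qFact_succ, smul_eq_mul]
      split_ifs with h1 h2 h2
      · rw [mul_comm]
      · omega
      · omega
      · rw [mul_zero]

theorem eq_single_iff {n : Fin θ → ℕ} {i : Fin θ} {m : ℕ} :
    n = Pi.single i m ↔ (∀ k, k ≠ i → n k = 0) ∧ n i = m := by
  refine ⟨fun H => ⟨fun k hk => by simp [H, hk], by simp [H]⟩, fun H => funext fun k => ?_⟩
  rcases eq_or_ne k i with rfl | hk
  · simpa using H.2
  · simpa [hk] using H.1 k hk

open Classical in
/-- The linear form `ξ_i ^ m` is `(m)!` times the dual basis element of `x_i ^ m`. -/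
theorem ξPow_mon (i : Fin θ) (m : ℕ) (n : Fin θ → ℕ) : ξPow W i m (mon W 0 0 n) =
    if n = Pi.single i m then qFact (W.q i i) m else 0 := by
  have hw : mon W 0 0 n = word (opL W) n 1 := by
    have := map_word (Algebra.lmul K W.Biproduct) (x W 0 0) n
    exact (mul_one _).symm.trans (LinearMap.congr_fun this 1)
  have h := comp_word_eq_ite (X := opL W) (ξPow W i m) n i
    (fun k hk => ξPow_comp_opL_of_ne hk m)
    (fun k hk => comp_eq_zero_of_qComm (pow_mul_qComm (c := W.q k i) (opL_mul_opL W hk.ne) _)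
      (ξPow_comp_opL_of_ne hk.ne' m))
  rw [hw]
  refine (LinearMap.congr_fun h 1).trans ?_
  by_cases hz : ∀ k, k ≠ i → n k = 0
  · rw [if_pos hz]
    refine (ξPow_opL_pow_one i m (n i)).trans ?_
    congr 1
    exact propext ⟨fun H => eq_single_iff.mpr ⟨hz, H⟩, fun H => (eq_single_iff.mp H).2⟩
  · rw [if_neg hz, if_neg fun H => hz (eq_single_iff.mp H).1]
    rfl

/-! ### Skew sums that differ in one place -/

variable (s t : W.Param)

variable {s t} in
theorem comb_congr {S : Type*} [Ring S] [Algebra K S] {k : Fin θ}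
    (h : ∀ l < k, s.off k l = t.off k l) (hd : s.diag k = t.diag k) (d : Fin θ → S) :
    s.comb d k = t.comb d k := by
  rw [Param.comb, Param.comb, hd]
  congr 1
  exact Finset.sum_congr rfl fun l hl => by rw [h l (Finset.mem_Iio.mp hl)]

theorem defCochain_congr {s' : W.Param} (h : ∀ k, ∀ l < k, s.off k l = s'.off k l)
    (hd : ∀ k, s.diag k = s'.diag k) : defCochain s t = defCochain s' t := by
  have hY : opY s t = opY s' t := funext fun k => by
    rw [opY, opY, opP, opP, comb_congr (h k) (hd k)]
  have hM : leftMul s t = leftMul s' t := by rw [leftMul, leftMul, hY]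
  rw [defCochain, defCochain, defMul, defMul, hM]

theorem counit_comp_opY (k : Fin θ) :
    (Coalgebra.counit : W.Biproduct →ₗ[K] K) ∘ₗ opY s t k =
      Coalgebra.counit ∘ₗ (opP s k - opP t k) := by
  refine LinearMap.ext fun y => ?_
  rw [LinearMap.comp_apply, counit_opY, LinearMap.comp_apply, LinearMap.sub_apply, map_sub]

/-- If `a_ki ≠ 0` for some `k > i`, the condition `r_i = 2` is needed: the summand `d_i` of the
operator then commutes with `d_i` by the wrong scalar, which is harmless only if `d_i ^ 2 = 0`. -/
theorem opP_mul_opD {i k : Fin θ} (hki : k ≠ i) (h : i < k → t.off k i ≠ 0 → W.r i = 2) :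
    opP t k * opD W i = W.q k i • (opD W i * opP t k) := by
  refine t.comb_mul (opD W) k (opD W i) _ (fun l hl h0 => ?_) (fun h0 => ?_)
  · rcases eq_or_ne l i with rfl | hli
    · have h3 : opD W l * opD W l = 0 := by rw [← pow_two, ← h hl h0, opD_pow]
      rw [h3, smul_zero]
    · have h2 := t.q_mul_q_off hl.ne' h0 i
      have h3 := q_mul_q (W := W) hli
      have h4 : W.q k i = W.q i l :=
        mul_right_cancel₀ (W.q_ne_zero l i) (by rw [h2, mul_comm, h3])
      rw [h4, opD_mul_opD W hli]
  · rw [pow_mul_qComm (c := W.q i k) (opD_mul_opD W hki),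
      Param.pow_pred (W.two_le k) (t.q_pow' hki h0) (q_mul_q hki.symm)]

/-- Under `ξ_i ^ m` a deformed letter `X_k`, `k ≠ i`, acts as the difference of its two
corrections. -/
theorem ξPow_comp_opY {i k : Fin θ} (hki : k ≠ i) (h : i < k → t.off k i ≠ 0 → W.r i = 2) (m : ℕ) :
    ξPow W i m ∘ₗ opY s t k = ξPow W i m ∘ₗ (opP s k - opP t k) := by
  refine LinearMap.ext fun y => ?_
  have e1 := LinearMap.congr_fun (ξPow_comp_opL_of_ne (W := W) hki m) y
  have e2 : opD W i ^ m * opQ t k = W.q i k ^ m • (opGr W (W.g k) * (opP' t k * opD W i ^ m)) := by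
    have hc : opD W i ^ m * opP' t k = opP' t k * opD W i ^ m :=
      (show Commute (opD W i) (opP' t k) from opD_mul_opP' t i k).pow_left m
    rw [opQ, ← mul_assoc, pow_mul_qComm (c := W.q i k) (opD_mul_opGr W i (W.g k)), smul_mul_assoc,
      mul_assoc, hc]
  have e3 := mul_pow_qComm (c := W.q k i) (opP_mul_opD t hki h) m
  have e4 : ξPow W i m (opQ t k y) = ξPow W i m (opP t k y) := by
    rw [ξPow, LinearMap.comp_apply, ← Module.End.mul_apply, e2, LinearMap.smul_apply,
      Module.End.mul_apply, map_smul, counit_opGr, Module.End.mul_apply, counit_opP',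
      ← Module.End.mul_apply, e3, LinearMap.smul_apply, map_smul, smul_smul, ← mul_pow,
      q_mul_q hki.symm, one_pow, one_smul]
    rfl
  rw [LinearMap.comp_apply, LinearMap.comp_apply, opY, LinearMap.sub_apply, LinearMap.add_apply,
    map_sub, map_add, e4, LinearMap.sub_apply, map_sub]
  rw [LinearMap.comp_apply, LinearMap.zero_apply] at e1
  rw [e1, zero_add]

/-- By `H`-bilinearity the cochain is determined by the values of `ε` on words in the deformed
letters applied to monomials. -/
theorem defCochain_eq_bilinExt {f : Exps W → Exps W → K}
    (h : ∀ n m : Exps W, ((Coalgebra.counit : W.Biproduct →ₗ[K] K) ∘ₗ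
      word (opY s t) fun k => (n k : ℕ)) (mon W 0 0 fun k => m k) = f n m) :
    defCochain s t = bilinExt W f := by
  have : (defCochain s t).ofConv = (bilinExt W f).ofConv := by
    refine ((leftBasis W).tensorProduct (basis W)).ext fun p => ?_
    obtain ⟨⟨n, k⟩, m, l⟩ := p
    rw [Module.Basis.tensorProduct_apply, leftBasis_apply, basis_apply]
    refine Eq.trans ?_ ((h n m).trans (bilinExt_apply W f k l n m).symm)
    refine (defCochain_apply s t _).trans ?_
    have hb : mon W 0 0 (fun i => (n i : ℕ)) = basis W (n, 1) := by
      rw [basis_apply, of_one, mul_one]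
    rw [defMul_of_mul_tmul, defMul_tmul_mul_of, counit_of_mul, Bialgebra.counit_mul, counit_of,
      mul_one, hb, defMul_tmul, leftMul_basis, opGr_one, mul_one]
    rfl
  exact congrArg toConv this

end Biproduct

end QLS.QuantumLinearSpace

namespace QLS.QuantumLinearSpace

variable {K : Type*} [Field K] {Γ : Type*} [CommGroup Γ] {θ : ℕ} {W : QuantumLinearSpace K Γ θ}

namespace Biproduct

open Lifting

variable (s t : W.Param)

/-! ### Changing one scalar -/

variable {s t}

theorem opP_of_off {i j : Fin θ} (hij : i < j) (ht : t.off j i = 0)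
    (hoff : ∀ l < j, l ≠ i → s.off j l = t.off j l) (hd : s.diag j = t.diag j) :
    opP s j = opP t j + s.off j i • opD W i := by
  have hi : i ∈ Finset.Iio j := Finset.mem_Iio.mpr hij
  rw [opP, opP, Param.comb, Param.comb, hd, ← Finset.add_sum_erase _ _ hi,
    ← Finset.add_sum_erase _ _ hi, ht, zero_smul, zero_add, Finset.sum_congr rfl fun l hl => ?_,
    add_assoc, add_comm]
  obtain ⟨h1, h2⟩ := Finset.mem_erase.mp hl
  rw [hoff l (Finset.mem_Iio.mp h2) h1]

theorem comp_opY_eq_zero {k : Fin θ} (h : opP s k = opP t k) :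
    (Coalgebra.counit : W.Biproduct →ₗ[K] K) ∘ₗ opY s t k = 0 := by
  rw [counit_comp_opY, h, sub_self, LinearMap.comp_zero]

/-- Switching on the scalar `a_ji` multiplies the cocycle by `γ_ij`. -/
theorem defCochain_eq_offCochain {i j : Fin θ} (hij : i < j) (ht : t.off j i = 0)
    (hoff : ∀ k, ∀ l < k, ¬(k = j ∧ l = i) → s.off k l = t.off k l) (hd : s.diag = t.diag) :
    defCochain s t = offCochain W (s.off j i) i j := by
  have hP : ∀ k ≠ j, opP s k = opP t k := fun k hk =>
    comb_congr (fun l hl => hoff k l hl fun H => hk H.1) (congrFun hd k) _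
  have hPj : opP s j = opP t j + s.off j i • opD W i :=
    opP_of_off hij ht (fun l hl hli => hoff j l hl fun H => hli H.2) (congrFun hd j)
  have hpow : ∀ m, (Coalgebra.counit : W.Biproduct →ₗ[K] K) ∘ₗ (opY s t j ^ m) =
      s.off j i ^ m • ξPow W i m := by
    intro m
    induction m with
    | zero => rw [ξPow_zero, pow_zero, pow_zero, one_smul, Module.End.one_eq_id, LinearMap.comp_id]
    | succ m ih =>
      rw [pow_succ, Module.End.mul_eq_comp, ← LinearMap.comp_assoc, ih, LinearMap.smul_comp,
        ξPow_comp_opY s t hij.ne' (fun _ h => absurd ht h), hPj, add_sub_cancel_left,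
        LinearMap.comp_smul, smul_smul, ← pow_succ, ξPow, LinearMap.comp_assoc,
        ← Module.End.mul_eq_comp, ← pow_succ]
      rfl
  -- only the words `X_j ^ m` contribute, and `ε X_j ^ m` is the multiple `a_ji ^ m` of `ξ_i ^ m`
  refine defCochain_eq_bilinExt s t fun n m => ?_
  rw [comp_word_eq_ite _ _ j (fun k hk => comp_opY_eq_zero (hP k hk)) (fun k hk => ?_), hpow]
  · by_cases hz : ∀ k, k ≠ j → (n k : ℕ) = 0
    · rw [if_pos hz, LinearMap.smul_apply, ξPow_mon]
      by_cases hm : (fun k => (m k : ℕ)) = Pi.single i (n j : ℕ)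
      · have hmi : (m i : ℕ) = n j := (eq_single_iff.mp hm).2
        rw [if_pos hm, if_pos ⟨eq_single_iff.mpr ⟨hz, hmi.symm⟩, by rw [hmi]; exact hm⟩, hmi,
          smul_eq_mul, mul_comm]
        rfl
      · rw [if_neg hm, smul_zero, if_neg fun H => hm ?_]
        rw [(eq_single_iff.mp H.1).2]
        exact H.2
    · rw [if_neg hz, if_neg fun H => hz (eq_single_iff.mp H.1).1]
      rfl
  · rw [hpow, LinearMap.smul_comp]
    rcases Nat.eq_zero_or_pos (n j) with h0 | h0
    · rw [h0, ξPow_zero, comp_opY_eq_zero (hP k hk.ne'), smul_zero]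
    · by_cases hc : s.off j i = 0
      · rw [hc, zero_pow h0.ne', zero_smul]
      · -- if `a_ki ≠ 0` as well, then `i` has two neighbours, so that `r_i = 2`
        rw [ξPow_comp_opY s t (hij.trans hk).ne' fun hik h => ?_, hP k hk.ne', sub_self,
          LinearMap.comp_zero, smul_zero]
        refine s.r_eq_two hk.ne hij.ne' hik.ne' hc ?_
        rwa [hoff k i hik fun H => hk.ne' H.1]

/-- Switching on the scalar `a_i` multiplies the cocycle by `γ_i`, provided that all `a_ij` vanish:
then `ε X_i ^ m` is the multiple `a_i / (r_i - m)!` of `ξ_i ^ (r_i - m)` for `0 < m < r_i`. -/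
theorem defCochain_eq_diagCochain {i : Fin θ} (ht : t.diag i = 0)
    (hi : ∀ k ≠ i, s.off i k = 0 ∧ s.off k i = 0) (hoff : s.off = t.off)
    (hd : ∀ k ≠ i, s.diag k = t.diag k) :
    defCochain s t = diagCochain W (s.diag i) i := by
  have h2 := W.two_le i
  have hP : ∀ k ≠ i, opP s k = opP t k := fun k hk =>
    comb_congr (fun l _ => by rw [hoff]) (hd k hk) _
  have hcomb : ∀ u : W.Param, (∀ k ≠ i, u.off i k = 0) → ∀ d : Fin θ → Module.End K W.Biproduct,
      u.comb d i = (u.diag i / qFact (W.q i i) (W.r i - 1)) • d i ^ (W.r i - 1) := by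
    intro u hu d
    rw [Param.comb, Finset.sum_eq_zero, zero_add]
    exact fun l hl => by rw [hu l (Finset.mem_Iio.mp hl).ne, zero_smul]
  have hti : ∀ d : Fin θ → Module.End K W.Biproduct, t.comb d i = 0 := fun d => by
    rw [hcomb t (fun k hk => by rw [← hoff, (hi k hk).1]), ht, zero_div, zero_smul]
  have hY : opY s t i = opL W i +
      (s.diag i / qFact (W.q i i) (W.r i - 1)) • opD W i ^ (W.r i - 1) := by
    rw [opY, opQ, opP', hti, mul_zero, sub_zero, opP, hcomb s fun k hk => (hi k hk).1]
  have hpow : ∀ m, m + 1 < W.r i → (Coalgebra.counit : W.Biproduct →ₗ[K] K) ∘ₗ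
      (opY s t i ^ (m + 1)) = (s.diag i / qFact (W.q i i) (W.r i - (m + 1))) •
        ξPow W i (W.r i - (m + 1)) := by
    intro m
    induction m with
    | zero =>
      intro _
      rw [zero_add, pow_one, hY, LinearMap.comp_add, counit_comp_opL, zero_add,
        LinearMap.comp_smul]
      rfl
    | succ m ih =>
      intro hm
      obtain ⟨p, hp⟩ : ∃ p, W.r i - (m + 1) = p + 1 := ⟨W.r i - (m + 1) - 1, by omega⟩
      have hp' : W.r i - (m + 1 + 1) = p := by omega
      -- the correction term involves `ξ_i ^ (r_i + p)`, which vanishes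
      have hz : ξPow W i (p + 1) ∘ₗ (opD W i ^ (W.r i - 1)) = 0 := by
        rw [ξPow, LinearMap.comp_assoc, ← Module.End.mul_eq_comp, ← pow_add]
        exact ξPow_eq_zero i (by omega)
      have hq : qInt (W.q i i) (p + 1) ≠ 0 := by
        have := W.qFact_ne_zero i (m := p + 1) (by omega)
        rw [qFact_succ] at this
        exact right_ne_zero_of_mul this
      rw [pow_succ, Module.End.mul_eq_comp, ← LinearMap.comp_assoc, ih (by omega), hp, hp',
        LinearMap.smul_comp, hY, LinearMap.comp_add, LinearMap.comp_smul, hz, smul_zero, add_zero,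
        ξPow_comp_opL, smul_smul, qFact_succ, div_mul_eq_mul_div, mul_div_mul_right _ _ hq]
  refine defCochain_eq_bilinExt s t fun n m => ?_
  rw [comp_word_eq_ite _ _ i (fun k hk => comp_opY_eq_zero (hP k hk)) (fun k hk => ?_)]
  · by_cases hz : ∀ k, k ≠ i → (n k : ℕ) = 0
    · rw [if_pos hz]
      rcases Nat.eq_zero_or_pos (n i) with h0 | h0
      · have hn : ∀ l, (n l : ℕ) = 0 := fun l => by
          rcases eq_or_ne l i with rfl | hl
          exacts [h0, hz l hl]
        rw [h0, pow_zero, Module.End.one_eq_id, LinearMap.comp_id, ← ξPow_zero i, ξPow_mon]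
        refine Eq.trans ?_ (if_neg ?_).symm
        · simp [hn, funext_iff, qFact]
        · rintro ⟨k, hk, -, hk', -⟩
          have := hn i
          rw [(eq_single_iff.mp hk').2] at this
          omega
      · obtain ⟨p, hp⟩ : ∃ p, (n i : ℕ) = p + 1 := ⟨(n i : ℕ) - 1, by omega⟩
        have hlt := (n i).2
        rw [hp, hpow p (hp ▸ hlt), LinearMap.smul_apply, ξPow_mon]
        by_cases hm : (fun k => (m k : ℕ)) = Pi.single i (W.r i - (p + 1))
        · rw [if_pos hm, if_pos ⟨n i, h0, hlt, eq_single_iff.mpr ⟨hz, rfl⟩, by rw [hp, hm]⟩,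
            smul_eq_mul, div_mul_cancel₀ _ (W.qFact_ne_zero i (by omega))]
        · rw [if_neg hm, smul_zero, if_neg, if_neg]
          · exact fun H => h0.ne' (H.1 i)
          · rintro ⟨k, -, -, hk, hk'⟩
            rw [← (eq_single_iff.mp hk).2, hp] at hk'
            exact hm hk'
    · rw [if_neg hz, if_neg, if_neg]
      · rfl
      · exact fun H => hz fun k _ => H.1 k
      · rintro ⟨k, -, -, hk, -⟩
        exact hz (eq_single_iff.mp hk).1
  · rcases Nat.eq_zero_or_pos (n i) with h0 | h0
    · rw [h0, pow_zero, Module.End.one_eq_id, LinearMap.comp_id, comp_opY_eq_zero (hP k hk.ne')]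
    · obtain ⟨p, hp⟩ : ∃ p, (n i : ℕ) = p + 1 := ⟨(n i : ℕ) - 1, by omega⟩
      rw [hp, hpow p (hp ▸ (n i).2), LinearMap.smul_comp, ξPow_comp_opY s t hk.ne' fun _ h => ?_,
        hP k hk.ne', sub_self, LinearMap.comp_zero, smul_zero]
      exact absurd (hoff ▸ (hi k hk.ne').2) h

end Biproduct

/-! ### Switching on the scalars one at a time -/

open Classical in
/-- The scalars `a_ij` with `(i, j)` or `(j, i)` in `S`, and `a_i` with `i` in `S`; the others are
replaced by `0`. -/
def Param.restrict (s : W.Param) (S : Set (Fin θ × Fin θ ⊕ Fin θ)) : W.Param where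
  diag i := if Sum.inr i ∈ S then s.diag i else 0
  off i j := if Sum.inl (i, j) ∈ S ∨ Sum.inl (j, i) ∈ S then s.off i j else 0
  diag_ne i h := s.diag_ne i fun H => h (by rw [H, ite_self])
  off_ne i j hij h := s.off_ne i j hij fun H => h (by rw [H, ite_self])
  off_swap i j hij := by
    by_cases h : Sum.inl (i, j) ∈ S ∨ Sum.inl (j, i) ∈ S
    · rw [if_pos h, if_pos h.symm, s.off_swap i j hij]
    · rw [if_neg h, if_neg (mt Or.symm h), mul_zero]

open Classical in
theorem Param.restrict_off (s : W.Param) (S : Set (Fin θ × Fin θ ⊕ Fin θ)) (i j : Fin θ) :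
    (s.restrict S).off i j =
      if Sum.inl (i, j) ∈ S ∨ Sum.inl (j, i) ∈ S then s.off i j else 0 := rfl

open Classical in
theorem Param.restrict_off_congr (s : W.Param) {S S' : Set (Fin θ × Fin θ ⊕ Fin θ)} {i j : Fin θ}
    (h : Sum.inl (i, j) ∈ S ↔ Sum.inl (i, j) ∈ S') (h' : Sum.inl (j, i) ∈ S ↔ Sum.inl (j, i) ∈ S') :
    (s.restrict S).off i j = (s.restrict S').off i j := if_congr (or_congr h h') rfl rfl

open Classical in
theorem Param.restrict_diag_congr (s : W.Param) {S S' : Set (Fin θ × Fin θ ⊕ Fin θ)} {i : Fin θ}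
    (h : Sum.inr i ∈ S ↔ Sum.inr i ∈ S') :
    (s.restrict S).diag i = (s.restrict S').diag i := if_congr h rfl rfl

open Biproduct

/-- The cochain `γ_ij` of a pair `(i, j)`, or `γ_i` of a vertex `i`. -/
def Param.factor (s : W.Param) : Fin θ × Fin θ ⊕ Fin θ → Cochain K W.Biproduct :=
  Sum.elim (fun p => offCochain W (s.off p.2 p.1) p.1 p.2) fun i => diagCochain W (s.diag i) i

/-- The convolution product of the factors in a list in which no vertex precedes a pair containing
it. Each factor switches on one scalar, and the product telescopes by `defCochain_mul`. -/
theorem Param.prod_factor (s : W.Param) (l : List (Fin θ × Fin θ ⊕ Fin θ)) (hnd : l.Nodup)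
    (hlt : ∀ p, Sum.inl p ∈ l → p.1 < p.2)
    (hl : l.Pairwise fun a b => ∀ i p, a = Sum.inr i → b = Sum.inl p → i ≠ p.1 ∧ i ≠ p.2) :
    (l.map s.factor).prod = defCochain (s.restrict {a | a ∈ l}) 0 := by
  induction l with
  | nil =>
    rw [List.map_nil, List.prod_nil, ← defCochain_self (0 : W.Param)]
    exact (defCochain_congr _ _ (fun k l _ => if_neg (by simp)) (fun k => if_neg (by simp))).symm
  | cons a l ih =>
    rw [List.nodup_cons] at hnd
    rw [List.pairwise_cons] at hl
    rw [List.map_cons, List.prod_cons,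
      ih hnd.2 (fun p hp => hlt p (List.mem_cons_of_mem _ hp)) hl.2,
      ← defCochain_mul (s.restrict {b | b ∈ a :: l}) (s.restrict {b | b ∈ l})]
    congr 1
    symm
    cases a with
    | inl p =>
      obtain ⟨i, j⟩ := p
      have hij : i < j := hlt (i, j) List.mem_cons_self
      have hji : Sum.inl (j, i) ∉ l := fun H =>
        lt_asymm hij (hlt (j, i) (List.mem_cons_of_mem _ H))
      rw [defCochain_eq_offCochain hij]
      · simp [restrict, factor]
      · simp [restrict, hnd.1, hji]
      · intro k m hmk H
        have h1 : ¬(k = i ∧ m = j) := fun H' => lt_asymm hij (by rw [← H'.1, ← H'.2]; exact hmk)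
        have h2 : ¬(m = i ∧ k = j) := fun H' => H ⟨H'.2, H'.1⟩
        exact s.restrict_off_congr (by simp [h1]) (by simp [h2])
      · exact funext fun k => s.restrict_diag_congr (by simp)
    | inr i =>
      have hne : ∀ p, Sum.inl p ∈ l → i ≠ p.1 ∧ i ≠ p.2 := fun p hp => hl.1 _ hp i p rfl rfl
      have hik : ∀ k, Sum.inl (i, k) ∉ l ∧ Sum.inl (k, i) ∉ l := fun k =>
        ⟨fun H => (hne _ H).1 rfl, fun H => (hne _ H).2 rfl⟩
      rw [defCochain_eq_diagCochain (i := i)]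
      · simp [restrict, factor]
      · simp [restrict, hnd.1]
      · intro k _
        simp [restrict, (hik k).1, (hik k).2]
      · exact funext fun k => funext fun m => s.restrict_off_congr (by simp) (by simp)
      · exact fun k hk => s.restrict_diag_congr (by simp [hk])

namespace LiftingDatum

variable (L : W.LiftingDatum)

/-- The pairs and the vertices, in the order of the factors of `α`. -/
def FactorOrder.list {L : W.LiftingDatum} (o : L.FactorOrder) : List (Fin θ × Fin θ ⊕ Fin θ) :=
  o.comps.flatMap fun τ => (o.pairs τ).map Sum.inl ++ (o.verts τ).map Sum.inr

theorem cocycle_eq_prod (o : L.FactorOrder) : L.cocycle o = (o.list.map L.param.factor).prod := by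
  rw [cocycle, FactorOrder.list]
  induction o.comps with
  | nil => simp
  | cons τ l ih =>
    rw [List.map_cons, List.prod_cons, ih, List.flatMap_cons, List.map_append, List.prod_append,
      List.map_append, List.prod_append, List.map_map, List.map_map]
    rfl

theorem mem_list_inl (o : L.FactorOrder) (i j : Fin θ) : Sum.inl (i, j) ∈ o.list ↔
    i < j ∧ L.graph.connectedComponentMk i = L.graph.connectedComponentMk j := by
  simp [FactorOrder.list, o.mem_comps, o.mem_pairs, eq_comm]

theorem mem_list_inr (o : L.FactorOrder) (i : Fin θ) : Sum.inr i ∈ o.list := by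
  simp [FactorOrder.list, o.mem_comps, o.mem_verts]

/-- If `a_ij ≠ 0`, then `i` and `j` lie in one component, so that every nonzero scalar is switched
on by a factor of `α`. -/
theorem cocycle_eq_defCochain (o : L.FactorOrder) : L.cocycle o = defCochain L.param 0 := by
  have hinl : ∀ τ p, p ∈ o.pairs τ → p.1 ∈ τ.supp ∧ p.2 ∈ τ.supp := fun τ p hp =>
    ((o.mem_pairs τ p.1 p.2).mp hp).2
  have hdisj : ∀ {τ τ' : L.graph.ConnectedComponent} {i : Fin θ}, i ∈ τ.supp → i ∈ τ'.supp →
      τ = τ' := fun h h' => h.symm.trans h'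
  rw [cocycle_eq_prod, L.param.prod_factor]
  · refine defCochain_congr _ _ (fun k l hlk => ?_) (fun k => ?_)
    · by_cases h : L.off k l = 0
      · rw [Param.restrict_off, show L.param.off k l = 0 from h, ite_self]
      · have hadj : L.graph.Adj l k := by
          rw [graph, SimpleGraph.fromRel_adj]
          exact ⟨hlk.ne, Or.inr h⟩
        exact if_pos (Or.inr ((L.mem_list_inl o l k).mpr
          ⟨hlk, SimpleGraph.ConnectedComponent.sound hadj.reachable⟩))
    · exact if_pos (L.mem_list_inr o k)
  · rw [FactorOrder.list, List.nodup_flatMap]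
    refine ⟨fun τ _ => ?_, o.nodup_comps.imp fun {τ τ'} hne => ?_⟩
    · refine List.Nodup.append ((o.nodup_pairs τ).map Sum.inl_injective)
        ((o.nodup_verts τ).map Sum.inr_injective) ?_
      intro a ha hb
      obtain ⟨p, -, rfl⟩ := List.mem_map.mp ha
      obtain ⟨i, -, h⟩ := List.mem_map.mp hb
      cases h
    · intro a ha hb
      rcases List.mem_append.mp ha with ha | ha <;> rcases List.mem_append.mp hb with hb | hb <;>
        obtain ⟨p, hp, rfl⟩ := List.mem_map.mp ha <;> obtain ⟨p', hp', h⟩ := List.mem_map.mp hb <;>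
        cases h
      · exact hne (hdisj (hinl τ p hp).1 (hinl τ' p hp').1)
      · exact hne (hdisj ((o.mem_verts τ p).mp hp) ((o.mem_verts τ' p).mp hp'))
  · rintro ⟨i, j⟩ hp
    exact ((L.mem_list_inl o i j).mp hp).1
  · rw [FactorOrder.list, List.pairwise_flatMap]
    refine ⟨fun τ _ => ?_, o.nodup_comps.imp fun {τ τ'} hne => ?_⟩
    · refine List.pairwise_append.mpr ⟨?_, ?_, ?_⟩
      · exact List.pairwise_map.mpr (List.pairwise_of_forall fun _ _ i p h => nomatch h)
      · exact List.pairwise_map.mpr (List.pairwise_of_forall fun _ _ i p _ h => nomatch h)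
      · intro a ha b hb i p hai
        subst hai
        simp at ha
    · rintro a ha b hb i p rfl rfl
      have hi : i ∈ τ.supp := (o.mem_verts τ i).mp (by simpa using ha)
      have hp := hinl τ' p (by simpa using hb)
      exact ⟨fun h => hne (hdisj hi (h ▸ hp.1)), fun h => hne (hdisj hi (h ▸ hp.2))⟩

end LiftingDatum

end QLS.QuantumLinearSpace

end

theorem mainTheorem9 {K : Type*} [Field K] [CharZero K] {Γ : Type*} [CommGroup Γ] [Finite Γ]
    {θ : ℕ} (W : QLS.QuantumLinearSpace K Γ θ) (L : W.LiftingDatum) (o : L.FactorOrder) :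
    QLS.IsCocycle (QLS.QuantumLinearSpace.Biproduct.groupAlgebra W) (L.cocycle o) ∧
      QLS.TwistIso (L.cocycle o) L.Alg := by
  rw [L.cocycle_eq_defCochain o]
  exact ⟨QLS.QuantumLinearSpace.Biproduct.isCocycle_defCochain L.param, L.twistIso_defCochain⟩
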